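/- Let $N$ be a compact connected smooth $3$-dimensional manifold with boundary $\partial N$ and interior $N^{\rm int}$, let $M=\mathbb R\times N$, and let $g=-\alpha(\mathfrak t,x')\,d\mathfrak t^2+\kappa(\mathfrak t,x')$ be a Lorentzian metric on $M$, where $\alpha\colon M\to(0,\infty)$ is smooth and $\kappa(\mathfrak t,\cdot)$ is a Riemannian metric on $N$ depending smoothly on $\mathfrak t$. A vector is future-pointing if its $\mathfrak t$-component is positive. For $p,q\in M$ write $p\le q$ if $p=q$ or there is a future-pointing causal curve in $M$ from $p$ to $q$, and $p\ll q$ if $p\ne q$ and there is a future-pointing timelike curve in $M$ from $p$ to $q$ (curves are continuous on $[0,1]$ and smooth on $(0,1)$ with causal, respectively timelike, velocity there). Put $J_g(p,q)=\{r\in M: p\le r\le q\}$ and, for $T\in\mathbb R$, $$\mathbb U_g=\bigcup_{p,q\in(0,T)\times\partial N}J_g(p,q).$$ Then for every $q_0\in\mathbb U_g\cap\bigl((0,T)\times N^{\rm int}\bigr)$ there is a future-pointing null geodesic $\mu\colon[0,1]\to M$ with $\mu(0)\in(0,T)\times\partial N$ and $\mu(1)=q_0$ which has no cut points, that is, $\mu(s)\ll\mu(t)$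 holds for no $s,t\in[0,1]$. -/

import Mathlib

open Set Bundle
open scoped Manifold ContDiff

noncomputable section

section Geodesics

variable {E : Type*} [NormedAddCommGroup E] [NormedSpace ℝ E]
  {H : Type*} [TopologicalSpace H] (I : ModelWithCorners ℝ E H)
  {M : Type*} [TopologicalSpace M] [ChartedSpace H M]

/-- Velocity at `s` of a curve `c` with parameter set `S` (one-sided at end points of `S`). -/
def curveVelocity (c : ℝ → M) (S : Set ℝ) (s : ℝ) : TangentSpace I (c s) :=
  mfderivWithin 𝓘(ℝ, ℝ) I c S s (1 : ℝ)

/-- The component `g_y(u, v)` of a field `g` of bilinear forms on the tangent spaces, in the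
coordinates given by the chart at `p`; here `y` is the coordinate vector of the base point. -/
def chartMetric (g : ∀ q : M, TangentSpace I q → TangentSpace I q → ℝ) (p : M) (y u v : E) : ℝ :=
  g ((extChartAt I p).symm y)
    (mfderivWithin 𝓘(ℝ, E) I (extChartAt I p).symm (range I) y u)
    (mfderivWithin 𝓘(ℝ, E) I (extChartAt I p).symm (range I) y v)

/-- Christoffel symbols of the first kind in the chart at `p`:
`Γ(u, v; w) = (∂_u g(v, w) + ∂_v g(u, w) - ∂_w g(u, v)) / 2`. -/
def christoffelFirst (g : ∀ q : M, TangentSpace I q → TangentSpace I q → ℝ)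
    (p : M) (y u v w : E) : ℝ :=
  (fderivWithin ℝ (fun z => chartMetric I g p z v w) (range I) y u
    + fderivWithin ℝ (fun z => chartMetric I g p z u w) (range I) y v
    - fderivWithin ℝ (fun z => chartMetric I g p z u v) (range I) y w) / 2

/-- `c` is a smooth affinely parametrized geodesic of `g` on the parameter set `S`: at every `s`,
`g(∇_{c'} c', w) = 0` for all `w`, which in the chart at `c s` reads
`g(y'', w) + Γ(y', y'; w) = 0`, where `y` is the coordinate expression of `c`. -/
def IsGeodesicOn (g : ∀ q : M, TangentSpace I q → TangentSpace I q → ℝ)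
    (c : ℝ → M) (S : Set ℝ) : Prop :=
  ContMDiffOn 𝓘(ℝ, ℝ) I ∞ c S ∧
    ∀ s ∈ S, ∀ w : E,
      let y : ℝ → E := fun r => extChartAt I (c s) (c r)
      chartMetric I g (c s) (y s) (derivWithin (derivWithin y S) S s) w
        + christoffelFirst I g (c s) (y s) (derivWithin y S s) (derivWithin y S s) w = 0

end Geodesics

/-- Model of the four-dimensional manifold with boundary `ℝ × N`, for `N` a three-dimensional
manifold with boundary. -/
abbrev spacetimeModel : ModelWithCorners ℝ (ℝ × EuclideanSpace ℝ (Fin 3))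
    (ModelProd ℝ (EuclideanHalfSpace 3)) :=
  (𝓘(ℝ, ℝ)).prod (𝓡∂ 3)

/-- The data of a smooth Lorentzian metric `g = -α(t, x) dt² + κ(t, x)` on `ℝ × N`: a smooth
positive function `α`, and Riemannian metrics `κ(t, ·)` on `N` depending smoothly on `t`. -/
structure SplitMetric (N : Type*) [TopologicalSpace N] [ChartedSpace (EuclideanHalfSpace 3) N]
    [IsManifold (𝓡∂ 3) ∞ N] where
  α : ℝ × N → ℝ
  α_pos : ∀ p, 0 < α p
  α_smooth : ContMDiff spacetimeModel 𝓘(ℝ, ℝ) ∞ α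
  κ : ∀ p : ℝ × N, TangentSpace (𝓡∂ 3) p.2 →L[ℝ] TangentSpace (𝓡∂ 3) p.2 →L[ℝ] ℝ
  κ_symm : ∀ p u v, κ p u v = κ p v u
  κ_pos : ∀ p u, u ≠ 0 → 0 < κ p u u
  κ_smooth : ContMDiff spacetimeModel
    ((𝓡∂ 3).prod
      𝓘(ℝ, EuclideanSpace ℝ (Fin 3) →L[ℝ] EuclideanSpace ℝ (Fin 3) →L[ℝ] ℝ)) ∞
    (fun p : ℝ × N => TotalSpace.mk'
      (EuclideanSpace ℝ (Fin 3) →L[ℝ] EuclideanSpace ℝ (Fin 3) →L[ℝ] ℝ)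
      (E := fun x : N => TangentSpace (𝓡∂ 3) x →L[ℝ] TangentSpace (𝓡∂ 3) x →L[ℝ] ℝ) p.2 (κ p))

namespace SplitMetric

variable {N : Type*} [TopologicalSpace N] [ChartedSpace (EuclideanHalfSpace 3) N]
  [IsManifold (𝓡∂ 3) ∞ N] (G : SplitMetric N)

/-- The Lorentzian metric `g = -α dt² + κ` on `ℝ × N`, using `T_(t,x)(ℝ × N) = ℝ × T_x N`. -/
def g (p : ℝ × N) (u v : TangentSpace spacetimeModel p) : ℝ :=
  -G.α p * (u.1 * v.1) + G.κ p u.2 v.2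

/-- Tangent vectors that are causal (non-zero, `g(v, v) ≤ 0`) and point towards increasing `t`. -/
def FutureCausal (p : ℝ × N) (v : TangentSpace spacetimeModel p) : Prop :=
  v ≠ 0 ∧ G.g p v v ≤ 0 ∧ 0 < v.1

/-- Future-pointing timelike tangent vectors. -/
def FutureTimelike (p : ℝ × N) (v : TangentSpace spacetimeModel p) : Prop :=
  G.g p v v < 0 ∧ 0 < v.1

/-- Future-pointing null tangent vectors. -/
def FutureNull (p : ℝ × N) (v : TangentSpace spacetimeModel p) : Prop :=
  v ≠ 0 ∧ G.g p v v = 0 ∧ 0 < v.1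

/-- The curve `c` joins `p` to `q`, parametrized by `[0, 1]`, and is smooth on `(0, 1)` with
velocities satisfying `P`. -/
def Joins (P : ∀ p : ℝ × N, TangentSpace spacetimeModel p → Prop)
    (c : ℝ → ℝ × N) (p q : ℝ × N) : Prop :=
  ContinuousOn c (Icc 0 1) ∧ c 0 = p ∧ c 1 = q ∧
    ContMDiffOn 𝓘(ℝ, ℝ) spacetimeModel ∞ c (Ioo 0 1) ∧
    ∀ s ∈ Ioo (0 : ℝ) 1, P (c s) (curveVelocity spacetimeModel c (Ioo 0 1) s)

/-- The causal relation `p ≤ q`: `p = q`, or a future-pointing causal curve joins `p` to `q`. -/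
def CausalLE (p q : ℝ × N) : Prop :=
  p = q ∨ ∃ c : ℝ → ℝ × N, Joins G.FutureCausal c p q

/-- The chronological relation `p ≪ q`: `p ≠ q`, and a future-pointing timelike curve joins
`p` to `q`. -/
def ChronLT (p q : ℝ × N) : Prop :=
  p ≠ q ∧ ∃ c : ℝ → ℝ × N, Joins G.FutureTimelike c p q

/-- The causal future `J⁺(p)`. -/
def causalFuture (p : ℝ × N) : Set (ℝ × N) := {q | G.CausalLE p q}

/-- The causal past `J⁻(q)`. -/
def causalPast (q : ℝ × N) : Set (ℝ × N) := {p | G.CausalLE p q}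

/-- The causal diamond `J(p, q) = J⁺(p) ∩ J⁻(q)`. -/
def causalDiamond (p q : ℝ × N) : Set (ℝ × N) := G.causalFuture p ∩ G.causalPast q

/-- `𝕌_g`: the union of the `J(p, q)` over all `p, q ∈ (0, T) × ∂N`. -/
def diamondUnion (T : ℝ) : Set (ℝ × N) :=
  ⋃ p ∈ Ioo (0 : ℝ) T ×ˢ (𝓡∂ 3).boundary N, ⋃ q ∈ Ioo (0 : ℝ) T ×ˢ (𝓡∂ 3).boundary N,
    G.causalDiamond p q

/-- `μ : [0, 1] → ℝ × N` is a future-pointing null geodesic. -/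
def IsFutureNullGeodesic (μ : ℝ → ℝ × N) : Prop :=
  IsGeodesicOn spacetimeModel G.g μ (Icc 0 1) ∧
    ∀ s ∈ Icc (0 : ℝ) 1, G.FutureNull (μ s) (curveVelocity spacetimeModel μ (Icc 0 1) s)

/-- The future-pointing null geodesic segment `μ : [0, 1] → ℝ × N` has no cut points. The null cut
point of `μ s` along `μ` is where the points of `μ` begin to be chronologically after `μ s` (that
is, to have positive time separation from `μ s`); so there is no cut point on the segment
when no point of it chronologically precedes another one. -/
def HasNoCutPoints (μ : ℝ → ℝ × N) : Prop :=
  ∀ s ∈ Icc (0 : ℝ) 1, ∀ t ∈ Icc (0 : ℝ) 1, ¬ G.ChronLT (μ s) (μ t)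

end SplitMetric

end

/-!
A causal curve in `ℝ × N` can be parametrized by the time `t`, and it is then a curve in `N` whose
speed for the time-dependent Riemannian metric `h = κ / α` is at most one. The geodesic of the
theorem is a causal curve from the boundary to `q₀` which departs as late as possible.

*Existence.* Smooth causal curves are not closed under limits, so maximization takes place in the
class `SplitMetric.CausalOn`, defined by testing against smooth functions on `N`. This class
contains the smooth causal curves (`CausalOn.of_contMDiffOn`), is stable under concatenation
(`CausalOn.union_Icc`), and is closed under pointwise limits along an ultrafilter, because smooth
functions are uniformly Lipschitz along its members. This yields a curve with the latest departure
(`exists_latest_departure`). It meets the boundary only at its initial point, since otherwise a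
later point of it would be a better departure.

*Slack can be moved to the start.* If some point of a causal curve can be left with a delay and the
final point still be reached in time, then the curve can depart later: run its earlier part with
a delay that grows exponentially, at a rate exceeding the relative rate of change of `h` in time
(`Reach.exists_delay`). So no point of the maximizer can be left with a delay
(`SplitMetric.IsUnimprovable`). In particular there is no timelike curve from a point of it to
another, as a timelike curve can be traversed with a delayed start: there are no cut points.

*Regularity.* In a chart the maximizer is only Lipschitz, and competitors have to stay in the
interior. Varying both the position and the time along it, absence of shortcuts gives `h`-speed one
and the Euler–Lagrange equations almost everywhere (`ae_eulerLagrange_of_no_shortcut`); the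
momentum thus agrees with an absolutely continuous function, and the curve is smooth with
`p' = ½ h_t(V, V) p + ½ h_x(V, V)` for the momentum `p = h(V, ·)`. The right-hand side is bounded,
so this extends to the initial time, where the curve is on the boundary
(`contDiffOn_and_isOptimalMotion_Icc`). No convexity of the boundary is needed.

*The geodesic.* The equation above says that the curve is a null geodesic up to parametrization.
With `q = ½ h_t(V, V)` and `ρ = exp (-∫ q)`, the affine parameter `s` is determined by
`dt/ds = c ρ / α` (`IsUnimprovable.exists_isFutureNullGeodesic`).
-/

noncomputable section

open MeasureTheory Filter Topology

/-! ### Monotonicity, uniform differentiability and smoothness on intervals -/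

/-- A real function that is monotone near every point of a compact interval, relative to that
interval, is monotone on it. -/
theorem monotoneOn_Icc_of_locally {f : ℝ → ℝ} {a b : ℝ}
    (h : ∀ s ∈ Icc a b, ∃ u ∈ 𝓝[Icc a b] s, MonotoneOn f u) : MonotoneOn f (Icc a b) := by
  rcases lt_or_ge b a with hba | hab
  · simp [Icc_eq_empty_of_lt hba, MonotoneOn]
  choose! u hu hmono using h
  have hv : ∀ s ∈ Icc a b, ∃ v, IsOpen v ∧ s ∈ v ∧ v ∩ Icc a b ⊆ u s := fun s hs =>
    mem_nhdsWithin.1 (hu s hs)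
  choose! v hvo hsv hvu using hv
  obtain ⟨t, ht0, htm, ⟨m, hm⟩, htc⟩ := exists_monotone_Icc_subset_open_cover_Icc hab
    (c := fun s : Icc a b => Subtype.val ⁻¹' v s)
    (fun s => (hvo s s.2).preimage continuous_subtype_val)
    (fun s _ => mem_iUnion.2 ⟨s, hsv s s.2⟩)
  have key : ∀ n, MonotoneOn f (Icc a (t n : ℝ)) := by
    intro n
    induction n with
    | zero => rw [ht0]; simp
    | succ n ih =>
      obtain ⟨s, hs⟩ := htc n
      have hle : (t n : ℝ) ≤ t (n + 1) := htm (Nat.le_succ n)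
      have h2 : MonotoneOn f (Icc (t n : ℝ) (t (n + 1))) := by
        refine (hmono s s.2).mono fun x hx => hvu s s.2 ?_
        have hx' : x ∈ Icc a b := ⟨(t n).2.1.trans hx.1, hx.2.trans (t (n + 1)).2.2⟩
        exact ⟨hs (a := ⟨x, hx'⟩) ⟨hx.1, hx.2⟩, hx'⟩
      rw [← Icc_union_Icc_eq_Icc (t n).2.1 hle]
      exact ih.union_right h2 (isGreatest_Icc (t n).2.1) (isLeast_Icc hle)
  have := key m
  rwa [hm m le_rfl] at this

/-- A Lipschitz function with almost everywhere non-negative derivative is monotone. -/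
theorem monotoneOn_of_ae_deriv_nonneg {f : ℝ → ℝ} {a b : ℝ} {K : NNReal}
    (hf : LipschitzOnWith K f (Icc a b))
    (h : ∀ᵐ s, s ∈ Ioo a b → DifferentiableAt ℝ f s → 0 ≤ deriv f s) :
    MonotoneOn f (Icc a b) := by
  intro x hx y hy hxy
  have hac : AbsolutelyContinuousOnInterval f x y := by
    apply LipschitzOnWith.absolutelyContinuousOnInterval (K := K)
    rw [uIcc_of_le hxy]
    exact hf.mono (Icc_subset_Icc hx.1 hy.2)
  have h1 := hac.integral_deriv_eq_sub
  have h2 : 0 ≤ ∫ s in x..y, deriv f s := by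
    apply intervalIntegral.integral_nonneg_of_ae_restrict hxy
    rw [Filter.EventuallyLE, ae_restrict_iff' measurableSet_Icc]
    have e1 : ∀ᵐ s : ℝ, s ≠ x := by simp [ae_iff, measure_singleton]
    have e2 : ∀ᵐ s : ℝ, s ≠ y := by simp [ae_iff, measure_singleton]
    filter_upwards [h, e1, e2] with s hs n1 n2 hxs
    by_cases hd : DifferentiableAt ℝ f s
    · exact hs ⟨lt_of_le_of_lt hx.1 (lt_of_le_of_ne hxs.1 n1.symm),
        lt_of_lt_of_le (lt_of_le_of_ne hxs.2 n2) hy.2⟩ hd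
    · simp [deriv_zero_of_not_differentiableAt hd]
  linarith

/-- First-order expansion of a `C¹` function, uniform over a compact set. -/
theorem IsCompact.exists_uniform_fderiv_approx {V : Type*} [NormedAddCommGroup V]
    [NormedSpace ℝ V] {L : V → ℝ} {O K : Set V} (hO : IsOpen O) (hL : ContDiffOn ℝ 1 L O)
    (hK : IsCompact K) (hKO : K ⊆ O) {η : ℝ} (hη : 0 < η) :
    ∃ δ > 0, ∀ k ∈ K, ∀ u : V, ‖u‖ ≤ δ → |L (k + u) - L k - fderiv ℝ L k u| ≤ η * ‖u‖ := by
  refine hK.induction_on (p := fun S => ∃ δ > 0, ∀ k ∈ S, ∀ u : V, ‖u‖ ≤ δ →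
    |L (k + u) - L k - fderiv ℝ L k u| ≤ η * ‖u‖) ?_ ?_ ?_ ?_
  · exact ⟨1, one_pos, by simp⟩
  · rintro s t hst ⟨δ, hδ, h⟩
    exact ⟨δ, hδ, fun k hk => h k (hst hk)⟩
  · rintro s t ⟨δ, hδ, h⟩ ⟨δ', hδ', h'⟩
    refine ⟨min δ δ', lt_min hδ hδ', ?_⟩
    rintro k (hk | hk) u hu
    · exact h k hk u (hu.trans (min_le_left _ _))
    · exact h' k hk u (hu.trans (min_le_right _ _))
  · intro k hk
    have hkO : O ∈ 𝓝 k := hO.mem_nhds (hKO hk)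
    have hcd : ContDiffAt ℝ 1 L k := hL.contDiffAt hkO
    have hst : HasStrictFDerivAt L (fderiv ℝ L k) k := hcd.hasStrictFDerivAt (by simp)
    have hc : ContinuousAt (fderiv ℝ L) k :=
      (hL.continuousOn_fderiv_of_isOpen hO le_rfl).continuousAt hkO
    have h1 := (hst.isLittleO.def (half_pos hη))
    have h2 : ∀ᶠ z in 𝓝 k, ‖fderiv ℝ L z - fderiv ℝ L k‖ < η / 2 := by
      have := hc.eventually (Metric.ball_mem_nhds _ (half_pos hη))
      filter_upwards [this] with z hz
      simpa [dist_eq_norm] using hz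
    obtain ⟨r, hr, hr1⟩ := Metric.eventually_nhds_iff_ball.1 h1
    obtain ⟨r', hr', hr2⟩ := Metric.eventually_nhds_iff_ball.1 h2
    refine ⟨Metric.ball k (min (r / 2) r'),
      mem_nhdsWithin_of_mem_nhds (Metric.ball_mem_nhds _ (by positivity)), r / 4,
      by positivity, ?_⟩
    intro z hz u hu
    have hz1 : dist z k < r / 2 := lt_of_lt_of_le hz (min_le_left _ _)
    have hz2 : dist z k < r' := lt_of_lt_of_le hz (min_le_right _ _)
    have hzu : dist (z + u) k < r := by
      calc dist (z + u) k ≤ dist (z + u) z + dist z k := dist_triangle _ _ _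
        _ < r / 2 + r / 2 := by
          have : dist (z + u) z = ‖u‖ := by simp [dist_eq_norm]
          rw [this]; linarith
        _ = r := by ring
    have a1 := hr1 (z + u, z) (by
      rw [Metric.mem_ball, Prod.dist_eq]
      exact max_lt hzu (by linarith))
    simp only [add_sub_cancel_left, Real.norm_eq_abs] at a1
    have a2 := hr2 z hz2
    have a3 : |(fderiv ℝ L z - fderiv ℝ L k) u| ≤ η / 2 * ‖u‖ := by
      rw [← Real.norm_eq_abs]
      exact (ContinuousLinearMap.le_opNorm _ _).trans
        (mul_le_mul_of_nonneg_right a2.le (norm_nonneg _))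
    rw [sub_apply] at a3
    have : L (z + u) - L z - fderiv ℝ L z u =
      (L (z + u) - L z - fderiv ℝ L k u) - (fderiv ℝ L z u - fderiv ℝ L k u) := by ring
    rw [this]
    calc _ ≤ _ := abs_sub _ _
      _ ≤ η / 2 * ‖u‖ + η / 2 * ‖u‖ := add_le_add a1 a3
      _ = η * ‖u‖ := by ring

/-- Bootstrapping: a solution of an ordinary differential equation with smooth right-hand side
is smooth. -/
theorem contDiffOn_of_hasDerivWithinAt {F : Type*} [NormedAddCommGroup F] [NormedSpace ℝ F]
    {u : ℝ → F} {S : Set ℝ} (hS : UniqueDiffOn ℝ S) {D : Set (ℝ × F)} {Φ : ℝ × F → F}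
    (hΦ : ContDiffOn ℝ ∞ Φ D) (hD : ∀ s ∈ S, (s, u s) ∈ D)
    (hu : ∀ s ∈ S, HasDerivWithinAt u (Φ (s, u s)) S s) : ContDiffOn ℝ ∞ u S := by
  rw [contDiffOn_infty]
  intro n
  induction n with
  | zero =>
    exact contDiffOn_zero.2 fun s hs => (hu s hs).continuousWithinAt
  | succ n ih =>
    push_cast
    rw [contDiffOn_succ_iff_derivWithin hS]
    refine ⟨fun s hs => (hu s hs).differentiableWithinAt, by simp, ?_⟩
    have h1 : ContDiffOn ℝ n (fun s => Φ (s, u s)) S :=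
      (hΦ.of_le (by exact_mod_cast le_top)).comp (contDiffOn_id.prodMk ih) hD
    exact h1.congr fun s hs => (hu s hs).derivWithin (hS s hs)

/-! ### Shortcuts from variations -/

section Variation

variable {E : Type*} [NormedAddCommGroup E] [NormedSpace ℝ E]

/-- A shortcut for the time-parametrized curve `y` on `[a, b]`: a space-time curve `(τ, z)` in
`ℝ × O` which leaves `y a` at a time later than `a` (but by less than `ζ`), reaches `y b` at time
`b`, and satisfies `L(τ, z, z') ≤ τ'²`. When `L` is a time-dependent Riemannian metric, this says
that `(τ, z)` is a causal curve. -/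
structure IsShortcut (L : ℝ × E × E → ℝ) (O : Set E) (y : ℝ → E) (a b ζ : ℝ)
    (τ : ℝ → ℝ) (z : ℝ → E) : Prop where
  lipschitz_time : ∃ K, LipschitzOnWith K τ (Icc a b)
  lipschitz_space : ∃ K, LipschitzOnWith K z (Icc a b)
  lt_start : a < τ a
  start_lt : τ a < a + ζ
  time_end : τ b = b
  space_start : z a = y a
  space_end : z b = y b
  mem : ∀ s ∈ Icc a b, z s ∈ O
  ae_causal : ∀ᵐ s, s ∈ Ioo a b → ∃ τ' z', HasDerivAt τ τ' s ∧ HasDerivAt z z' s ∧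
    1 / 2 ≤ τ' ∧ L (τ s, z s, z') ≤ τ' ^ 2

/-- If a variation `(ψ, φ)` of a causal curve `y` with a delayed start satisfies the causality
condition strictly to first order (wherever `y` itself has no slack), then the varied curve
`(s + ε ψ, y + ε φ)` is a shortcut for small `ε`. -/
theorem exists_isShortcut_of_variation {L : ℝ × E × E → ℝ} {O : Set E} (hO : IsOpen O)
    (hL : ContDiffOn ℝ 1 L (univ ×ˢ O ×ˢ univ)) [FiniteDimensional ℝ E]
    {y v φ w : ℝ → E} {ψ χ : ℝ → ℝ} {a b M η ζ : ℝ} (hab : a ≤ b) (hζ : 0 < ζ) (hη : 0 < η)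
    (hy : ∃ K, LipschitzOnWith K y (Icc a b)) (hyO : ∀ s ∈ Icc a b, y s ∈ O)
    (hv : ∀ s, ‖v s‖ ≤ M) (hyv : ∀ᵐ s, s ∈ Ioo a b → HasDerivAt y (v s) s)
    (hφ : ∃ K, LipschitzOnWith K φ (Icc a b)) (hφM : ∀ s ∈ Icc a b, ‖φ s‖ ≤ M)
    (hw : ∀ s ∈ Icc a b, ‖w s‖ ≤ M) (hφw : ∀ᵐ s, s ∈ Ioo a b → HasDerivAt φ (w s) s)
    (hφa : φ a = 0) (hφb : φ b = 0)
    (hψ : ∃ K, LipschitzOnWith K ψ (Icc a b)) (hψM : ∀ s ∈ Icc a b, |ψ s| ≤ M)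
    (hχ : ∀ s ∈ Icc a b, |χ s| ≤ M) (hψχ : ∀ᵐ s, s ∈ Ioo a b → HasDerivAt ψ (χ s) s)
    (hψa : 0 < ψ a) (hψb : ψ b = 0)
    (hvar : ∀ᵐ s, s ∈ Ioo a b →
      (L (s, y s, v s) ≤ 1 ∧ fderiv ℝ L (s, y s, v s) (ψ s, φ s, w s) + η ≤ 2 * χ s) ∨
        L (s, y s, v s) ≤ 1 - η) :
    ∃ τ z, IsShortcut L O y a b ζ τ z := by
  obtain ⟨Ky, hKy⟩ := hy
  obtain ⟨Kφ, hKφ⟩ := hφ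
  obtain ⟨Kψ, hKψ⟩ := hψ
  have hM : 0 ≤ M := (norm_nonneg _).trans (hv a)
  set K : Set (ℝ × E × E) := (fun p : ℝ × E => (p.1, y p.1, p.2)) ''
    (Icc a b ×ˢ Metric.closedBall (0 : E) M) with hKdef
  have hKc : IsCompact K := by
    apply (isCompact_Icc.prod (isCompact_closedBall (0 : E) M)).image_of_continuousOn
    refine continuousOn_fst.prodMk (ContinuousOn.prodMk ?_ continuousOn_snd)
    exact hKy.continuousOn.comp continuousOn_fst fun p hp => hp.1
  have hOO : IsOpen ((univ : Set ℝ) ×ˢ O ×ˢ (univ : Set E)) :=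
    isOpen_univ.prod (hO.prod isOpen_univ)
  have hKO : K ⊆ univ ×ˢ O ×ˢ univ := by
    rintro _ ⟨p, hp, rfl⟩
    exact ⟨mem_univ _, hyO _ hp.1, mem_univ _⟩
  have hmem : ∀ s ∈ Icc a b, (s, y s, v s) ∈ K := fun s hs =>
    ⟨(s, v s), ⟨hs, by simpa using hv s⟩, rfl⟩
  -- Bound for the derivative of `L` along the curve.
  obtain ⟨CL, hCL⟩ : ∃ C, ∀ k ∈ K, ‖fderiv ℝ L k‖ ≤ C :=
    hKc.exists_bound_of_continuousOn
      ((hL.continuousOn_fderiv_of_isOpen hOO le_rfl).mono hKO)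
  have hCL0 : 0 ≤ CL := (norm_nonneg _).trans (hCL _ (hmem a ⟨le_rfl, hab⟩))
  -- With this accuracy, the linearization error of `L` is at most `ε η / 2`, half of the margin.
  set η₁ := η / (2 * (M + 1)) with hη₁
  have hη₁pos : 0 < η₁ := by positivity
  have hη₁M : η₁ * M ≤ η / 2 := by
    rw [hη₁, div_mul_eq_mul_div, div_le_div_iff₀ (by positivity) two_pos]
    nlinarith
  obtain ⟨δ, hδ, happrox⟩ := hKc.exists_uniform_fderiv_approx hOO hL hKO hη₁pos
  obtain ⟨r, hr, hrO⟩ := (isCompact_Icc.image_of_continuousOn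
    hKy.continuousOn).exists_cthickening_subset_open hO
      (by rintro _ ⟨s, hs, rfl⟩; exact hyO s hs)
  -- The conditions on `ε`: validity of the linearization, values in `O`, start before `a + ζ`,
  -- time derivative at least `1 / 2`, and a change of `L` below `η` where there is slack.
  obtain ⟨ε, hε, h1, h2, h3, h4, h5⟩ : ∃ ε > 0, ε * M ≤ δ ∧ ε * M ≤ r ∧ ε * M < ζ ∧
      ε * M ≤ 1 / 2 ∧ ε * (CL * M + η + 2 * M) ≤ η := by
    have key : ∀ c d : ℝ, 0 < d → ∀ᶠ ε in 𝓝[>] (0 : ℝ), ε * c < d := by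
      intro c d hd
      have : Tendsto (fun ε : ℝ => ε * c) (𝓝[>] 0) (𝓝 0) := by
        have : Tendsto (fun ε : ℝ => ε * c) (𝓝 0) (𝓝 (0 * c)) :=
          (continuous_id.mul continuous_const).tendsto 0
        rw [zero_mul] at this
        exact this.mono_left nhdsWithin_le_nhds
      exact this.eventually (gt_mem_nhds hd)
    have := (key M δ hδ).and ((key M r hr).and ((key M ζ hζ).and ((key M (1 / 2)
      (by norm_num)).and ((key (CL * M + η + 2 * M) η hη).and self_mem_nhdsWithin))))
    obtain ⟨ε, e1, e2, e3, e4, e5, e6⟩ := this.exists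
    exact ⟨ε, e6, e1.le, e2.le, e3, e4.le, e5.le⟩
  refine ⟨fun s => s + ε * ψ s, fun s => y s + ε • φ s, ?_, ?_, ?_, ?_, ?_, ?_, ?_, ?_, ?_⟩
  · exact ⟨1 + ‖ε‖₊ * Kψ, LipschitzWith.id.lipschitzOnWith.add
      (((lipschitzWith_smul ε).comp_lipschitzOnWith hKψ))⟩
  · exact ⟨Ky + ‖ε‖₊ * Kφ, hKy.add ((lipschitzWith_smul ε).comp_lipschitzOnWith hKφ)⟩
  · have := mul_pos hε hψa
    linarith
  · have := hψM a ⟨le_rfl, hab⟩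
    have := mul_le_mul_of_nonneg_left (le_of_abs_le this) hε.le
    linarith
  · simp [hψb]
  · simp [hφa]
  · simp [hφb]
  · intro s hs
    apply hrO
    refine Metric.mem_cthickening_of_dist_le _ (y s) _ _ (mem_image_of_mem _ hs) ?_
    simp only [dist_self_add_left, norm_smul, Real.norm_eq_abs, abs_of_pos hε]
    exact (mul_le_mul_of_nonneg_left (hφM s hs) hε.le).trans h2
  · filter_upwards [hyv, hφw, hψχ, hvar] with s g1 g2 g3 g4 hs
    have hs' : s ∈ Icc a b := Ioo_subset_Icc_self hs
    have hχs := abs_le.1 (hχ s hs')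
    have hεχ : |ε * χ s| ≤ ε * M := by
      rw [abs_mul, abs_of_pos hε]; exact mul_le_mul_of_nonneg_left (hχ s hs') hε.le
    refine ⟨1 + ε * χ s, v s + ε • w s, (hasDerivAt_id s).add ((g3 hs).const_mul ε),
      (g1 hs).add ((g2 hs).const_smul ε), ?_, ?_⟩
    · linarith [(abs_le.1 hεχ).1]
    · set u : ℝ × E × E := (ψ s, φ s, w s) with hu
      have hun : ‖u‖ ≤ M := by
        simp only [hu, Prod.norm_mk, sup_le_iff]
        exact ⟨hψM s hs', hφM s hs', hw s hs'⟩
      have hεu : ‖ε • u‖ ≤ ε * M := by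
        rw [norm_smul, Real.norm_eq_abs, abs_of_pos hε]
        exact mul_le_mul_of_nonneg_left hun hε.le
      have happ := happrox _ (hmem s hs') (ε • u) (hεu.trans h1)
      have hk : ((s, y s, v s) : ℝ × E × E) + ε • u
          = (s + ε * ψ s, y s + ε • φ s, v s + ε • w s) := by simp [hu]
      rw [hk, map_smul, smul_eq_mul] at happ
      have happ' := (abs_le.1 happ).2
      have hrem : η₁ * ‖ε • u‖ ≤ ε * (η / 2) := by
        calc η₁ * ‖ε • u‖ ≤ η₁ * (ε * M) := mul_le_mul_of_nonneg_left hεu hη₁pos.le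
          _ = ε * (η₁ * M) := by ring
          _ ≤ _ := mul_le_mul_of_nonneg_left hη₁M hε.le
      have hsq : 1 + 2 * (ε * χ s) ≤ (1 + ε * χ s) ^ 2 := by nlinarith [sq_nonneg (ε * χ s)]
      refine le_trans ?_ hsq
      rcases g4 hs with ⟨c1, c2⟩ | c
      · have := mul_le_mul_of_nonneg_left c2 hε.le
        nlinarith
      · have hD : fderiv ℝ L (s, y s, v s) u ≤ CL * M :=
          (le_abs_self _).trans ((ContinuousLinearMap.le_opNorm _ _).trans
            (mul_le_mul (hCL _ (hmem s hs')) hun (norm_nonneg _) hCL0))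
        have := mul_le_mul_of_nonneg_left hD hε.le
        have := (abs_le.1 hεχ).1
        nlinarith

end Variation

/-! ### Primitives of bounded functions and partial gradients -/

section EulerLagrange

theorem intervalIntegrable_of_measurable_of_bounded {F : Type*} [NormedAddCommGroup F]
    [MeasurableSpace F] [BorelSpace F] [SecondCountableTopology F]
    {f : ℝ → F} {C : ℝ} (hf : Measurable f) (hb : ∀ s, ‖f s‖ ≤ C) (x y : ℝ) :
    IntervalIntegrable f volume x y :=
  (intervalIntegrable_const (c := C)).mono_fun' hf.aestronglyMeasurable
    (Eventually.of_forall hb)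

/-- The primitive of a bounded measurable function, stopped outside `[a, b]`. -/
def clampedPrimitive {F : Type*} [NormedAddCommGroup F] [NormedSpace ℝ F] {a b : ℝ} (hab : a ≤ b)
    (f : ℝ → F) (s : ℝ) : F := ∫ r in a..(projIcc a b hab s : ℝ), f r

section Primitive

variable {F : Type*} [NormedAddCommGroup F] [NormedSpace ℝ F] {a b : ℝ} (hab : a ≤ b) {f : ℝ → F}
  {C : ℝ}

theorem clampedPrimitive_of_mem {s : ℝ} (hs : s ∈ Icc a b) :
    clampedPrimitive hab f s = ∫ r in a..s, f r := by
  rw [clampedPrimitive, projIcc_of_mem hab hs]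

theorem clampedPrimitive_left : clampedPrimitive hab f a = 0 := by
  simp [clampedPrimitive]

theorem norm_clampedPrimitive_le (hb : ∀ s, ‖f s‖ ≤ C) (s : ℝ) :
    ‖clampedPrimitive hab f s‖ ≤ C * (b - a) := by
  have h := intervalIntegral.norm_integral_le_of_norm_le_const (a := a)
    (b := (projIcc a b hab s : ℝ)) (f := f) (C := C) fun x _ => hb x
  refine h.trans (mul_le_mul_of_nonneg_left ?_ ((norm_nonneg _).trans (hb 0)))
  have := (projIcc a b hab s).2
  rw [abs_of_nonneg (by linarith [this.1])]
  linarith [this.2]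

variable [MeasurableSpace F] [BorelSpace F] [SecondCountableTopology F]

theorem lipschitzWith_clampedPrimitive (hf : Measurable f) (hb : ∀ s, ‖f s‖ ≤ C) :
    LipschitzWith C.toNNReal (clampedPrimitive hab f) := by
  have hC : 0 ≤ C := (norm_nonneg _).trans (hb 0)
  have h1 : LipschitzWith C.toNNReal fun x : ℝ => ∫ r in a..x, f r := by
    refine LipschitzWith.of_dist_le_mul fun x y => ?_
    rw [dist_eq_norm, intervalIntegral.integral_interval_sub_left
      (intervalIntegrable_of_measurable_of_bounded hf hb _ _)
      (intervalIntegrable_of_measurable_of_bounded hf hb _ _), Real.coe_toNNReal _ hC]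
    exact intervalIntegral.norm_integral_le_of_norm_le_const fun x _ => hb x
  have h2 : LipschitzWith 1 fun s : ℝ => (projIcc a b hab s : ℝ) := by
    have : LipschitzWith 1 (projIcc a b hab) := LipschitzWith.projIcc hab
    exact this
  have h3 := h1.comp h2
  rwa [mul_one] at h3

theorem ae_hasDerivAt_clampedPrimitive [CompleteSpace F] (hf : Measurable f)
    (hb : ∀ s, ‖f s‖ ≤ C) :
    ∀ᵐ s, s ∈ Ioo a b → HasDerivAt (clampedPrimitive hab f) (f s) s := by
  have h := (intervalIntegrable_of_measurable_of_bounded hf hb a b).ae_hasDerivAt_integral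
  filter_upwards [h] with s hs hs'
  have hs'' : s ∈ uIcc a b := by rw [uIcc_of_le hab]; exact Ioo_subset_Icc_self hs'
  refine (hs hs'' a left_mem_uIcc).congr_of_eventuallyEq ?_
  filter_upwards [Ioo_mem_nhds hs'.1 hs'.2] with r hr
  exact clampedPrimitive_of_mem hab (Ioo_subset_Icc_self hr)

end Primitive

variable {E : Type*} [NormedAddCommGroup E] [InnerProductSpace ℝ E]
/-- The time component of the derivative of a Lagrangian. -/
def timeGrad (L : ℝ × E × E → ℝ) (k : ℝ × E × E) : ℝ := fderiv ℝ L k (1, 0, 0)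

theorem continuousOn_timeGrad {L : ℝ × E × E → ℝ} {O : Set (ℝ × E × E)} (hO : IsOpen O)
    (hL : ContDiffOn ℝ 1 L O) : ContinuousOn (timeGrad L) O :=
  (hL.continuousOn_fderiv_of_isOpen hO le_rfl).clm_apply continuousOn_const

variable [FiniteDimensional ℝ E]

/-- The position gradient of a Lagrangian. -/
def posGrad (L : ℝ × E × E → ℝ) (k : ℝ × E × E) : E :=
  (InnerProductSpace.toDual ℝ E).symm
    ((fderiv ℝ L k).comp ((ContinuousLinearMap.inr ℝ ℝ (E × E)).comp
      (ContinuousLinearMap.inl ℝ E E)))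

/-- The velocity gradient of a Lagrangian. -/
def velGrad (L : ℝ × E × E → ℝ) (k : ℝ × E × E) : E :=
  (InnerProductSpace.toDual ℝ E).symm
    ((fderiv ℝ L k).comp ((ContinuousLinearMap.inr ℝ ℝ (E × E)).comp
      (ContinuousLinearMap.inr ℝ E E)))

theorem inner_posGrad (L : ℝ × E × E → ℝ) (k : ℝ × E × E) (u : E) :
    inner ℝ (posGrad L k) u = fderiv ℝ L k (0, u, 0) := by
  simp [posGrad]

theorem inner_velGrad (L : ℝ × E × E → ℝ) (k : ℝ × E × E) (u : E) :
    inner ℝ (velGrad L k) u = fderiv ℝ L k (0, 0, u) := by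
  simp [velGrad]

theorem fderiv_eq_grads (L : ℝ × E × E → ℝ) (k : ℝ × E × E) (r : ℝ) (u w : E) :
    fderiv ℝ L k (r, u, w)
      = timeGrad L k * r + inner ℝ (posGrad L k) u + inner ℝ (velGrad L k) w := by
  rw [inner_posGrad, inner_velGrad, timeGrad]
  have : ((r, u, w) : ℝ × E × E) = r • (1, 0, 0) + (0, u, 0) + (0, 0, w) := by simp
  rw [this, map_add, map_add, map_smul, smul_eq_mul, mul_comm]

theorem continuousOn_posGrad {L : ℝ × E × E → ℝ} {O : Set (ℝ × E × E)} (hO : IsOpen O)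
    (hL : ContDiffOn ℝ 1 L O) : ContinuousOn (posGrad L) O := by
  have : Continuous fun A : ℝ × E × E →L[ℝ] ℝ => (InnerProductSpace.toDual ℝ E).symm
    (A.comp ((ContinuousLinearMap.inr ℝ ℝ (E × E)).comp (ContinuousLinearMap.inl ℝ E E))) := by
    fun_prop
  exact this.comp_continuousOn (hL.continuousOn_fderiv_of_isOpen hO le_rfl)

theorem continuousOn_velGrad {L : ℝ × E × E → ℝ} {O : Set (ℝ × E × E)} (hO : IsOpen O)
    (hL : ContDiffOn ℝ 1 L O) : ContinuousOn (velGrad L) O := by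
  have : Continuous fun A : ℝ × E × E →L[ℝ] ℝ => (InnerProductSpace.toDual ℝ E).symm
    (A.comp ((ContinuousLinearMap.inr ℝ ℝ (E × E)).comp (ContinuousLinearMap.inr ℝ E E))) := by
    fun_prop
  exact this.comp_continuousOn (hL.continuousOn_fderiv_of_isOpen hO le_rfl)

variable [MeasurableSpace E] [BorelSpace E]

theorem measurable_timeGrad (L : ℝ × E × E → ℝ) : Measurable (timeGrad L) :=
  measurable_fderiv_apply_const ℝ L _

theorem measurable_posGrad (L : ℝ × E × E → ℝ) : Measurable (posGrad L) := by
  have : Continuous fun A : ℝ × E × E →L[ℝ] ℝ => (InnerProductSpace.toDual ℝ E).symm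
    (A.comp ((ContinuousLinearMap.inr ℝ ℝ (E × E)).comp (ContinuousLinearMap.inl ℝ E E))) := by
    fun_prop
  exact this.measurable.comp (measurable_fderiv ℝ L)

theorem measurable_velGrad (L : ℝ × E × E → ℝ) : Measurable (velGrad L) := by
  have : Continuous fun A : ℝ × E × E →L[ℝ] ℝ => (InnerProductSpace.toDual ℝ E).symm
    (A.comp ((ContinuousLinearMap.inr ℝ ℝ (E × E)).comp (ContinuousLinearMap.inr ℝ E E))) := by
    fun_prop
  exact this.measurable.comp (measurable_fderiv ℝ L)

end EulerLagrange

/-! ### The Euler–Lagrange equations in integrated form -/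

section EulerLagrange

variable {E : Type*} [NormedAddCommGroup E] [InnerProductSpace ℝ E] [FiniteDimensional ℝ E]
  [MeasurableSpace E] [BorelSpace E]

/-- The product of a Lipschitz function with the exponential of another one is Lipschitz on
`[a, b]`. -/
theorem exists_lipschitzOnWith_mul_exp {F A : ℝ → ℝ} {a b : ℝ} {K K' : NNReal}
    (hF : LipschitzWith K F) (hA : LipschitzWith K' A) :
    ∃ C, LipschitzOnWith C (fun s => F s * Real.exp (A s)) (Icc a b) := by
  have h1 : LocallyLipschitz fun p : ℝ × ℝ => p.1 * Real.exp p.2 := by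
    apply ContDiff.locallyLipschitz (𝕂 := ℝ)
    fun_prop
  have h2 : LocallyLipschitz fun s => F s * Real.exp (A s) :=
    h1.comp (hF.prodMk hA).locallyLipschitz
  exact h2.locallyLipschitzOn.exists_lipschitzOnWith_of_compact isCompact_Icc

/-- The Euler–Lagrange equation in integrated form (with the integrating factor `exp (-A)` which
accounts for the dependence of arrival times on delays), together with `L = 1`, holds almost
everywhere along a causal curve without shortcuts. -/
theorem ae_eulerLagrange_of_no_shortcut {L : ℝ × E × E → ℝ} {O : Set E} (hO : IsOpen O)
    (hL : ContDiffOn ℝ 1 L (univ ×ˢ O ×ˢ univ))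
    {y : ℝ → E} {a b ζ : ℝ} (hab : a < b) (hζ : 0 < ζ)
    (hy : ∃ K, LipschitzOnWith K y (Icc a b)) (hyO : ∀ s ∈ Icc a b, y s ∈ O)
    (hcausal : ∀ᵐ s, s ∈ Ioo a b → ∃ v, HasDerivAt y v s ∧ L (s, y s, v) ≤ 1)
    (hno : ¬ ∃ τ z, IsShortcut L O y a b ζ τ z) :
    ∃ (v : ℝ → E) (c : E),
      (∃ M, ∀ s, ‖v s‖ ≤ M) ∧ (∀ᵐ s, s ∈ Ioo a b → HasDerivAt y (v s) s) ∧
      ContinuousOn (fun s => ∫ r in a..s, 1 / 2 * timeGrad L (r, y r, v r)) (Icc a b) ∧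
      ContinuousOn (fun s => ∫ r in a..s,
        (1 / 2 * Real.exp (-∫ t in a..r, 1 / 2 * timeGrad L (t, y t, v t))) •
          posGrad L (r, y r, v r)) (Icc a b) ∧
      ∀ᵐ s, s ∈ Ioo a b → L (s, y s, v s) = 1 ∧
        (1 / 2 * Real.exp (-∫ r in a..s, 1 / 2 * timeGrad L (r, y r, v r))) •
            velGrad L (s, y s, v s)
          = c + ∫ r in a..s,
            (1 / 2 * Real.exp (-∫ t in a..r, 1 / 2 * timeGrad L (t, y t, v t))) •
              posGrad L (r, y r, v r) := by
  obtain ⟨Ky, hKy⟩ := hy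
  have hab' := hab.le
  -- A bounded measurable version of the velocity.
  set v : ℝ → E := fun s => if s ∈ Ioo a b then deriv y s else 0 with hvdef
  have hvm : Measurable v := (measurable_deriv y).ite measurableSet_Ioo measurable_const
  have hvM : ∀ s, ‖v s‖ ≤ (Ky : ℝ) := by
    intro s
    by_cases hs : s ∈ Ioo a b
    · simp only [hvdef, if_pos hs]
      exact norm_deriv_le_of_lipschitzOn (Icc_mem_nhds hs.1 hs.2) hKy
    · simp only [hvdef, if_neg hs, norm_zero]
      exact Ky.2
  have hyv : ∀ᵐ s, s ∈ Ioo a b → HasDerivAt y (v s) s := by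
    filter_upwards [hcausal] with s hs hs'
    obtain ⟨u, hu, -⟩ := hs hs'
    simp only [hvdef, if_pos hs']
    rw [hu.deriv]; exact hu
  have hcaus : ∀ᵐ s, s ∈ Ioo a b → L (s, y s, v s) ≤ 1 := by
    filter_upwards [hcausal] with s hs hs'
    obtain ⟨u, hu, h⟩ := hs hs'
    simp only [hvdef, if_pos hs']
    rwa [hu.deriv]
  have hyc : Continuous fun s => y (projIcc a b hab' s) :=
    hKy.continuousOn.comp_continuous (continuous_subtype_val.comp continuous_projIcc)
      fun s => (projIcc a b hab' s).2
  -- The jet of `y`, extended to all parameters so that it has values in the compact set `K`.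
  set k : ℝ → ℝ × E × E := fun s => (projIcc a b hab' s, y (projIcc a b hab' s), v s) with hk
  have hks : ∀ s ∈ Icc a b, k s = (s, y s, v s) := by
    intro s hs; simp [hk, projIcc_of_mem hab' hs]
  have hkm : Measurable k :=
    (continuous_subtype_val.comp continuous_projIcc).measurable.prodMk (hyc.measurable.prodMk hvm)
  set K : Set (ℝ × E × E) := (fun p : ℝ × E => (p.1, y p.1, p.2)) ''
    (Icc a b ×ˢ Metric.closedBall (0 : E) Ky) with hKdef
  have hKc : IsCompact K := by
    apply (isCompact_Icc.prod (isCompact_closedBall (0 : E) Ky)).image_of_continuousOn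
    refine continuousOn_fst.prodMk (ContinuousOn.prodMk ?_ continuousOn_snd)
    exact hKy.continuousOn.comp continuousOn_fst fun p hp => hp.1
  have hOO : IsOpen ((univ : Set ℝ) ×ˢ O ×ˢ (univ : Set E)) :=
    isOpen_univ.prod (hO.prod isOpen_univ)
  have hKO : K ⊆ univ ×ˢ O ×ˢ univ := by
    rintro _ ⟨p, hp, rfl⟩
    exact ⟨mem_univ _, hyO _ hp.1, mem_univ _⟩
  have hkK : ∀ s, k s ∈ K := fun s =>
    ⟨(projIcc a b hab' s, v s), ⟨(projIcc a b hab' s).2, by simpa using hvM s⟩, rfl⟩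
  obtain ⟨Ct, hCt⟩ := hKc.exists_bound_of_continuousOn ((continuousOn_timeGrad hOO hL).mono hKO)
  obtain ⟨Cx, hCx⟩ := hKc.exists_bound_of_continuousOn ((continuousOn_posGrad hOO hL).mono hKO)
  obtain ⟨Cv, hCv⟩ := hKc.exists_bound_of_continuousOn ((continuousOn_velGrad hOO hL).mono hKO)
  have hCx0 : 0 ≤ Cx := (norm_nonneg _).trans (hCx _ (hkK 0))
  have hCv0 : 0 ≤ Cv := (norm_nonneg _).trans (hCv _ (hkK 0))
  set q : ℝ → ℝ := fun s => 1 / 2 * timeGrad L (k s) with hq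
  have hqm : Measurable q := ((measurable_timeGrad L).comp hkm).const_mul _
  have hqb : ∀ s, ‖q s‖ ≤ 1 / 2 * Ct := by
    intro s
    simp only [hq, norm_mul]
    have := hCt _ (hkK s)
    rw [show ‖(1 / 2 : ℝ)‖ = 1 / 2 by norm_num]
    linarith
  -- A delay `ψ` enters the first variation of `L` through `2 q ψ`. Writing it as a multiple of
  -- `exp A` with `A' = q` removes this term, and weights the others by `ρ = exp (-A)`.
  set A : ℝ → ℝ := clampedPrimitive hab' q with hA
  have hAlip := lipschitzWith_clampedPrimitive hab' hqm hqb
  have hAd := ae_hasDerivAt_clampedPrimitive hab' hqm hqb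
  set CA : ℝ := 1 / 2 * Ct * (b - a) with hCA
  have hAb : ∀ s, |A s| ≤ CA := norm_clampedPrimitive_le hab' hqb
  set ρ : ℝ → ℝ := fun s => Real.exp (-A s) with hρ
  have hρpos : ∀ s, 0 < ρ s := fun s => Real.exp_pos _
  have hρm : Measurable ρ := (Real.continuous_exp.comp hAlip.continuous.neg).measurable
  have hρb : ∀ s, ρ s ≤ Real.exp CA := fun s =>
    Real.exp_le_exp.2 (by linarith [(abs_le.1 (hAb s)).1])
  have hhalfρ : ∀ s, ‖(1 / 2 * ρ s : ℝ)‖ ≤ 1 / 2 * Real.exp CA := by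
    intro s
    rw [Real.norm_eq_abs, abs_of_pos (by have := hρpos s; positivity)]
    have := hρb s
    linarith
  set X : ℝ → E := fun s => (1 / 2 * ρ s) • posGrad L (k s) with hX
  have hXm : Measurable X := (hρm.const_mul _).smul ((measurable_posGrad L).comp hkm)
  have hXb : ∀ s, ‖X s‖ ≤ 1 / 2 * Real.exp CA * Cx := fun s => by
    rw [hX, norm_smul]
    exact mul_le_mul (hhalfρ s) (hCx _ (hkK s)) (norm_nonneg _) (by positivity)
  set Y : ℝ → E := fun s => (1 / 2 * ρ s) • velGrad L (k s) with hY
  have hYm : Measurable Y := (hρm.const_mul _).smul ((measurable_velGrad L).comp hkm)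
  have hYb : ∀ s, ‖Y s‖ ≤ 1 / 2 * Real.exp CA * Cv := fun s => by
    rw [hY, norm_smul]
    exact mul_le_mul (hhalfρ s) (hCv _ (hkK s)) (norm_nonneg _) (by positivity)
  set P : ℝ → E := clampedPrimitive hab' X with hP
  have hPlip := lipschitzWith_clampedPrimitive hab' hXm hXb
  have hPd := ae_hasDerivAt_clampedPrimitive hab' hXm hXb
  have hPb := norm_clampedPrimitive_le hab' hXb
  -- If `g` dominates the weighted first variation of `L` wherever `y` has no slack, then `∫ g` is
  -- non-negative: otherwise the delay `(G - ∫ g) exp A`, with `G` the primitive of `g`, is positive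
  -- at the start and zero at the end, and gives a shortcut.
  have SC : ∀ (φ w : ℝ → E) (g : ℝ → ℝ) (M η : ℝ), (∃ C, LipschitzOnWith C φ (Icc a b)) →
      (∀ s, ‖φ s‖ ≤ M) → (∀ s, ‖w s‖ ≤ M) → (∀ᵐ s, s ∈ Ioo a b → HasDerivAt φ (w s) s) →
      φ a = 0 → φ b = 0 → Measurable g → (∀ s, ‖g s‖ ≤ M) → 0 < η →
      (∀ᵐ s, s ∈ Ioo a b → (inner ℝ (X s) (φ s) + inner ℝ (Y s) (w s) + η ≤ g s) ∨
        L (k s) ≤ 1 - η) → 0 ≤ ∫ s in a..b, g s := by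
    intro φ w g M η hφl hφM hwM hφw hφa hφb hgm hgM hη hvar
    by_contra! hneg
    apply hno
    set Ig := ∫ s in a..b, g s with hIg
    set G : ℝ → ℝ := clampedPrimitive hab' g with hG
    have hGlip := lipschitzWith_clampedPrimitive hab' hgm hgM
    have hGd := ae_hasDerivAt_clampedPrimitive hab' hgm hgM
    have hGb := norm_clampedPrimitive_le hab' hgM
    set B : ℝ := M * (b - a) + |Ig| with hB
    have hΨb : ∀ s, |G s - Ig| ≤ B := fun s =>
      (abs_sub _ _).trans (add_le_add_left (hGb s) _)
    have hB0 : 0 ≤ B := (abs_nonneg _).trans (hΨb a)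
    have heA : ∀ s, Real.exp (A s) ≤ Real.exp CA := fun s =>
      Real.exp_le_exp.2 (le_of_abs_le (hAb s))
    have hM0 : 0 ≤ M := (norm_nonneg _).trans (hφM a)
    have hψb : ∀ s, |(G s - Ig) * Real.exp (A s)| ≤ B * Real.exp CA := fun s => by
      rw [abs_mul, Real.abs_exp]
      exact mul_le_mul (hΨb s) (heA s) (Real.exp_pos _).le hB0
    have hCt0 : 0 ≤ 1 / 2 * Ct := (norm_nonneg _).trans (hqb 0)
    have hχb : ∀ s, |g s * Real.exp (A s) + (G s - Ig) * (Real.exp (A s) * q s)|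
        ≤ M * Real.exp CA + B * Real.exp CA * (1 / 2 * Ct) := fun s => by
      refine (abs_add_le _ _).trans (add_le_add ?_ ?_)
      · rw [abs_mul, Real.abs_exp]
        exact mul_le_mul (hgM s) (heA s) (Real.exp_pos _).le hM0
      · rw [← mul_assoc, abs_mul]
        exact mul_le_mul (hψb s) (hqb s) (abs_nonneg _) (by positivity)
    set M' := Ky + M + B * Real.exp CA + (M * Real.exp CA + B * Real.exp CA * (1 / 2 * Ct))
      with hM'
    have e1 : 0 ≤ B * Real.exp CA := by positivity
    have e2 : 0 ≤ M * Real.exp CA + B * Real.exp CA * (1 / 2 * Ct) := by positivity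
    have e3 : (0 : ℝ) ≤ Ky := Ky.2
    refine exists_isShortcut_of_variation (φ := φ) (w := w) (v := v)
      (ψ := fun s => (G s - Ig) * Real.exp (A s))
      (χ := fun s => g s * Real.exp (A s) + (G s - Ig) * (Real.exp (A s) * q s))
      (M := M') (η := min η (2 * η * Real.exp (-CA))) hO hL hab' hζ (by positivity)
      ⟨Ky, hKy⟩ hyO (fun s => (hvM s).trans (by linarith)) hyv hφl
      (fun s _ => (hφM s).trans (by linarith)) (fun s _ => (hwM s).trans (by linarith)) hφw hφa hφb
      ?_ (fun s _ => (hψb s).trans (by linarith)) (fun s _ => (hχb s).trans (by linarith))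
      ?_ ?_ ?_ ?_
    · exact exists_lipschitzOnWith_mul_exp (hGlip.sub (LipschitzWith.const Ig)) hAlip
    · filter_upwards [hGd, hAd] with s g1 g2 hs
      exact ((g1 hs).sub_const Ig).mul (g2 hs).exp
    · have : G a = 0 := clampedPrimitive_left hab'
      rw [this]
      exact mul_pos (by linarith) (Real.exp_pos _)
    · have : G b = Ig := clampedPrimitive_of_mem hab' ⟨hab', le_rfl⟩
      simp [this]
    · filter_upwards [hvar, hcaus] with s g1 g2 hs
      rw [← hks s (Ioo_subset_Icc_self hs)] at g2 ⊢
      rcases g1 hs with g1 | g1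
      · refine Or.inl ⟨g2 hs, ?_⟩
        rw [fderiv_eq_grads]
        have r1 : inner ℝ (X s) (φ s) = 1 / 2 * ρ s * inner ℝ (posGrad L (k s)) (φ s) := by
          rw [hX]; simp only [real_inner_smul_left]
        have r2 : inner ℝ (Y s) (w s) = 1 / 2 * ρ s * inner ℝ (velGrad L (k s)) (w s) := by
          rw [hY]; simp only [real_inner_smul_left]
        rw [r1, r2] at g1
        have r3 : ρ s * Real.exp (A s) = 1 := by
          rw [hρ]; simp only; rw [← Real.exp_add]; simp
        have r4 : Real.exp (-CA) ≤ Real.exp (A s) :=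
          Real.exp_le_exp.2 (by linarith [(abs_le.1 (hAb s)).1])
        have r5 : min η (2 * η * Real.exp (-CA)) ≤ 2 * η * Real.exp (A s) :=
          (min_le_right _ _).trans (mul_le_mul_of_nonneg_left r4 (by positivity))
        have r6 : timeGrad L (k s) = 2 * q s := by rw [hq]; ring
        rw [r6]
        have r7 := mul_le_mul_of_nonneg_right g1 (Real.exp_pos (A s)).le
        have r8 : (1 / 2 * ρ s * inner ℝ (posGrad L (k s)) (φ s) +
            1 / 2 * ρ s * inner ℝ (velGrad L (k s)) (w s) + η) * Real.exp (A s)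
            = 1 / 2 * (ρ s * Real.exp (A s)) * (inner ℝ (posGrad L (k s)) (φ s) +
            inner ℝ (velGrad L (k s)) (w s)) + η * Real.exp (A s) := by ring
        rw [r8, r3] at r7
        linarith
      · exact Or.inr (g1.trans (by linarith [min_le_left η (2 * η * Real.exp (-CA))]))
  set m : ℝ → E := fun s => Y s - P s with hm
  have hmm : Measurable m := hYm.sub hPlip.continuous.measurable
  set Cm : ℝ := 1 / 2 * Real.exp CA * Cv + 1 / 2 * Real.exp CA * Cx * (b - a) with hCm
  have hmb : ∀ s, ‖m s‖ ≤ Cm := fun s => (norm_sub_le _ _).trans (add_le_add (hYb s) (hPb s))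
  have hmi := intervalIntegrable_of_measurable_of_bounded hmm hmb a b
  -- The mean value of the weighted momentum minus the primitive of the weighted force.
  set c : E := (b - a)⁻¹ • ∫ s in a..b, m s with hc
  have hlen : 0 < b - a := by linarith
  -- The variation field: minus the primitive of the deviation of the momentum from its mean.
  set w : ℝ → E := fun s => -(m s - c) with hw
  have hwm : Measurable w := (hmm.sub_const c).neg
  have hwb : ∀ s, ‖w s‖ ≤ Cm + ‖c‖ := fun s => by
    rw [hw, norm_neg]
    exact (norm_sub_le _ _).trans (add_le_add_left (hmb s) _)
  have hwi := intervalIntegrable_of_measurable_of_bounded hwm hwb a b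
  have hw0 : ∫ s in a..b, w s = 0 := by
    rw [hw, intervalIntegral.integral_neg, intervalIntegral.integral_sub hmi (by simp),
      intervalIntegral.integral_const, hc, smul_smul, mul_inv_cancel₀ hlen.ne', one_smul, sub_self,
      neg_zero]
  set φ : ℝ → E := clampedPrimitive hab' w with hφ
  have hφlip := lipschitzWith_clampedPrimitive hab' hwm hwb
  have hφd := ae_hasDerivAt_clampedPrimitive hab' hwm hwb
  have hφbd := norm_clampedPrimitive_le hab' hwb
  have hφa : φ a = 0 := clampedPrimitive_left hab'
  have hφb : φ b = 0 := by
    rw [hφ, clampedPrimitive_of_mem hab' ⟨hab', le_rfl⟩, hw0]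
  have hinner_m : ∀ {u v : ℝ → E}, Measurable u → Measurable v →
      Measurable fun s => inner ℝ (u s) (v s) := fun hu hv => hu.inner hv
  set g₀ : ℝ → ℝ := fun s => inner ℝ (X s) (φ s) + inner ℝ (Y s) (w s) with hg₀
  have hφm : Measurable φ := hφlip.continuous.measurable
  have hg₀m : Measurable g₀ := (hinner_m hXm hφm).add (hinner_m hYm hwm)
  set Cg : ℝ := 1 / 2 * Real.exp CA * Cx * ((Cm + ‖c‖) * (b - a))
    + 1 / 2 * Real.exp CA * Cv * (Cm + ‖c‖) with hCg
  have hg₀b : ∀ s, |g₀ s| ≤ Cg := fun s =>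
    (abs_add_le _ _).trans (add_le_add
      ((abs_real_inner_le_norm _ _).trans (mul_le_mul (hXb s) (hφbd s) (norm_nonneg _)
        (by positivity)))
      ((abs_real_inner_le_norm _ _).trans (mul_le_mul (hYb s) (hwb s) (norm_nonneg _)
        (by positivity))))
  have hg₀i := intervalIntegrable_of_measurable_of_bounded hg₀m hg₀b a b
  have hcm : Measurable fun s => inner ℝ c (w s) := hinner_m measurable_const hwm
  have hI1 : ∫ s in a..b, inner ℝ c (w s) = 0 := by
    have := (innerSL ℝ c).intervalIntegral_comp_comm hwi
    simp only [innerSL_apply_apply] at this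
    rw [this, hw0, inner_zero_right]
  have hI2 : ∫ s in a..b, (inner ℝ (X s) (φ s) + inner ℝ (P s) (w s)) = 0 := by
    have hlip : ∃ C, LipschitzOnWith C (fun s => inner ℝ (P s) (φ s)) (Icc a b) := by
      have h1 : LocallyLipschitz fun p : E × E => inner ℝ p.1 p.2 := by
        exact ContDiff.locallyLipschitz (𝕂 := ℝ) (contDiff_fst.inner ℝ contDiff_snd)
      exact (h1.comp (hPlip.prodMk hφlip).locallyLipschitz).locallyLipschitzOn
        |>.exists_lipschitzOnWith_of_compact isCompact_Icc
    obtain ⟨C, hC⟩ := hlip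
    rw [← uIcc_of_le hab'] at hC
    have := hC.absolutelyContinuousOnInterval.integral_deriv_eq_sub
    rw [hφa, hφb, inner_zero_right, inner_zero_right, sub_zero] at this
    rw [← this]
    apply intervalIntegral.integral_congr_ae
    have hb : ∀ᵐ s : ℝ, s ≠ b := by simp [ae_iff, measure_singleton]
    filter_upwards [hPd, hφd, hb] with s h1 h2 h3 hs
    rw [uIoc_of_le hab'] at hs
    have hs' : s ∈ Ioo a b := ⟨hs.1, lt_of_le_of_ne hs.2 h3⟩
    rw [((h1 hs').inner ℝ (h2 hs')).deriv, add_comm]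
  -- After integration by parts, the first variation is minus the variance of `m`.
  have hIφ : ∫ s in a..b, g₀ s = -∫ s in a..b, ‖m s - c‖ ^ 2 := by
    have hPw := (hinner_m hPlip.continuous.measurable hwm)
    have e1 : ∀ s, g₀ s = (inner ℝ (X s) (φ s) + inner ℝ (P s) (w s)) + inner ℝ c (w s)
        - ‖m s - c‖ ^ 2 := by
      intro s
      have : ‖m s - c‖ ^ 2 = - inner ℝ (Y s - P s - c) (w s) := by
        rw [hw, inner_neg_right, neg_neg, ← real_inner_self_eq_norm_sq]
      rw [this, inner_sub_left, inner_sub_left]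
      simp only [hg₀]; ring
    have i2 : IntervalIntegrable (fun s => inner ℝ c (w s)) volume a b :=
      intervalIntegrable_of_measurable_of_bounded (C := ‖c‖ * (Cm + ‖c‖)) hcm
        (fun s => (norm_inner_le_norm _ _).trans
          (mul_le_mul_of_nonneg_left (hwb s) (norm_nonneg _))) a b
    have i3 : IntervalIntegrable (fun s => ‖m s - c‖ ^ 2) volume a b := by
      refine intervalIntegrable_of_measurable_of_bounded (C := (Cm + ‖c‖) ^ 2)
        ((hmm.sub_const c).norm.pow_const 2) (fun s => ?_) a b
      rw [Real.norm_eq_abs, abs_of_nonneg (by positivity)]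
      have := hwb s
      rw [hw, norm_neg] at this
      gcongr
    have i1 : IntervalIntegrable (fun s => inner ℝ (X s) (φ s) + inner ℝ (P s) (w s))
        volume a b := by
      have : (fun s => inner ℝ (X s) (φ s) + inner ℝ (P s) (w s))
          = fun s => g₀ s - inner ℝ c (w s) + ‖m s - c‖ ^ 2 := by
        ext s; rw [e1 s]; ring
      rw [this]
      exact (hg₀i.sub i2).add i3
    simp_rw [e1]
    rw [intervalIntegral.integral_sub (i1.add i2) i3, intervalIntegral.integral_add i1 i2, hI1, hI2]
    ring
  have hsq0 : ∫ s in a..b, ‖m s - c‖ ^ 2 = 0 := by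
    refine le_antisymm ?_ (intervalIntegral.integral_nonneg hab' fun s _ => by positivity)
    by_contra! hpos
    set η := (∫ s in a..b, ‖m s - c‖ ^ 2) / (2 * (b - a)) with hη
    have hη0 : 0 < η := by positivity
    have hCmc : 0 ≤ Cm + ‖c‖ := (norm_nonneg _).trans (hwb a)
    have hCg0 : 0 ≤ Cg := (abs_nonneg _).trans (hg₀b a)
    have := SC φ w (fun s => g₀ s + η) (Cg + η + (Cm + ‖c‖) * (b - a) + (Cm + ‖c‖)) η
      ⟨_, hφlip.lipschitzOnWith⟩ (fun s => (hφbd s).trans (by linarith))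
      (fun s => (hwb s).trans (by have : 0 ≤ (Cm + ‖c‖) * (b - a) := by positivity
                                  linarith)) hφd hφa hφb (hg₀m.add_const _)
      (fun s => (norm_add_le _ _).trans (by
        have : 0 ≤ (Cm + ‖c‖) * (b - a) := by positivity
        have h1 := hg₀b s
        rw [Real.norm_eq_abs, Real.norm_eq_abs, abs_of_pos hη0]
        linarith)) hη0
      (Eventually.of_forall fun s _ => Or.inl le_rfl)
    rw [intervalIntegral.integral_add hg₀i (by simp), hIφ, intervalIntegral.integral_const,
      smul_eq_mul] at this
    have e : (b - a) * η = (∫ s in a..b, ‖m s - c‖ ^ 2) / 2 := by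
      rw [hη]; field_simp
    rw [e] at this
    linarith
  have hmc : ∀ᵐ s, s ∈ Ioo a b → m s = c := by
    have i3 : IntervalIntegrable (fun s => ‖m s - c‖ ^ 2) volume a b := by
      refine intervalIntegrable_of_measurable_of_bounded (C := (Cm + ‖c‖) ^ 2)
        ((hmm.sub_const c).norm.pow_const 2) (fun s => ?_) a b
      rw [Real.norm_eq_abs, abs_of_nonneg (by positivity)]
      have := hwb s
      rw [hw, norm_neg] at this
      gcongr
    have := (intervalIntegral.integral_eq_zero_iff_of_le_of_nonneg_ae hab'
      (Eventually.of_forall fun s => by positivity) i3).1 hsq0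
    rw [Filter.EventuallyEq, ae_restrict_iff' measurableSet_Ioc] at this
    filter_upwards [this] with s hs hs'
    have := hs (Ioo_subset_Ioc_self hs')
    simpa [sub_eq_zero] using this
  -- Otherwise `y` could be traversed faster on a set `B` of positive measure.
  have hL1 : ∀ᵐ s, s ∈ Ioo a b → 1 ≤ L (s, y s, v s) := by
    have hLk : Measurable fun s => L (k s) :=
      (hL.continuousOn.domRestrict).measurable.comp
        (hkm.subtype_mk (h := fun s => hKO (hkK s)))
    have key : ∀ n : ℕ, ∀ᵐ s, s ∈ Ioo a b → 1 - 1 / ((n : ℝ) + 1) < L (k s) := by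
      intro n
      set η : ℝ := 1 / ((n : ℝ) + 1) with hη
      have hη0 : 0 < η := by positivity
      set B : Set ℝ := Ioo a b ∩ {s | L (k s) ≤ 1 - η} with hB
      have hBm : MeasurableSet B := measurableSet_Ioo.inter (hLk measurableSet_Iic)
      have hBfin : volume B ≠ ⊤ :=
        ((measure_mono inter_subset_left).trans_lt measure_Ioo_lt_top).ne
      by_contra hcon
      have hBpos : 0 < volume.real B := by
        rw [measureReal_def]
        refine ENNReal.toReal_pos (fun h0 => hcon ?_) hBfin
        filter_upwards [measure_eq_zero_iff_ae_notMem.1 h0] with s hs hs'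
        by_contra! hle
        exact hs ⟨hs', hle⟩
      -- Speeding up on `B` by the amount `R` outweighs the loss of `η` elsewhere.
      set R : ℝ := (η * (b - a) + 1) / volume.real B with hR
      have hR0 : 0 < R := by positivity
      have hgm : Measurable fun s => η - B.indicator (fun _ => R) s :=
        measurable_const.sub (measurable_const.indicator hBm)
      have hgb : ∀ s, ‖η - B.indicator (fun _ => R) s‖ ≤ η + R := fun s => by
        refine (norm_sub_le _ _).trans (add_le_add ?_ ?_)
        · rw [Real.norm_eq_abs, abs_of_pos hη0]
        · refine (norm_indicator_le_norm_self _ _).trans ?_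
          rw [Real.norm_eq_abs, abs_of_pos hR0]
      have := SC 0 0 (fun s => η - B.indicator (fun _ => R) s) (η + R) η
        ⟨0, (LipschitzWith.const (0 : E)).lipschitzOnWith⟩ (by simp; positivity)
        (by simp; positivity) (Eventually.of_forall fun s _ => hasDerivAt_const s (0 : E)) rfl rfl
        hgm hgb hη0 (Eventually.of_forall fun s hs => by
          by_cases hsB : s ∈ B
          · exact Or.inr hsB.2
          · left; simp [hsB])
      have hind : ∫ s in a..b, B.indicator (fun _ => R) s = R * volume.real B := by
        have hsub : B ∩ Ioc a b = B :=
          inter_eq_left.2 (inter_subset_left.trans Ioo_subset_Ioc_self)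
        rw [intervalIntegral.integral_of_le hab', integral_indicator hBm,
          Measure.restrict_restrict hBm, hsub, setIntegral_const, smul_eq_mul, mul_comm]
      rw [intervalIntegral.integral_sub (by simp)
        (intervalIntegrable_of_measurable_of_bounded (C := R) (measurable_const.indicator hBm)
          (fun s => (norm_indicator_le_norm_self _ _).trans (by
            rw [Real.norm_eq_abs, abs_of_pos hR0])) a b), hind,
        intervalIntegral.integral_const, smul_eq_mul, hR, div_mul_cancel₀ _ hBpos.ne'] at this
      linarith
    filter_upwards [ae_all_iff.2 key] with s hs hs'
    rw [← hks s (Ioo_subset_Icc_self hs')]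
    refine le_of_forall_pos_lt_add fun ε hε => ?_
    obtain ⟨n, hn⟩ := exists_nat_one_div_lt hε
    have := hs n hs'
    linarith
  have hAeq : ∀ s ∈ Icc a b, ∫ r in a..s, 1 / 2 * timeGrad L (r, y r, v r) = A s := by
    intro s hs
    rw [hA, clampedPrimitive_of_mem hab' hs]
    refine intervalIntegral.integral_congr fun r hr => ?_
    rw [uIcc_of_le hs.1] at hr
    simp only [hq, hks r ⟨hr.1, hr.2.trans hs.2⟩]
  have hPs : ∀ s ∈ Icc a b, ∫ r in a..s,
      (1 / 2 * Real.exp (-∫ t in a..r, 1 / 2 * timeGrad L (t, y t, v t))) •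
              posGrad L (r, y r, v r) = P s := by
    intro s hs'
    rw [hP, clampedPrimitive_of_mem hab' hs']
    refine intervalIntegral.integral_congr fun r hr => ?_
    rw [uIcc_of_le hs'.1] at hr
    have hr' : r ∈ Icc a b := ⟨hr.1, hr.2.trans hs'.2⟩
    simp only [hX, hρ, hks r hr', hAeq r hr']
  refine ⟨v, c, ⟨Ky, hvM⟩, hyv, hAlip.continuous.continuousOn.congr hAeq,
    hPlip.continuous.continuousOn.congr hPs, ?_⟩
  filter_upwards [hL1, hcaus, hmc] with s h1 h2 h3 hs
  have hs' := Ioo_subset_Icc_self hs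
  refine ⟨le_antisymm (h2 hs) (h1 hs), ?_⟩
  rw [hPs s hs', hAeq s hs', ← h3 hs]
  simp only [hm, hY, hρ, hks s hs', sub_add_cancel]

end EulerLagrange

/-! ### Equations of motion for metrics -/

section Classical

set_option maxSynthPendingDepth 5
set_option synthInstance.maxHeartbeats 200000

section Inverse

variable {E : Type*} [NormedAddCommGroup E] [InnerProductSpace ℝ E] [FiniteDimensional ℝ E]

/-- A positive definite bilinear form is an isomorphism onto the dual space. -/
theorem exists_equiv_of_posDef {B : E →L[ℝ] E →L[ℝ] ℝ} (hB : ∀ v, v ≠ 0 → 0 < B v v) :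
    ∃ e : E ≃L[ℝ] (E →L[ℝ] ℝ), (e : E →L[ℝ] E →L[ℝ] ℝ) = B := by
  have hinj : Function.Injective (B : E →ₗ[ℝ] E →L[ℝ] ℝ) := by
    rw [injective_iff_map_eq_zero]
    intro v hv
    by_contra hne
    have h1 := hB v hne
    have h2 : B v = 0 := hv
    rw [h2] at h1
    simp at h1
  have hdim : Module.finrank ℝ E = Module.finrank ℝ (E →L[ℝ] ℝ) :=
    (InnerProductSpace.toDual ℝ E).toLinearEquiv.finrank_eq
  have : FiniteDimensional ℝ (E →L[ℝ] ℝ) :=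
    (InnerProductSpace.toDual ℝ E).toLinearEquiv.finiteDimensional
  refine ⟨(LinearEquiv.ofInjectiveOfFinrankEq (B : E →ₗ[ℝ] E →L[ℝ] ℝ) hinj
    hdim).toContinuousLinearEquiv, ?_⟩
  ext v w
  rfl

theorem apply_inverse_of_posDef {B : E →L[ℝ] E →L[ℝ] ℝ} (hB : ∀ v, v ≠ 0 → 0 < B v v)
    (p : E →L[ℝ] ℝ) : B (B.inverse p) = p := by
  obtain ⟨e, rfl⟩ := exists_equiv_of_posDef hB
  simp

theorem inverse_apply_of_posDef {B : E →L[ℝ] E →L[ℝ] ℝ} (hB : ∀ v, v ≠ 0 → 0 < B v v)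
    (v : E) : B.inverse (B v) = v := by
  obtain ⟨e, rfl⟩ := exists_equiv_of_posDef hB
  simp

end Inverse

variable {E : Type*} [NormedAddCommGroup E] [InnerProductSpace ℝ E]

/-- Half of the time derivative of the energy `h(t, x)(v, v)`. -/
def halfTimeDeriv (h : ℝ × E → E →L[ℝ] E →L[ℝ] ℝ) (D : Set (ℝ × E)) (t : ℝ) (x v : E) : ℝ :=
  1 / 2 * fderivWithin ℝ h D (t, x) (1, 0) v v

/-- Half of the position differential of the energy `h(t, x)(v, v)`. -/
def halfPosDeriv (h : ℝ × E → E →L[ℝ] E →L[ℝ] ℝ) (D : Set (ℝ × E)) (t : ℝ) (x v : E) :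
    E →L[ℝ] ℝ :=
  (1 / 2 : ℝ) • ((ContinuousLinearMap.apply ℝ ℝ v).comp ((ContinuousLinearMap.apply ℝ _ v).comp
    ((fderivWithin ℝ h D (t, x)).comp (ContinuousLinearMap.inr ℝ ℝ E))))

theorem halfPosDeriv_apply (h : ℝ × E → E →L[ℝ] E →L[ℝ] ℝ) (D : Set (ℝ × E)) (t : ℝ) (x v u : E) :
    halfPosDeriv h D t x v u = 1 / 2 * fderivWithin ℝ h D (t, x) (0, u) v v := by
  simp [halfPosDeriv]

/-- The classical Euler–Lagrange equations of a null optimal curve on a set `S` of times: `V` is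
the velocity, has unit length, and the momentum `h(s, y)(V, ·)` obeys
`p' = ½ h_t(V, V) p + ½ h_x(V, V)`. -/
structure IsOptimalMotion (h : ℝ × E → E →L[ℝ] E →L[ℝ] ℝ) (D : Set (ℝ × E)) (y V : ℝ → E)
    (S : Set ℝ) : Prop where
  hasDeriv : ∀ s ∈ S, HasDerivWithinAt y (V s) S s
  unit : ∀ s ∈ S, h (s, y s) (V s) (V s) = 1
  momentum : ∀ s ∈ S, HasDerivWithinAt (fun r => h (r, y r) (V r))
    (halfTimeDeriv h D s (y s) (V s) • h (s, y s) (V s) + halfPosDeriv h D s (y s) (V s)) S s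

/-- The vector field on phase space whose integral curves `(y, p)` are the optimal motions. -/
def optimalField (h : ℝ × E → E →L[ℝ] E →L[ℝ] ℝ) (D : Set (ℝ × E)) :
    ℝ × (E × (E →L[ℝ] ℝ)) → E × (E →L[ℝ] ℝ) := fun k =>
  ((h (k.1, k.2.1)).inverse k.2.2,
    halfTimeDeriv h D k.1 k.2.1 ((h (k.1, k.2.1)).inverse k.2.2) • k.2.2 +
      halfPosDeriv h D k.1 k.2.1 ((h (k.1, k.2.1)).inverse k.2.2))

variable {h : ℝ × E → E →L[ℝ] E →L[ℝ] ℝ} {T : Set E}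

theorem hasDerivWithinAt_primitive {F : Type*} [NormedAddCommGroup F] [NormedSpace ℝ F]
    [CompleteSpace F] {f : ℝ → F} {a b : ℝ} (hf : ContinuousOn f (Icc a b)) {s : ℝ}
    (hs : s ∈ Icc a b) : HasDerivWithinAt (fun s => ∫ r in a..s, f r) (f s) (Icc a b) s := by
  have hab : a ≤ b := hs.1.trans hs.2
  have hc : Continuous fun s => f (projIcc a b hab s) :=
    hf.comp_continuous (continuous_subtype_val.comp continuous_projIcc)
      fun s => (projIcc a b hab s).2
  have h1 := (hc.integral_hasStrictDerivAt a s).hasDerivAt.hasDerivWithinAt (s := Icc a b)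
  simp only [projIcc_of_mem hab hs] at h1
  have heq : ∀ t ∈ Icc a b, ∫ r in a..t, f r = ∫ r in a..t, f (projIcc a b hab r) := by
    intro t ht
    refine intervalIntegral.integral_congr fun r hr => ?_
    rw [uIcc_of_le ht.1] at hr
    simp only [projIcc_of_mem hab (⟨hr.1, hr.2.trans ht.2⟩ : r ∈ Icc a b)]
  exact h1.congr heq (heq s hs)

theorem intervalIntegral_congr_of_ae_Ioo {F : Type*} [NormedAddCommGroup F] [NormedSpace ℝ F]
    {f g : ℝ → F} {a b : ℝ} (h : ∀ᵐ r, r ∈ Ioo a b → f r = g r) {s : ℝ} (hs : s ∈ Icc a b) :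
    ∫ r in a..s, f r = ∫ r in a..s, g r := by
  have hbne : ∀ᵐ s : ℝ, s ≠ b := by simp [ae_iff, measure_singleton]
  apply intervalIntegral.integral_congr_ae
  filter_upwards [h, hbne] with r h1 h2 hr
  rw [uIoc_of_le hs.1] at hr
  exact h1 ⟨hr.1, lt_of_le_of_ne (hr.2.trans hs.2) h2⟩

theorem fderiv_energy (hsymm : ∀ k ∈ (univ : Set ℝ) ×ˢ T, ∀ u v, h k u v = h k v u)
    (hh : ContDiffOn ℝ ∞ h (univ ×ˢ T)) {t : ℝ} {x : E} (hx : x ∈ interior T) (v : E)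
    (r : ℝ) (u w : E) :
    fderiv ℝ (fun k : ℝ × E × E => h (k.1, k.2.1) k.2.2 k.2.2) (t, x, v) (r, u, w)
      = fderivWithin ℝ h (univ ×ˢ T) (t, x) (r, u) v v + 2 * h (t, x) v w := by
  have hnhds : (univ : Set ℝ) ×ˢ T ∈ 𝓝 (t, x) :=
    prod_mem_nhds univ_mem (mem_interior_iff_mem_nhds.1 hx)
  have h1 : HasFDerivAt h (fderivWithin ℝ h (univ ×ˢ T) (t, x)) (t, x) := by
    rw [fderivWithin_of_mem_nhds hnhds]
    exact ((hh.contDiffAt hnhds).differentiableAt (by simp)).hasFDerivAt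
  have h2 : HasFDerivAt (fun k : ℝ × E × E => (k.1, k.2.1))
      ((ContinuousLinearMap.fst ℝ ℝ (E × E)).prod ((ContinuousLinearMap.fst ℝ E E).comp
        (ContinuousLinearMap.snd ℝ ℝ (E × E)))) (t, x, v) :=
    hasFDerivAt_fst.prodMk (hasFDerivAt_fst.comp _ hasFDerivAt_snd)
  have h3 : HasFDerivAt (fun k : ℝ × E × E => k.2.2) ((ContinuousLinearMap.snd ℝ E E).comp
        (ContinuousLinearMap.snd ℝ ℝ (E × E))) (t, x, v) :=
    hasFDerivAt_snd.comp _ hasFDerivAt_snd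
  have h4 : HasFDerivAt (fun k : ℝ × E × E => h (k.1, k.2.1)) _ (t, x, v) :=
    HasFDerivAt.comp (t, x, v) (g := h) (f := fun k : ℝ × E × E => (k.1, k.2.1)) h1 h2
  rw [((h4.clm_apply h3).clm_apply h3).fderiv]
  simp [hsymm (t, x) ⟨mem_univ _, interior_subset hx⟩ w v]
  ring

theorem contDiffOn_energy (hh : ContDiffOn ℝ ∞ h (univ ×ˢ T)) :
    ContDiffOn ℝ ∞ (fun k : ℝ × E × E => h (k.1, k.2.1) k.2.2 k.2.2)
      (univ ×ˢ T ×ˢ univ) := by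
  have h1 : ContDiffOn ℝ ∞ (fun k : ℝ × E × E => h (k.1, k.2.1)) (univ ×ˢ T ×ˢ univ) :=
    hh.comp (t := univ ×ˢ T) (by fun_prop) fun k hk => ⟨mem_univ _, hk.2.1⟩
  exact (h1.clm_apply (by fun_prop)).clm_apply (by fun_prop)

variable [FiniteDimensional ℝ E]

theorem contDiffOn_inverse {n : WithTop ℕ∞} {D : Set (ℝ × E)} (hh : ContDiffOn ℝ n h D)
    (hpos : ∀ k ∈ D, ∀ v, v ≠ 0 → 0 < h k v v) :
    ContDiffOn ℝ n (fun k => (h k).inverse) D := by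
  intro k hk
  obtain ⟨e, he⟩ := exists_equiv_of_posDef (hpos k hk)
  have : ContDiffAt ℝ n (ContinuousLinearMap.inverse : (E →L[ℝ] E →L[ℝ] ℝ) → _) (h k) := by
    rw [← he]; exact contDiffAt_map_inverse e
  exact this.comp_contDiffWithinAt k (hh k hk)

theorem contDiffOn_optimalField {D : Set (ℝ × E)} (hD : UniqueDiffOn ℝ D)
    (hh : ContDiffOn ℝ ∞ h D) (hpos : ∀ k ∈ D, ∀ v, v ≠ 0 → 0 < h k v v) :
    ContDiffOn ℝ ∞ (optimalField h D) {k | (k.1, k.2.1) ∈ D} := by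
  set D' : Set (ℝ × (E × (E →L[ℝ] ℝ))) := {k | (k.1, k.2.1) ∈ D} with hD'
  have hπ : ContDiffOn ℝ ∞ (fun k : ℝ × (E × (E →L[ℝ] ℝ)) => (k.1, k.2.1)) D' := by fun_prop
  have hm : MapsTo (fun k : ℝ × (E × (E →L[ℝ] ℝ)) => (k.1, k.2.1)) D' D := fun k hk => hk
  have h1 : ContDiffOn ℝ ∞ (fun k : ℝ × (E × (E →L[ℝ] ℝ)) =>
      (h (k.1, k.2.1)).inverse k.2.2) D' :=
    ((contDiffOn_inverse hh hpos).comp hπ hm).clm_apply (by fun_prop)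
  have h2 : ContDiffOn ℝ ∞ (fun k : ℝ × (E × (E →L[ℝ] ℝ)) => fderivWithin ℝ h D (k.1, k.2.1)) D' :=
    (hh.fderivWithin hD (by simp)).comp hπ hm
  have h3 : ContDiffOn ℝ ∞ (fun k : ℝ × (E × (E →L[ℝ] ℝ)) =>
      halfTimeDeriv h D k.1 k.2.1 ((h (k.1, k.2.1)).inverse k.2.2)) D' :=
    contDiffOn_const.mul (((h2.clm_apply contDiffOn_const).clm_apply h1).clm_apply h1)
  have h4 : ContDiffOn ℝ ∞ (fun k : ℝ × (E × (E →L[ℝ] ℝ)) =>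
      halfPosDeriv h D k.1 k.2.1 ((h (k.1, k.2.1)).inverse k.2.2)) D' := by
    rw [contDiffOn_clm_apply]
    intro u
    simp only [halfPosDeriv_apply]
    exact contDiffOn_const.mul (((h2.clm_apply contDiffOn_const).clm_apply h1).clm_apply h1)
  exact h1.prodMk ((h3.smul (by fun_prop)).add h4)

variable [MeasurableSpace E] [BorelSpace E]

/-- A curve in the interior which admits no shortcut is continuously differentiable and satisfies
the classical equations of motion. -/
theorem exists_isOptimalMotion_of_no_shortcut
    (hsymm : ∀ k ∈ (univ : Set ℝ) ×ˢ T, ∀ u v, h k u v = h k v u)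
    (hpos : ∀ k ∈ (univ : Set ℝ) ×ˢ T, ∀ v, v ≠ 0 → 0 < h k v v)
    (hh : ContDiffOn ℝ ∞ h (univ ×ˢ T))
    {y : ℝ → E} {a b ζ : ℝ} (hab : a < b) (hζ : 0 < ζ)
    (hy : ∃ K, LipschitzOnWith K y (Icc a b)) (hyO : ∀ s ∈ Icc a b, y s ∈ interior T)
    (hcausal : ∀ᵐ s, s ∈ Ioo a b → ∃ v, HasDerivAt y v s ∧ h (s, y s) v v ≤ 1)
    (hno : ¬ ∃ τ z, IsShortcut (fun k => h (k.1, k.2.1) k.2.2 k.2.2) (interior T) y a b ζ τ z) :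
    ∃ V, IsOptimalMotion h (univ ×ˢ T) y V (Icc a b) := by
  set L : ℝ × E × E → ℝ := fun k => h (k.1, k.2.1) k.2.2 k.2.2 with hLdef
  have hOO : IsOpen ((univ : Set ℝ) ×ˢ (interior T) ×ˢ (univ : Set E)) :=
    isOpen_univ.prod (isOpen_interior.prod isOpen_univ)
  have hL : ContDiffOn ℝ 1 L (univ ×ˢ interior T ×ˢ univ) :=
    ((contDiffOn_energy hh).of_le (by norm_cast)).mono
      (prod_mono_right (prod_mono_left interior_subset))
  obtain ⟨v, c, ⟨M, hvM⟩, hyv, hAc, hPc, hEL⟩ :=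
    ae_eulerLagrange_of_no_shortcut isOpen_interior hL hab hζ hy hyO hcausal hno
  obtain ⟨Ky, hKy⟩ := hy
  set D : Set (ℝ × E) := univ ×ˢ T with hD
  have hyD : ∀ s ∈ Icc a b, (s, y s) ∈ D := fun s hs => ⟨mem_univ _, interior_subset (hyO s hs)⟩
  have hyc : ContinuousOn (fun s => (s, y s)) (Icc a b) := continuousOn_id.prodMk hKy.continuousOn
  set A : ℝ → ℝ := fun s => ∫ r in a..s, 1 / 2 * timeGrad L (r, y r, v r) with hA
  set P : ℝ → E := fun s => c + ∫ r in a..s, (1 / 2 * Real.exp (-A r)) • posGrad L (r, y r, v r)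
    with hP
  have hgt : ∀ s ∈ Icc a b, ∀ w, timeGrad L (s, y s, w) = 2 * halfTimeDeriv h D s (y s) w := by
    intro s hs w
    rw [timeGrad, fderiv_energy hsymm hh (hyO s hs), halfTimeDeriv]
    simp [hD]
  have hgx : ∀ s ∈ Icc a b, ∀ w, InnerProductSpace.toDual ℝ E (posGrad L (s, y s, w))
      = (2 : ℝ) • halfPosDeriv h D s (y s) w := by
    intro s hs w
    ext u
    rw [InnerProductSpace.toDual_apply_apply, inner_posGrad, fderiv_energy hsymm hh (hyO s hs)]
    simp only [smul_apply, halfPosDeriv_apply]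
    simp [hD]
  have hgv : ∀ s ∈ Icc a b, ∀ w, InnerProductSpace.toDual ℝ E (velGrad L (s, y s, w))
      = (2 : ℝ) • h (s, y s) w := by
    intro s hs w
    ext u
    rw [InnerProductSpace.toDual_apply_apply, inner_velGrad, fderiv_energy hsymm hh (hyO s hs)]
    simp [Prod.mk_zero_zero]
  -- The continuous representative of the velocity, obtained from the momentum `exp A • P`.
  set V : ℝ → E := fun s => (h (s, y s)).inverse
    (Real.exp (A s) • InnerProductSpace.toDual ℝ E (P s)) with hV
  have hPc' : ContinuousOn P (Icc a b) := continuousOn_const.add hPc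
  have hVc : ContinuousOn V (Icc a b) := by
    have h1 : ContinuousOn (fun s => (h (s, y s)).inverse) (Icc a b) :=
      (contDiffOn_inverse hh hpos).continuousOn.comp hyc hyD
    refine h1.clm_apply ((Real.continuous_exp.comp_continuousOn hAc).smul ?_)
    exact (InnerProductSpace.toDual ℝ E).continuous.comp_continuousOn hPc'
  have hhV : ∀ s ∈ Icc a b, h (s, y s) (V s)
      = Real.exp (A s) • InnerProductSpace.toDual ℝ E (P s) := fun s hs =>
    apply_inverse_of_posDef (hpos _ (hyD s hs)) _
  have hvV : ∀ᵐ s, s ∈ Ioo a b → v s = V s := by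
    filter_upwards [hEL] with s hs hs'
    have h1 := congrArg (InnerProductSpace.toDual ℝ E) (hs hs').2
    rw [map_smul, hgv s (Ioo_subset_Icc_self hs'), smul_smul] at h1
    have h2 : InnerProductSpace.toDual ℝ E (P s) = Real.exp (-A s) • h (s, y s) (v s) := by
      rw [hP]; simp only; rw [← h1]; congr 1; ring
    simp only [hV]
    rw [h2, smul_smul, ← Real.exp_add, add_neg_cancel, Real.exp_zero, one_smul,
      inverse_apply_of_posDef (hpos _ (hyD s (Ioo_subset_Icc_self hs')))]
  have hbne : ∀ᵐ s : ℝ, s ≠ b := by simp [ae_iff, measure_singleton]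
  have hane : ∀ᵐ s : ℝ, s ≠ a := by simp [ae_iff, measure_singleton]
  have hyV : ∀ s ∈ Icc a b, HasDerivWithinAt y (V s) (Icc a b) s := by
    have hVc' : Continuous fun s => V (projIcc a b hab.le s) :=
      hVc.comp_continuous (continuous_subtype_val.comp continuous_projIcc)
        fun s => (projIcc a b hab.le s).2
    obtain ⟨C, hC⟩ := isCompact_Icc.exists_bound_of_continuousOn hVc
    have hCb : ∀ s, ‖V (projIcc a b hab.le s)‖ ≤ C := fun s => hC _ (projIcc a b hab.le s).2
    have hlip := lipschitzWith_clampedPrimitive hab.le hVc'.measurable hCb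
    have hae := ae_hasDerivAt_clampedPrimitive hab.le hVc'.measurable hCb
    have hac : AbsolutelyContinuousOnInterval
        (fun s => y s - clampedPrimitive hab.le (fun s => V (projIcc a b hab.le s)) s) a b := by
      have := hKy.sub (hlip.lipschitzOnWith (s := Icc a b))
      exact (this.mono (uIcc_of_le hab.le).subset).absolutelyContinuousOnInterval
    obtain ⟨C', hC'⟩ := hac.const_of_ae_hasDerivAt_zero (by
      filter_upwards [hae, hyv, hvV, hbne, hane] with s h1 h2 h3 h4 h5 hs
      rw [uIcc_of_le hab.le] at hs
      have hs' : s ∈ Ioo a b := ⟨lt_of_le_of_ne hs.1 h5.symm, lt_of_le_of_ne hs.2 h4⟩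
      have := (h2 hs').sub (h1 hs')
      rwa [projIcc_of_mem hab.le hs, h3 hs', sub_self] at this)
    rw [uIcc_of_le hab.le] at hC'
    intro s hs
    have h1 := (hasDerivWithinAt_primitive hVc hs).const_add C'
    have heq : ∀ t ∈ Icc a b, y t = C' + ∫ r in a..t, V r := by
      intro t ht
      have h2 := hC' t ht
      rw [clampedPrimitive_of_mem hab.le ht] at h2
      rw [← h2]
      have : ∫ r in a..t, V r = ∫ r in a..t, V (projIcc a b hab.le r) := by
        refine intervalIntegral.integral_congr fun r hr => ?_
        rw [uIcc_of_le ht.1] at hr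
        simp only [projIcc_of_mem hab.le (⟨hr.1, hr.2.trans ht.2⟩ : r ∈ Icc a b)]
      rw [this]; abel
    exact h1.congr heq (heq s hs)
  have hkc : ContinuousOn (fun s => (s, y s, V s)) (Icc a b) :=
    continuousOn_id.prodMk (hKy.continuousOn.prodMk hVc)
  have hkm : MapsTo (fun s => (s, y s, V s)) (Icc a b) (univ ×ˢ interior T ×ˢ univ) :=
    fun s hs => ⟨mem_univ _, hyO s hs, mem_univ _⟩
  -- As `V` is continuous, the integrals defining `A` and `P` can be differentiated everywhere.
  have hA' : ∀ s ∈ Icc a b, HasDerivWithinAt A (halfTimeDeriv h D s (y s) (V s)) (Icc a b) s := by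
    intro s hs
    have hc : ContinuousOn (fun s => 1 / 2 * timeGrad L (s, y s, V s)) (Icc a b) :=
      continuousOn_const.mul ((continuousOn_timeGrad hOO hL).comp hkc hkm)
    have h1 := hasDerivWithinAt_primitive hc hs
    rw [hgt s hs] at h1
    have heq : ∀ t ∈ Icc a b, A t = ∫ r in a..t, 1 / 2 * timeGrad L (r, y r, V r) :=
      fun t ht => intervalIntegral_congr_of_ae_Ioo (hvV.mono fun r hr hr' => by rw [hr hr']) ht
    convert! h1.congr heq (heq s hs) using 1
    ring
  have hP' : ∀ s ∈ Icc a b, HasDerivWithinAt P ((1 / 2 * Real.exp (-A s)) •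
      posGrad L (s, y s, V s)) (Icc a b) s := by
    intro s hs
    have hc : ContinuousOn (fun s => (1 / 2 * Real.exp (-A s)) • posGrad L (s, y s, V s))
        (Icc a b) :=
      (continuousOn_const.mul (Real.continuous_exp.comp_continuousOn hAc.neg)).smul
        ((continuousOn_posGrad hOO hL).comp hkc hkm)
    have h1 := (hasDerivWithinAt_primitive hc hs).const_add c
    have heq : ∀ t ∈ Icc a b, P t = c + ∫ r in a..t, (1 / 2 * Real.exp (-A r)) •
        posGrad L (r, y r, V r) := fun t ht => by
      rw [hP]; simp only
      rw [intervalIntegral_congr_of_ae_Ioo (hvV.mono fun r hr hr' => by rw [hr hr']) ht]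
    exact h1.congr heq (heq s hs)
  refine ⟨V, hyV, ?_, ?_⟩
  · have hc : ContinuousOn (fun s => h (s, y s) (V s) (V s)) (Icc a b) :=
      (hL.continuousOn.comp hkc hkm : _)
    refine fun s hs => Measure.eqOn_Icc_of_ae_eq (μ := volume) hab.ne
      (f := fun s => h (s, y s) (V s) (V s)) (g := fun _ => (1 : ℝ)) ?_ hc continuousOn_const hs
    rw [Filter.EventuallyEq, ae_restrict_iff' measurableSet_Icc]
    filter_upwards [hEL, hvV, hbne, hane] with s h1 h2 h4 h5 hs
    have hs' : s ∈ Ioo a b := ⟨lt_of_le_of_ne hs.1 h5.symm, lt_of_le_of_ne hs.2 h4⟩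
    have := (h1 hs').1
    rw [h2 hs'] at this
    exact this
  · intro s hs
    have h1 := (hA' s hs).exp.smul
      ((InnerProductSpace.toDual ℝ E).toContinuousLinearEquiv.toContinuousLinearMap.hasFDerivAt
        (x := P s) |>.comp_hasDerivWithinAt s (hP' s hs))
    have h2 := h1.congr (f₁ := fun r => h (r, y r) (V r)) (fun r hr => hhV r hr) (hhV s hs)
    convert! h2 using 1
    rw [hhV s hs]
    ext u
    simp only [add_apply, smul_apply, smul_eq_mul, map_smul, Function.comp_apply,
      ContinuousLinearEquiv.coe_coe, LinearIsometryEquiv.coe_toContinuousLinearEquiv,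
      hgx s hs]
    have : Real.exp (A s) * Real.exp (-A s) = 1 := by rw [← Real.exp_add]; simp
    linear_combination (-halfPosDeriv h D s (y s) (V s) u) * this

end Classical

/-! ### Regularity at the initial time -/

section Extension

set_option maxSynthPendingDepth 5

variable {E : Type*} [NormedAddCommGroup E] [InnerProductSpace ℝ E] [FiniteDimensional ℝ E]
  {h : ℝ × E → E →L[ℝ] E →L[ℝ] ℝ} {T : Set E}

/-- If a Lipschitz curve `y` with values in the chart domain `T` is an optimal motion on `[a', b]`
for every `a' > a`, then it is smooth up to the initial time `a` (where it may be on the boundary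
of `T`) and is an optimal motion on `[a, b]`: the momentum has bounded derivative, hence extends
to `a`, and the extended phase-space curve solves the equations of motion on `[a, b]`. -/
theorem contDiffOn_and_isOptimalMotion_Icc
    (hT : UniqueDiffOn ℝ T)
    (hpos : ∀ k ∈ (univ : Set ℝ) ×ˢ T, ∀ v, v ≠ 0 → 0 < h k v v)
    (hh : ContDiffOn ℝ ∞ h (univ ×ˢ T))
    {y : ℝ → E} {a b : ℝ} (hab : a < b)
    (hy : ∃ K, LipschitzOnWith K y (Icc a b)) (hyT : ∀ s ∈ Icc a b, y s ∈ T)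
    (hmot : ∀ a' ∈ Ioo a b, ∃ V, IsOptimalMotion h (univ ×ˢ T) y V (Icc a' b)) :
    ContDiffOn ℝ ∞ y (Icc a b) ∧
      IsOptimalMotion h (univ ×ˢ T) y (derivWithin y (Icc a b)) (Icc a b) := by
  obtain ⟨K, hK⟩ := hy
  set D : Set (ℝ × E) := univ ×ˢ T with hD
  have hDu : UniqueDiffOn ℝ D := uniqueDiffOn_univ.prod hT
  have hu : UniqueDiffOn ℝ (Icc a b) := uniqueDiffOn_Icc hab
  have hyD : ∀ s ∈ Icc a b, (s, y s) ∈ D := fun s hs => ⟨mem_univ _, hyT s hs⟩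
  set V := derivWithin y (Icc a b) with hVdef
  have hnhds : ∀ {a' s : ℝ}, a < a' → a' < s → 𝓝[Icc a' b] s = 𝓝[Icc a b] s := by
    intro a' s h1 h2
    have : Icc a' b = Icc a b ∩ Ici a' := by
      ext r; simp only [mem_Icc, mem_inter_iff, mem_Ici]; constructor
      · rintro ⟨h3, h4⟩; exact ⟨⟨h1.le.trans h3, h4⟩, h3⟩
      · rintro ⟨⟨_, h4⟩, h3⟩; exact ⟨h3, h4⟩
    rw [this]
    exact nhdsWithin_inter_of_mem' (nhdsWithin_le_nhds (Ici_mem_nhds h2))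
  have hVeq : ∀ {a' : ℝ} (_ : a' ∈ Ioo a b) {W : ℝ → E}, IsOptimalMotion h D y W (Icc a' b) →
      ∀ s ∈ Ioc a' b, HasDerivWithinAt y (W s) (Icc a b) s ∧ V s = W s := by
    intro a' ha' W hW s hs
    have h1 := hW.hasDeriv s ⟨hs.1.le, hs.2⟩
    have h2 : HasDerivWithinAt y (W s) (Icc a b) s := by
      rw [HasDerivWithinAt, HasDerivAtFilter, ← hnhds ha'.1 hs.1] ; exact h1
    exact ⟨h2, h2.derivWithin (hu s ⟨ha'.1.le.trans hs.1.le, hs.2⟩)⟩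
  -- The equations of motion on the half-open interval, with `V` the derivative of `y`.
  set p : ℝ → (E →L[ℝ] ℝ) := fun s => h (s, y s) (V s) with hp
  have hIoc : ∀ s ∈ Ioc a b, HasDerivWithinAt y (V s) (Icc a b) s ∧ h (s, y s) (V s) (V s) = 1 ∧
      HasDerivWithinAt p (halfTimeDeriv h D s (y s) (V s) • p s + halfPosDeriv h D s (y s) (V s))
        (Icc a b) s := by
    intro s hs
    obtain ⟨a', h1, h2⟩ := exists_between hs.1
    have ha' : a' ∈ Ioo a b := ⟨h1, h2.trans_le hs.2⟩
    obtain ⟨W, hW⟩ := hmot a' ha'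
    obtain ⟨h3, h4⟩ := hVeq ha' hW s ⟨h2, hs.2⟩
    refine ⟨h4 ▸ h3, h4 ▸ hW.unit s ⟨h2.le, hs.2⟩, ?_⟩
    have h5 := hW.momentum s ⟨h2.le, hs.2⟩
    rw [HasDerivWithinAt, HasDerivAtFilter, hnhds h1 h2] at h5
    have h6 : HasDerivWithinAt (fun r => h (r, y r) (W r)) (halfTimeDeriv h D s (y s) (W s) •
      h (s, y s) (W s) + halfPosDeriv h D s (y s) (W s)) (Icc a b) s := h5
    rw [hp]
    simp only
    rw [h4]
    refine h6.congr_of_eventuallyEq ?_ (by rw [h4])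
    have : Ioc a' b ∈ 𝓝[Icc a b] s := by
      rw [mem_nhdsWithin]
      exact ⟨Ioi a', isOpen_Ioi, h2, fun r hr => ⟨hr.1, hr.2.2⟩⟩
    filter_upwards [this] with r hr
    rw [(hVeq ha' hW r hr).2]
  have hVb : ∀ s ∈ Ioc a b, ‖V s‖ ≤ K := by
    intro s hs
    have hs' : s ∈ Icc a b := Ioc_subset_Icc_self hs
    have h1 := (hIoc s hs).1
    have h2 : HasDerivWithinAt y (V s) (Ioo a s) s :=
      h1.mono fun r hr => ⟨hr.1.le, hr.2.le.trans hs.2⟩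
    rw [hasDerivWithinAt_iff_tendsto_slope' (by simp), nhdsWithin_Ioo_eq_nhdsLT hs.1] at h2
    refine le_of_tendsto h2.norm ?_
    filter_upwards [Ioo_mem_nhdsLT hs.1] with r hr
    have h3 := hK.dist_le_mul r ⟨hr.1.le, hr.2.le.trans hs.2⟩ s hs'
    rw [slope_def_module, norm_smul, norm_inv, inv_mul_le_iff₀ (by
      rw [norm_pos_iff, sub_ne_zero]; exact hr.2.ne), mul_comm, ← dist_eq_norm, ← dist_eq_norm]
    exact h3
  -- Boundedness of the momentum and of its derivative.
  have hΦ := contDiffOn_optimalField hDu hh hpos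
  set D' : Set (ℝ × (E × (E →L[ℝ] ℝ))) := {k | (k.1, k.2.1) ∈ D} with hD'
  have hyc : ContinuousOn (fun s => (s, y s)) (Icc a b) := continuousOn_id.prodMk hK.continuousOn
  obtain ⟨Ch, hCh⟩ := isCompact_Icc.exists_bound_of_continuousOn (hh.continuousOn.comp hyc hyD)
  have hpb : ∀ s ∈ Ioc a b, ‖p s‖ ≤ Ch * K := by
    intro s hs
    refine (ContinuousLinearMap.le_opNorm _ _).trans ?_
    have h1 := hCh s (Ioc_subset_Icc_self hs)
    exact mul_le_mul h1 (hVb s hs) (norm_nonneg _) ((norm_nonneg _).trans h1)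
  have hfield : ∀ s ∈ Ioc a b, optimalField h D (s, y s, p s)
      = (V s, halfTimeDeriv h D s (y s) (V s) • p s + halfPosDeriv h D s (y s) (V s)) := by
    intro s hs
    have : (h (s, y s)).inverse (p s) = V s :=
      inverse_apply_of_posDef (hpos _ (hyD s (Ioc_subset_Icc_self hs))) _
    simp only [optimalField, this]
  have : FiniteDimensional ℝ (E →L[ℝ] ℝ) :=
    (InnerProductSpace.toDual ℝ E).toLinearEquiv.finiteDimensional
  set C : Set (ℝ × (E × (E →L[ℝ] ℝ))) := (fun q : ℝ × (E →L[ℝ] ℝ) => (q.1, y q.1, q.2)) ''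
    (Icc a b ×ˢ Metric.closedBall 0 (Ch * K)) with hC
  have hCc : IsCompact C := by
    apply (isCompact_Icc.prod (isCompact_closedBall _ _)).image_of_continuousOn
    refine continuousOn_fst.prodMk (ContinuousOn.prodMk ?_ continuousOn_snd)
    exact hK.continuousOn.comp continuousOn_fst fun q hq => hq.1
  have hCD : C ⊆ D' := by
    rintro _ ⟨q, hq, rfl⟩
    exact hyD _ hq.1
  obtain ⟨CΦ, hCΦ⟩ := hCc.exists_bound_of_continuousOn (hΦ.continuousOn.mono hCD)
  have hplip : LipschitzOnWith CΦ.toNNReal p (Ioc a b) := by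
    apply (convex_Ioc a b).lipschitzOnWith_of_nnnorm_hasDerivWithin_le
      (f' := fun s => (optimalField h D (s, y s, p s)).2)
    · intro s hs
      rw [hfield s hs]
      exact (hIoc s hs).2.2.mono Ioc_subset_Icc_self
    · intro s hs
      have h1 : (s, y s, p s) ∈ C := ⟨(s, p s), ⟨Ioc_subset_Icc_self hs, by
        simpa using hpb s hs⟩, rfl⟩
      have h2 := (norm_snd_le (optimalField h D (s, y s, p s))).trans (hCΦ _ h1)
      rw [← NNReal.coe_le_coe, Real.coe_toNNReal _ ((norm_nonneg _).trans h2)]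
      exact h2
  obtain ⟨pe, hpe, hpeq⟩ := hplip.extend_finite_dimension
  -- The extended phase-space curve solves the equations of motion up to the initial time.
  set u : ℝ → E × (E →L[ℝ] ℝ) := fun s => (y s, pe s) with hudef
  have huc : ContinuousOn u (Icc a b) := hK.continuousOn.prodMk hpe.continuous.continuousOn
  have huD : ∀ s ∈ Icc a b, (s, u s) ∈ D' := hyD
  have hu1 : ∀ s ∈ Ioc a b, HasDerivWithinAt u (optimalField h D (s, u s)) (Icc a b) s := by
    intro s hs
    have e : u s = (y s, p s) := by simp only [hudef, hpeq hs]
    rw [e, hfield s hs]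
    refine (hIoc s hs).1.prodMk ((hIoc s hs).2.2.congr_of_eventuallyEq ?_ (hpeq hs).symm)
    have : Ioc a b ∈ 𝓝[Icc a b] s := by
      rw [mem_nhdsWithin]
      exact ⟨Ioi a, isOpen_Ioi, hs.1, fun r hr => ⟨hr.1, hr.2.2⟩⟩
    filter_upwards [this] with r hr
    exact (hpeq hr).symm
  have hcont : ContinuousOn (fun s => optimalField h D (s, u s)) (Icc a b) :=
    hΦ.continuousOn.comp (continuousOn_id.prodMk huc) huD
  have ha : a ∈ Icc a b := ⟨le_rfl, hab.le⟩
  have hu2 : ∀ s ∈ Icc a b, HasDerivWithinAt u (optimalField h D (s, u s)) (Icc a b) s := by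
    intro s hs
    rcases eq_or_lt_of_le hs.1 with rfl | hlt
    · have hd : ∀ s ∈ Ioo a b, HasDerivAt u (optimalField h D (s, u s)) s := fun s hs =>
        (hu1 s ⟨hs.1, hs.2.le⟩).hasDerivAt (Icc_mem_nhds hs.1 hs.2)
      refine (hasDerivWithinAt_Ici_of_tendsto_deriv (s := Ioo a b)
        (fun s hs => (hd s hs).differentiableAt.differentiableWithinAt)
        ((huc a ha).mono Ioo_subset_Icc_self) (Ioo_mem_nhdsGT hab) ?_).mono Icc_subset_Ici_self
      have h1 : Tendsto (fun s => optimalField h D (s, u s)) (𝓝[>] a)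
          (𝓝 (optimalField h D (a, u a))) := by
        have := (hcont a ha).mono Ioo_subset_Icc_self
        rwa [ContinuousWithinAt, nhdsWithin_Ioo_eq_nhdsGT hab] at this
      refine h1.congr' ?_
      filter_upwards [Ioo_mem_nhdsGT hab] with s hs
      exact (hd s hs).deriv.symm
    · exact hu1 s ⟨hlt, hs.2⟩
  have husm : ContDiffOn ℝ ∞ u (Icc a b) := contDiffOn_of_hasDerivWithinAt hu hΦ huD hu2
  have hysm : ContDiffOn ℝ ∞ y (Icc a b) := contDiff_fst.comp_contDiffOn husm
  have hyV : ∀ s ∈ Icc a b, HasDerivWithinAt y (V s) (Icc a b) s := fun s hs =>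
    ((hysm.differentiableOn (by simp)) s hs).hasDerivWithinAt
  have hVinv : ∀ s ∈ Icc a b, V s = (h (s, y s)).inverse (pe s) := fun s hs =>
    ((ContinuousLinearMap.fst ℝ E (E →L[ℝ] ℝ)).hasFDerivAt.comp_hasDerivWithinAt s
      (hu2 s hs)).derivWithin (hu s hs)
  have hppe : ∀ s ∈ Icc a b, h (s, y s) (V s) = pe s := fun s hs => by
    rw [hVinv s hs, apply_inverse_of_posDef (hpos _ (hyD s hs))]
  refine ⟨hysm, hyV, ?_, ?_⟩
  · have hVc : ContinuousOn V (Icc a b) :=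
      (hysm.derivWithin hu (by simp) : ContDiffOn ℝ ∞ _ _).continuousOn
    have hc : ContinuousOn (fun s => h (s, y s) (V s) (V s)) (Icc a b) :=
      ((hh.continuousOn.comp hyc hyD).clm_apply hVc).clm_apply hVc
    have h1 : closure (Ioc a b) = Icc a b := closure_Ioc hab.ne
    have h2 : EqOn (fun s => h (s, y s) (V s) (V s)) (fun _ => (1 : ℝ)) (Ioc a b) :=
      fun s hs => (hIoc s hs).2.1
    intro s hs
    exact h2.of_subset_closure hc continuousOn_const Ioc_subset_Icc_self h1.ge hs
  · intro s hs
    have h1 := (ContinuousLinearMap.snd ℝ E (E →L[ℝ] ℝ)).hasFDerivAt.comp_hasDerivWithinAt s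
      (hu2 s hs)
    have h2 := h1.congr (f₁ := fun r => h (r, y r) (V r)) (fun r hr => hppe r hr) (hppe s hs)
    convert! h2 using 1
    simp only [optimalField, hudef, ← hVinv s hs, hppe s hs, ContinuousLinearMap.coe_snd']

end Extension

/-! ### The conformal spatial metric in charts -/

namespace SplitMetric

variable {N : Type*} [TopologicalSpace N] [ChartedSpace (EuclideanHalfSpace 3) N]
  [IsManifold (𝓡∂ 3) ∞ N] (G : SplitMetric N)

/-- The derivative of the inverse of the chart at `p`, at the coordinate vector `z`. -/
def chartFrame (p : N) (z : EuclideanSpace ℝ (Fin 3)) :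
    EuclideanSpace ℝ (Fin 3) →L[ℝ] TangentSpace (𝓡∂ 3) ((extChartAt (𝓡∂ 3) p).symm z) :=
  mfderivWithin 𝓘(ℝ, EuclideanSpace ℝ (Fin 3)) (𝓡∂ 3) (extChartAt (𝓡∂ 3) p).symm
    (range (𝓡∂ 3)) z

/-- The conformal spatial metric `h = κ / α` in the chart at `p`, as a function of time and of the
coordinate vector. Causal curves parametrized by time are those of `h`-speed at most one. -/
def chartForm (p : N) (k : ℝ × EuclideanSpace ℝ (Fin 3)) :
    EuclideanSpace ℝ (Fin 3) →L[ℝ] EuclideanSpace ℝ (Fin 3) →L[ℝ] ℝ :=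
  (G.α (k.1, (extChartAt (𝓡∂ 3) p).symm k.2))⁻¹ •
    (((chartFrame p k.2).precomp ℝ).comp
      ((G.κ (k.1, (extChartAt (𝓡∂ 3) p).symm k.2)).comp (chartFrame p k.2)))

theorem chartForm_apply (p : N) (t : ℝ) (z u v : EuclideanSpace ℝ (Fin 3)) :
    G.chartForm p (t, z) u v = (G.α (t, (extChartAt (𝓡∂ 3) p).symm z))⁻¹ *
      G.κ (t, (extChartAt (𝓡∂ 3) p).symm z) (chartFrame p z u) (chartFrame p z v) := rfl

theorem chartForm_symm (p : N) (k : ℝ × EuclideanSpace ℝ (Fin 3))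
    (u v : EuclideanSpace ℝ (Fin 3)) : G.chartForm p k u v = G.chartForm p k v u := by
  obtain ⟨t, z⟩ := k
  rw [chartForm_apply, chartForm_apply, G.κ_symm]

instance : IsManifold (𝓡∂ 3) 1 N := .of_le (n := ∞) (by norm_cast)

theorem chartFrame_injective (p : N) {z : EuclideanSpace ℝ (Fin 3)}
    (hz : z ∈ (extChartAt (𝓡∂ 3) p).target) : Function.Injective (chartFrame p z) :=
  (isInvertible_mfderivWithin_extChartAt_symm hz).injective

theorem chartForm_pos (p : N) {k : ℝ × EuclideanSpace ℝ (Fin 3)}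
    (hk : k ∈ univ ×ˢ (extChartAt (𝓡∂ 3) p).target)
    {v : EuclideanSpace ℝ (Fin 3)} (hv : v ≠ 0) : 0 < G.chartForm p k v v := by
  obtain ⟨t, z⟩ := k
  rw [chartForm_apply]
  refine mul_pos (inv_pos.2 (G.α_pos _)) (G.κ_pos _ _ ?_)
  rw [← map_zero (chartFrame p z)]
  exact fun h => hv (chartFrame_injective p hk.2 h)

theorem contMDiffOn_chartFrame (p : N) (u : EuclideanSpace ℝ (Fin 3)) :
    ContMDiffOn 𝓘(ℝ, EuclideanSpace ℝ (Fin 3)) (𝓡∂ 3).tangent ∞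
      (fun z => TotalSpace.mk' (EuclideanSpace ℝ (Fin 3))
        (E := fun x : N => TangentSpace (𝓡∂ 3) x)
        ((extChartAt (𝓡∂ 3) p).symm z) (chartFrame p z u)) (extChartAt (𝓡∂ 3) p).target := by
  have hU : UniqueMDiffOn 𝓘(ℝ, EuclideanSpace ℝ (Fin 3)) (extChartAt (𝓡∂ 3) p).target :=
    (uniqueDiffOn_extChartAt_target p).uniqueMDiffOn
  have h1 := (contMDiffOn_extChartAt_symm (I := 𝓡∂ 3) (n := ∞) p).contMDiffOn_tangentMapWithin
    (m := ∞) (by simp) hU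
  have h2 : ContMDiff 𝓘(ℝ, EuclideanSpace ℝ (Fin 3)) (𝓘(ℝ, EuclideanSpace ℝ (Fin 3)).tangent) ∞
      (fun z => (⟨z, u⟩ : TangentBundle 𝓘(ℝ, EuclideanSpace ℝ (Fin 3))
        (EuclideanSpace ℝ (Fin 3)))) := by
    exact (contMDiff_vectorSpace_iff_contDiff (𝕜 := ℝ) (E := EuclideanSpace ℝ (Fin 3))
      (V := fun _ => u)).2 contDiff_const
  have h3 := ContMDiffOn.comp (s := (extChartAt (𝓡∂ 3) p).target) h1 h2.contMDiffOn
    (fun z hz => hz)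
  refine h3.congr fun z hz => ?_
  have h4 : mfderivWithin 𝓘(ℝ, EuclideanSpace ℝ (Fin 3)) (𝓡∂ 3) (extChartAt (𝓡∂ 3) p).symm
      (extChartAt (𝓡∂ 3) p).target z = chartFrame p z := by
    exact (mdifferentiableWithinAt_extChartAt_symm hz).mfderivWithin_mono (hU z hz)
      (extChartAt_target_subset_range p)
  simp only [Function.comp, tangentMapWithin, h4]
  rfl

theorem contDiffOn_chartForm (p : N) :
    ContDiffOn ℝ ∞ (G.chartForm p) (univ ×ˢ (extChartAt (𝓡∂ 3) p).target) := by
  rw [contDiffOn_clm_apply]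
  intro u
  rw [contDiffOn_clm_apply]
  intro v
  set S : Set (ℝ × EuclideanSpace ℝ (Fin 3)) := univ ×ˢ (extChartAt (𝓡∂ 3) p).target with hS
  set J := 𝓘(ℝ, ℝ × EuclideanSpace ℝ (Fin 3)) with hJ
  have hsnd : ContMDiffOn J 𝓘(ℝ, EuclideanSpace ℝ (Fin 3)) ∞
      (Prod.snd : ℝ × EuclideanSpace ℝ (Fin 3) → _) S :=
    contDiff_snd.contMDiff.contMDiffOn
  have hfst : ContMDiffOn J 𝓘(ℝ, ℝ) ∞ (Prod.fst : ℝ × EuclideanSpace ℝ (Fin 3) → _) S :=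
    contDiff_fst.contMDiff.contMDiffOn
  have hm : MapsTo (Prod.snd : ℝ × EuclideanSpace ℝ (Fin 3) → _) S
    (extChartAt (𝓡∂ 3) p).target := fun k hk => hk.2
  have hbase : ContMDiffOn J spacetimeModel ∞
      (fun k : ℝ × EuclideanSpace ℝ (Fin 3) => (k.1, (extChartAt (𝓡∂ 3) p).symm k.2)) S :=
    hfst.prodMk ((contMDiffOn_extChartAt_symm p).comp hsnd hm)
  have hα : ContMDiffOn J 𝓘(ℝ, ℝ) ∞ (fun k : ℝ × EuclideanSpace ℝ (Fin 3) =>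
      G.α (k.1, (extChartAt (𝓡∂ 3) p).symm k.2)) S :=
    G.α_smooth.comp_contMDiffOn hbase
  have hκ := G.κ_smooth.comp_contMDiffOn hbase
  have hf := fun w => (contMDiffOn_chartFrame p w).comp hsnd hm
  have h1 : ContMDiffOn J ((𝓡∂ 3).prod 𝓘(ℝ, ℝ)) ∞
      (fun k : ℝ × EuclideanSpace ℝ (Fin 3) => TotalSpace.mk' ℝ (E := Bundle.Trivial N ℝ)
        ((extChartAt (𝓡∂ 3) p).symm k.2) (G.κ (k.1, (extChartAt (𝓡∂ 3) p).symm k.2)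
        (chartFrame p k.2 u) (chartFrame p k.2 v))) S := by
    apply ContMDiffOn.clm_bundle_apply₂ (F₁ := EuclideanSpace ℝ (Fin 3))
      (F₂ := EuclideanSpace ℝ (Fin 3))
    · exact hκ
    · exact hf u
    · exact hf v
  have h2 : ContMDiffOn J 𝓘(ℝ, ℝ) ∞ (fun k : ℝ × EuclideanSpace ℝ (Fin 3) =>
      G.κ (k.1, (extChartAt (𝓡∂ 3) p).symm k.2) (chartFrame p k.2 u) (chartFrame p k.2 v)) S := by
    intro k hk
    have := h1 k hk
    rw [contMDiffWithinAt_totalSpace] at this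
    exact this.2
  exact ((contMDiffOn_iff_contDiffOn.1 hα).inv fun k _ => (G.α_pos _).ne').mul
    (contMDiffOn_iff_contDiffOn.1 h2)

end SplitMetric

/-! ### Slopes of smooth functions -/

namespace SplitMetric

variable {N : Type*} [TopologicalSpace N] [ChartedSpace (EuclideanHalfSpace 3) N]
  [IsManifold (𝓡∂ 3) ∞ N] (G : SplitMetric N)

/-- The squared length of a spatial vector in the conformal metric `h = κ / α`. -/
def speedSq (k : ℝ × N) (v : TangentSpace (𝓡∂ 3) k.2) : ℝ := (G.α k)⁻¹ * G.κ k v v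

theorem chartForm_self (p : N) (t : ℝ) (z u : EuclideanSpace ℝ (Fin 3)) :
    G.chartForm p (t, z) u u
      = G.speedSq (t, (extChartAt (𝓡∂ 3) p).symm z) (chartFrame p z u) := rfl

/-- The differential of a real-valued function, as a linear form on the tangent space. -/
def differential (f : N → ℝ) (x : N) : TangentSpace (𝓡∂ 3) x →L[ℝ] ℝ :=
  mfderiv (𝓡∂ 3) 𝓘(ℝ, ℝ) f x

/-- The differential of `f` at the space-time point `k` has norm less than `C` with respect to the
metric dual to `h = κ / α`. -/
def SlopeLT (f : N → ℝ) (k : ℝ × N) (C : ℝ) : Prop :=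
  0 < C ∧ ∀ v : TangentSpace (𝓡∂ 3) k.2, v ≠ 0 →
    (differential f k.2 v) ^ 2 < C ^ 2 * G.speedSq k v

/-- The differential of `f` in the chart at `p`. -/
def chartDeriv (f : N → ℝ) (p : N) (z : EuclideanSpace ℝ (Fin 3)) :
    EuclideanSpace ℝ (Fin 3) →L[ℝ] ℝ :=
  fderivWithin ℝ (f ∘ (extChartAt (𝓡∂ 3) p).symm) (extChartAt (𝓡∂ 3) p).target z

theorem hasFDerivWithinAt_chart {f : N → ℝ} (hf : ContMDiff (𝓡∂ 3) 𝓘(ℝ, ℝ) ∞ f) (p : N)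
    {z : EuclideanSpace ℝ (Fin 3)} (hz : z ∈ (extChartAt (𝓡∂ 3) p).target) :
    HasFDerivWithinAt (f ∘ (extChartAt (𝓡∂ 3) p).symm) (chartDeriv f p z)
      (extChartAt (𝓡∂ 3) p).target z := by
  have h1 : ContMDiffOn 𝓘(ℝ, EuclideanSpace ℝ (Fin 3)) 𝓘(ℝ, ℝ) ∞
      (f ∘ (extChartAt (𝓡∂ 3) p).symm) (extChartAt (𝓡∂ 3) p).target :=
    hf.comp_contMDiffOn (contMDiffOn_extChartAt_symm p)
  exact ((contMDiffOn_iff_contDiffOn.1 h1).differentiableOn (by simp) z hz).hasFDerivWithinAt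

theorem continuousOn_chartDeriv {f : N → ℝ} (hf : ContMDiff (𝓡∂ 3) 𝓘(ℝ, ℝ) ∞ f) (p : N) :
    ContinuousOn (chartDeriv f p) (extChartAt (𝓡∂ 3) p).target := by
  have h1 : ContMDiffOn 𝓘(ℝ, EuclideanSpace ℝ (Fin 3)) 𝓘(ℝ, ℝ) ∞
      (f ∘ (extChartAt (𝓡∂ 3) p).symm) (extChartAt (𝓡∂ 3) p).target :=
    hf.comp_contMDiffOn (contMDiffOn_extChartAt_symm p)
  exact (contMDiffOn_iff_contDiffOn.1 h1).continuousOn_fderivWithin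
    (uniqueDiffOn_extChartAt_target p) (by simp)

theorem differential_chartFrame {f : N → ℝ} (hf : ContMDiff (𝓡∂ 3) 𝓘(ℝ, ℝ) ∞ f) (p : N)
    {z : EuclideanSpace ℝ (Fin 3)} (hz : z ∈ (extChartAt (𝓡∂ 3) p).target)
    (u : EuclideanSpace ℝ (Fin 3)) :
    differential f ((extChartAt (𝓡∂ 3) p).symm z) (chartFrame p z u)
      = chartDeriv f p z u := by
  have h1 : HasMFDerivAt (𝓡∂ 3) 𝓘(ℝ, ℝ) f ((extChartAt (𝓡∂ 3) p).symm z)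
      (mfderiv (𝓡∂ 3) 𝓘(ℝ, ℝ) f ((extChartAt (𝓡∂ 3) p).symm z)) :=
    (hf.mdifferentiable (by simp) _).hasMFDerivAt
  have h2 : HasMFDerivWithinAt 𝓘(ℝ, EuclideanSpace ℝ (Fin 3)) (𝓡∂ 3)
      (extChartAt (𝓡∂ 3) p).symm (extChartAt (𝓡∂ 3) p).target z (chartFrame p z) :=
    (mdifferentiableWithinAt_extChartAt_symm hz).hasMFDerivWithinAt.mono
      (extChartAt_target_subset_range p)
  have h3 : HasFDerivWithinAt (f ∘ (extChartAt (𝓡∂ 3) p).symm)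
      ((differential f ((extChartAt (𝓡∂ 3) p).symm z)).comp (chartFrame p z))
      (extChartAt (𝓡∂ 3) p).target z := (h1.comp_hasMFDerivWithinAt z h2).hasFDerivWithinAt
  have hu : UniqueDiffWithinAt ℝ (extChartAt (𝓡∂ 3) p).target z :=
    uniqueDiffOn_extChartAt_target p z hz
  exact (DFunLike.congr_fun (h3.fderivWithin hu) u).symm

theorem slopeLT_iff_chart {f : N → ℝ} (hf : ContMDiff (𝓡∂ 3) 𝓘(ℝ, ℝ) ∞ f) (p : N) (t C : ℝ)
    {z : EuclideanSpace ℝ (Fin 3)} (hz : z ∈ (extChartAt (𝓡∂ 3) p).target) :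
    G.SlopeLT f (t, (extChartAt (𝓡∂ 3) p).symm z) C ↔
      0 < C ∧ ∀ u, u ≠ 0 → (chartDeriv f p z u) ^ 2 < C ^ 2 * G.chartForm p (t, z) u u := by
  refine and_congr_right fun _ => ⟨fun h u hu => ?_, fun h v hv => ?_⟩
  · have := h (chartFrame p z u) (by
      rw [← map_zero (chartFrame p z)]
      exact fun h => hu (chartFrame_injective p hz h))
    rwa [differential_chartFrame hf p hz, ← chartForm_self] at this
  · obtain ⟨u, rfl⟩ : ∃ u : EuclideanSpace ℝ (Fin 3), chartFrame p z u = v :=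
      (isInvertible_mfderivWithin_extChartAt_symm (I := 𝓡∂ 3) hz).surjective v
    have hu : u ≠ 0 := by rintro rfl; exact hv (map_zero _)
    have := h u hu
    rw [chartForm_self] at this
    have e : differential f ((extChartAt (𝓡∂ 3) p).symm z) (chartFrame p z u)
      = chartDeriv f p z u := differential_chartFrame hf p hz u
    exact (congrArg (· ^ 2) e).trans_lt this

theorem continuousOn_chartForm_comp (p : N) :
    ContinuousOn (fun k : ℝ × N => G.chartForm p (k.1, extChartAt (𝓡∂ 3) p k.2))
      (univ ×ˢ (extChartAt (𝓡∂ 3) p).source) := by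
  refine (G.contDiffOn_chartForm p).continuousOn.comp (continuousOn_fst.prodMk
    ((continuousOn_extChartAt p).comp continuousOn_snd fun k hk => hk.2)) fun k hk => ?_
  exact ⟨mem_univ _, (extChartAt (𝓡∂ 3) p).map_source hk.2⟩

theorem continuousAt_chartForm_comp (t : ℝ) (p : N) :
    ContinuousAt (fun k : ℝ × N => G.chartForm p (k.1, extChartAt (𝓡∂ 3) p k.2)) (t, p) :=
  (G.continuousOn_chartForm_comp p).continuousAt
    (prod_mem_nhds univ_mem (extChartAt_source_mem_nhds p))

/-- The condition `SlopeLT` is open in the space-time point: by homogeneity it is a condition on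
unit vectors, which form a compact set. -/
theorem eventually_slopeLT {f : N → ℝ} (hf : ContMDiff (𝓡∂ 3) 𝓘(ℝ, ℝ) ∞ f) {k : ℝ × N} {C : ℝ}
    (h : G.SlopeLT f k C) : ∀ᶠ k' in 𝓝 k, G.SlopeLT f k' C := by
  obtain ⟨t, p⟩ := k
  have hpt : extChartAt (𝓡∂ 3) p p ∈ (extChartAt (𝓡∂ 3) p).target := mem_extChartAt_target p
  have h0 : G.SlopeLT f (t, (extChartAt (𝓡∂ 3) p).symm (extChartAt (𝓡∂ 3) p p)) C := by
    rwa [extChartAt_to_inv]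
  rw [slopeLT_iff_chart G hf p t C hpt] at h0
  obtain ⟨hC, h0⟩ := h0
  have hc1 := G.continuousAt_chartForm_comp t p
  have hc2 : ContinuousAt (fun k : ℝ × N => chartDeriv f p (extChartAt (𝓡∂ 3) p k.2)) (t, p) := by
    have : ContinuousOn (fun x : N => chartDeriv f p (extChartAt (𝓡∂ 3) p x))
        (extChartAt (𝓡∂ 3) p).source :=
      (continuousOn_chartDeriv hf p).comp (continuousOn_extChartAt p) fun x hx =>
        (extChartAt (𝓡∂ 3) p).map_source hx
    exact ContinuousAt.comp (f := Prod.snd) (this.continuousAt (extChartAt_source_mem_nhds p))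
      continuousAt_snd
  have key : ∀ᶠ k' in 𝓝 (t, p), ∀ u ∈ Metric.sphere (0 : EuclideanSpace ℝ (Fin 3)) 1,
      (chartDeriv f p (extChartAt (𝓡∂ 3) p k'.2) u) ^ 2
        < C ^ 2 * G.chartForm p (k'.1, extChartAt (𝓡∂ 3) p k'.2) u u := by
    refine (isCompact_sphere _ _).eventually_forall_of_forall_eventually fun u hu => ?_
    have hu0 : u ≠ 0 := by rintro rfl; simp at hu
    have e1 : ContinuousAt (fun q : (ℝ × N) × EuclideanSpace ℝ (Fin 3) =>
        (chartDeriv f p (extChartAt (𝓡∂ 3) p q.1.2) q.2) ^ 2) ((t, p), u) :=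
      ((ContinuousAt.comp (f := Prod.fst) (x := ((t, p), u)) hc2 continuousAt_fst).clm_apply
        continuousAt_snd).pow 2
    have e2 : ContinuousAt (fun q : (ℝ × N) × EuclideanSpace ℝ (Fin 3) =>
        C ^ 2 * G.chartForm p (q.1.1, extChartAt (𝓡∂ 3) p q.1.2) q.2 q.2) ((t, p), u) :=
      continuousAt_const.mul (((ContinuousAt.comp (f := Prod.fst) (x := ((t, p), u)) hc1
        continuousAt_fst).clm_apply
        continuousAt_snd).clm_apply continuousAt_snd)
    exact e1.eventually_lt e2 (h0 u hu0)
  have hsrc : ∀ᶠ k' : ℝ × N in 𝓝 (t, p), k'.2 ∈ (extChartAt (𝓡∂ 3) p).source :=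
    continuousAt_snd.eventually (extChartAt_source_mem_nhds p)
  filter_upwards [key, hsrc] with k' hk hs
  have : k' = (k'.1, (extChartAt (𝓡∂ 3) p).symm (extChartAt (𝓡∂ 3) p k'.2)) := by
    rw [(extChartAt (𝓡∂ 3) p).left_inv hs]
  rw [this, slopeLT_iff_chart G hf p k'.1 C ((extChartAt (𝓡∂ 3) p).map_source hs)]
  refine ⟨hC, fun u hu => ?_⟩
  have hn : 0 < ‖u‖ := norm_pos_iff.2 hu
  have h1 := hk (‖u‖⁻¹ • u) (by simp [norm_smul, hn.ne'])
  simp only [map_smul, smul_apply, smul_eq_mul] at h1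
  have h2 : 0 < ‖u‖⁻¹ ^ 2 := by positivity
  have h3 : ‖u‖⁻¹ ^ 2 * (chartDeriv f p (extChartAt (𝓡∂ 3) p k'.2) u) ^ 2 < ‖u‖⁻¹ ^ 2 *
      (C ^ 2 * G.chartForm p (k'.1, extChartAt (𝓡∂ 3) p k'.2) u u) := by
    calc _ = (‖u‖⁻¹ * chartDeriv f p (extChartAt (𝓡∂ 3) p k'.2) u) ^ 2 := by ring
      _ < _ := h1
      _ = _ := by ring
  exact lt_of_mul_lt_mul_left h3 h2.le

theorem speedSq_pos (k : ℝ × N) {v : TangentSpace (𝓡∂ 3) k.2} (hv : v ≠ 0) : 0 < G.speedSq k v :=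
  mul_pos (inv_pos.2 (G.α_pos _)) (G.κ_pos _ _ hv)

variable {G} in
theorem SlopeLT.mono {f : N → ℝ} {k : ℝ × N} {C C' : ℝ} (h : G.SlopeLT f k C) (hC : C ≤ C') :
    G.SlopeLT f k C' := by
  refine ⟨h.1.trans_le hC, fun v hv => (h.2 v hv).trans_le ?_⟩
  exact mul_le_mul_of_nonneg_right (pow_le_pow_left₀ h.1.le hC 2) (G.speedSq_pos k hv).le

theorem exists_slopeLT {f : N → ℝ} (hf : ContMDiff (𝓡∂ 3) 𝓘(ℝ, ℝ) ∞ f) (k : ℝ × N) :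
    ∃ C, G.SlopeLT f k C := by
  obtain ⟨t, p⟩ := k
  have hpt : extChartAt (𝓡∂ 3) p p ∈ (extChartAt (𝓡∂ 3) p).target := mem_extChartAt_target p
  have hpos : ∀ u, u ≠ 0 → 0 < G.chartForm p (t, extChartAt (𝓡∂ 3) p p) u u := fun u hu =>
    G.chartForm_pos p ⟨mem_univ _, hpt⟩ hu
  obtain ⟨B, hB⟩ := (isCompact_sphere (0 : EuclideanSpace ℝ (Fin 3)) 1).exists_bound_of_continuousOn
    (f := fun u => (chartDeriv f p (extChartAt (𝓡∂ 3) p p) u) ^ 2 /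
      G.chartForm p (t, extChartAt (𝓡∂ 3) p p) u u) (by
      refine ContinuousOn.div (by fun_prop) (by fun_prop) fun u hu => (hpos u ?_).ne'
      rintro rfl; simp at hu)
  refine ⟨|B| + 1, ?_⟩
  have h0 : G.SlopeLT f (t, (extChartAt (𝓡∂ 3) p).symm (extChartAt (𝓡∂ 3) p p)) (|B| + 1) := by
    rw [slopeLT_iff_chart G hf p t _ hpt]
    refine ⟨by positivity, fun u hu => ?_⟩
    have hn : 0 < ‖u‖ := norm_pos_iff.2 hu
    have h1 := hB (‖u‖⁻¹ • u) (by simp [norm_smul, hn.ne'])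
    simp only [map_smul, smul_apply, smul_eq_mul] at h1
    have h2 : (‖u‖⁻¹ * (chartDeriv f p (extChartAt (𝓡∂ 3) p p)) u) ^ 2 /
        (‖u‖⁻¹ * (‖u‖⁻¹ * ((G.chartForm p (t, extChartAt (𝓡∂ 3) p p)) u) u))
        = (chartDeriv f p (extChartAt (𝓡∂ 3) p p) u) ^ 2 /
          G.chartForm p (t, extChartAt (𝓡∂ 3) p p) u u := by
      have := (hpos u hu).ne'
      field_simp
    rw [h2] at h1
    have h3 := (le_abs_self _).trans h1
    rw [div_le_iff₀ (hpos u hu)] at h3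
    refine h3.trans_lt (mul_lt_mul_of_pos_right ?_ (hpos u hu))
    nlinarith [le_abs_self B, abs_nonneg B]
  rwa [extChartAt_to_inv] at h0

/-- A smooth function has bounded slope over a compact set. -/
theorem exists_slopeLT_of_isCompact {f : N → ℝ} (hf : ContMDiff (𝓡∂ 3) 𝓘(ℝ, ℝ) ∞ f)
    {K : Set (ℝ × N)} (hK : IsCompact K) : ∃ C, ∀ k ∈ K, G.SlopeLT f k C := by
  refine hK.induction_on (p := fun S => ∃ C, ∀ k ∈ S, G.SlopeLT f k C) ⟨0, by simp⟩ ?_ ?_ ?_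
  · rintro s t hst ⟨C, hC⟩
    exact ⟨C, fun k hk => hC k (hst hk)⟩
  · rintro s t ⟨C, hC⟩ ⟨C', hC'⟩
    refine ⟨max C C', ?_⟩
    rintro k (hk | hk)
    · exact (hC k hk).mono (le_max_left _ _)
    · exact (hC' k hk).mono (le_max_right _ _)
  · intro k _
    obtain ⟨C, hC⟩ := G.exists_slopeLT hf k
    exact ⟨_, mem_nhdsWithin_of_mem_nhds (G.eventually_slopeLT hf hC), C, fun k hk => hk⟩

end SplitMetric

/-! ### Weakly causal curves -/

/-- A positive definite form on a finite-dimensional space is coercive. -/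
theorem exists_pos_mul_sq_le_of_posDef {E : Type*} [NormedAddCommGroup E] [NormedSpace ℝ E]
    [FiniteDimensional ℝ E] {B : E →L[ℝ] E →L[ℝ] ℝ} (hB : ∀ v, v ≠ 0 → 0 < B v v) :
    ∃ c > 0, ∀ v, c * ‖v‖ ^ 2 ≤ B v v := by
  have := FiniteDimensional.proper ℝ E
  rcases (Metric.sphere (0 : E) 1).eq_empty_or_nonempty with he | hne
  · refine ⟨1, one_pos, fun v => ?_⟩
    have : v = 0 := by
      by_contra hv
      have : ‖v‖⁻¹ • v ∈ Metric.sphere (0 : E) 1 := by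
        simp [norm_smul, norm_ne_zero_iff.2 hv]
      simp [he] at this
    simp [this]
  obtain ⟨w, hw, hmin⟩ := (isCompact_sphere (0 : E) 1).exists_isMinOn hne
    (f := fun v => B v v) (B.continuous.clm_apply continuous_id).continuousOn
  have hw0 : w ≠ 0 := by rintro rfl; simp at hw
  refine ⟨B w w, hB w hw0, fun v => ?_⟩
  rcases eq_or_ne v 0 with rfl | hv
  · simp
  have hn : 0 < ‖v‖ := norm_pos_iff.2 hv
  have h1 : B w w ≤ B (‖v‖⁻¹ • v) (‖v‖⁻¹ • v) := hmin (by simp [norm_smul, hn.ne'])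
  simp only [map_smul, smul_apply, smul_eq_mul] at h1
  calc B w w * ‖v‖ ^ 2 ≤ (‖v‖⁻¹ * (‖v‖⁻¹ * B v v)) * ‖v‖ ^ 2 := by gcongr
    _ = B v v := by field_simp

namespace SplitMetric

variable {N : Type*} [TopologicalSpace N] [ChartedSpace (EuclideanHalfSpace 3) N]
  [IsManifold (𝓡∂ 3) ∞ N] (G : SplitMetric N)

set_option synthInstance.maxHeartbeats 200000 in
set_option maxSynthPendingDepth 5 in
/-- Near a space-time point the metric `h = κ / α` changes with time by a factor close to one. -/
theorem exists_speedSq_le_near (t : ℝ) (p : N) :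
    ∃ K ≥ 0, ∃ U ∈ 𝓝 (t, p), ∀ t₁ t₂ x, (t₁, x) ∈ U → (t₂, x) ∈ U →
      ∀ v : TangentSpace (𝓡∂ 3) x,
        G.speedSq (t₁, x) v ≤ (1 + K * |t₁ - t₂|) * G.speedSq (t₂, x) v := by
  set z₀ := extChartAt (𝓡∂ 3) p p with hz₀
  have hpt : z₀ ∈ (extChartAt (𝓡∂ 3) p).target := mem_extChartAt_target p
  obtain ⟨c, hc, hlow⟩ := exists_pos_mul_sq_le_of_posDef (B := G.chartForm p (t, z₀))
    fun u hu => G.chartForm_pos p ⟨mem_univ _, hpt⟩ hu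
  have hsm : ContDiffWithinAt ℝ 1 (G.chartForm p) (univ ×ˢ range (𝓡∂ 3)) (t, z₀) := by
    refine ((G.contDiffOn_chartForm p (t, z₀) ⟨mem_univ _, hpt⟩).mono_of_mem_nhdsWithin
      ?_).of_le (by simp)
    rw [nhdsWithin_prod_eq]
    exact prod_mem_prod univ_mem (extChartAt_target_mem_nhdsWithin p)
  obtain ⟨K, s, hs, hlip⟩ := hsm.exists_lipschitzOnWith (convex_univ.prod (𝓡∂ 3).convex_range)
  have hcont := G.continuousAt_chartForm_comp t p
  have e1 : ∀ᶠ k : ℝ × N in 𝓝 (t, p), (k.1, extChartAt (𝓡∂ 3) p k.2) ∈ s := by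
    have h1 : ContinuousAt (fun k : ℝ × N => (k.1, extChartAt (𝓡∂ 3) p k.2)) (t, p) :=
      continuousAt_fst.prodMk (ContinuousAt.comp (f := Prod.snd)
        (continuousAt_extChartAt p) continuousAt_snd)
    have h2 : Tendsto (fun k : ℝ × N => (k.1, extChartAt (𝓡∂ 3) p k.2)) (𝓝 (t, p))
        (𝓝[univ ×ˢ range (𝓡∂ 3)] (t, z₀)) := by
      refine tendsto_nhdsWithin_iff.2 ⟨h1, Eventually.of_forall fun k => ⟨mem_univ _, ?_⟩⟩
      exact mem_range_self _
    exact h2 hs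
  have e2 : ∀ᶠ k : ℝ × N in 𝓝 (t, p),
      ‖G.chartForm p (t, z₀) - G.chartForm p (k.1, extChartAt (𝓡∂ 3) p k.2)‖ < c / 2 := by
    refine (continuousAt_const.sub hcont).norm.eventually_lt continuousAt_const ?_
    change ‖G.chartForm p (t, z₀) - G.chartForm p (t, z₀)‖ < c / 2
    rw [sub_self, norm_zero]
    positivity
  have hsrc : ∀ᶠ k' : ℝ × N in 𝓝 (t, p), k'.2 ∈ (extChartAt (𝓡∂ 3) p).source :=
    continuousAt_snd.eventually (extChartAt_source_mem_nhds p)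
  refine ⟨K * (c / 2)⁻¹, by positivity, _, (e1.and (e2.and hsrc)), ?_⟩
  rintro t₁ t₂ x ⟨h1s, -, hx⟩ ⟨h2s, h2b, -⟩ v
  simp only at h1s hx h2s h2b
  obtain ⟨z, hz⟩ : ∃ z, z = extChartAt (𝓡∂ 3) p x := ⟨_, rfl⟩
  rw [← hz] at h1s h2s h2b
  have hzt : z ∈ (extChartAt (𝓡∂ 3) p).target := hz ▸ (extChartAt (𝓡∂ 3) p).map_source hx
  obtain rfl : (extChartAt (𝓡∂ 3) p).symm z = x := hz ▸ (extChartAt (𝓡∂ 3) p).left_inv hx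
  obtain ⟨u, rfl⟩ : ∃ u : EuclideanSpace ℝ (Fin 3), chartFrame p z u = v :=
    (isInvertible_mfderivWithin_extChartAt_symm (I := 𝓡∂ 3) hzt).surjective v
  change G.chartForm p (t₁, z) u u ≤ _ * G.chartForm p (t₂, z) u u
  have hd := hlip.dist_le_mul _ h1s _ h2s
  rw [Prod.dist_eq] at hd
  simp only [dist_self, dist_nonneg, sup_of_le_left] at hd
  rw [dist_eq_norm, Real.dist_eq] at hd
  have ha : ∀ A : EuclideanSpace ℝ (Fin 3) →L[ℝ] EuclideanSpace ℝ (Fin 3) →L[ℝ] ℝ,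
      A u u ≤ ‖A‖ * ‖u‖ ^ 2 := fun A => by
    have := (le_abs_self _).trans ((A.le_opNorm₂ u u))
    simpa [pow_two, mul_assoc] using this
  have h3 := ha (G.chartForm p (t₁, z) - G.chartForm p (t₂, z))
  have h4 := ha (G.chartForm p (t, z₀) - G.chartForm p (t₂, z))
  have h5 := hlow u
  simp only [sub_apply] at h3 h4
  have h6 : c / 2 * ‖u‖ ^ 2 ≤ G.chartForm p (t₂, z) u u := by nlinarith [sq_nonneg ‖u‖]
  have h7 : G.chartForm p (t₁, z) u u - G.chartForm p (t₂, z) u u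
      ≤ K * |t₁ - t₂| * ‖u‖ ^ 2 := h3.trans (by gcongr)
  have h8 : ‖u‖ ^ 2 ≤ (c / 2)⁻¹ * G.chartForm p (t₂, z) u u := by
    rw [← div_eq_inv_mul, le_div_iff₀ (by positivity)]; linarith
  have h9 : K * |t₁ - t₂| * ‖u‖ ^ 2 ≤ K * |t₁ - t₂| * ((c / 2)⁻¹ * G.chartForm p (t₂, z) u u) := by
    gcongr
  calc _ ≤ G.chartForm p (t₂, z) u u + K * |t₁ - t₂| * ((c / 2)⁻¹ * G.chartForm p (t₂, z) u u) := by
        linarith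
    _ = _ := by ring

/-- Uniform version of `exists_speedSq_le_near` over a compact set. -/
theorem exists_speedSq_le_of_isCompact {S : Set (ℝ × N)} (hS : IsCompact S) :
    ∃ K ≥ 0, ∃ η > 0, ∀ t x, (t, x) ∈ S → ∀ t', |t' - t| ≤ η → ∀ v : TangentSpace (𝓡∂ 3) x,
      G.speedSq (t', x) v ≤ (1 + K * |t' - t|) * G.speedSq (t, x) v := by
  refine hS.induction_on (p := fun S => ∃ K ≥ 0, ∃ η > 0, ∀ t x, (t, x) ∈ S → ∀ t', |t' - t| ≤ η →
    ∀ v : TangentSpace (𝓡∂ 3) x,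
      G.speedSq (t', x) v ≤ (1 + K * |t' - t|) * G.speedSq (t, x) v) ?_ ?_ ?_ ?_
  · exact ⟨0, le_rfl, 1, one_pos, by simp⟩
  · rintro s t hst ⟨K, hK, η, hη, h⟩
    exact ⟨K, hK, η, hη, fun t x hx => h t x (hst hx)⟩
  · rintro s t ⟨K, hK, η, hη, h⟩ ⟨K', hK', η', hη', h'⟩
    have hmono : ∀ k v, ∀ r : ℝ, 0 ≤ r → ∀ A B : ℝ, A ≤ B →
        (1 + A * r) * G.speedSq k v ≤ (1 + B * r) * G.speedSq k v := by
      intro k v r hr A B hAB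
      rcases eq_or_ne v 0 with rfl | hv
      · simp [speedSq]
      · have := G.speedSq_pos k hv
        gcongr
    refine ⟨max K K', le_max_of_le_left hK, min η η', lt_min hη hη', ?_⟩
    rintro t x (hx | hx) t' ht' v
    · exact (h t x hx t' (ht'.trans (min_le_left _ _)) v).trans
        (hmono _ v _ (abs_nonneg _) _ _ (le_max_left _ _))
    · exact (h' t x hx t' (ht'.trans (min_le_right _ _)) v).trans
        (hmono _ v _ (abs_nonneg _) _ _ (le_max_right _ _))
  · rintro ⟨t, p⟩ -
    obtain ⟨K, hK, U, hU, h⟩ := G.exists_speedSq_le_near t p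
    rw [nhds_prod_eq, mem_prod_iff] at hU
    obtain ⟨A, hA, W, hW, hAW⟩ := hU
    obtain ⟨r, hr, hrA⟩ := Metric.mem_nhds_iff.1 hA
    refine ⟨Metric.ball t (r / 2) ×ˢ W, mem_nhdsWithin_of_mem_nhds
      (prod_mem_nhds (Metric.ball_mem_nhds _ (by positivity)) hW), K, hK, r / 4, by positivity, ?_⟩
    rintro s x ⟨hs, hx⟩ s' hs' v
    simp only [Metric.mem_ball, Real.dist_eq] at hs
    refine h s' s x (hAW ⟨hrA ?_, hx⟩) (hAW ⟨hrA ?_, hx⟩) v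
    · rw [Metric.mem_ball, Real.dist_eq]
      have := abs_add_le (s' - s) (s - t)
      simp only [sub_add_sub_cancel] at this
      linarith
    · rw [Metric.mem_ball, Real.dist_eq]; linarith

variable {G} in
/-- Slope bounds degrade by a controlled factor when the time is shifted. -/
theorem SlopeLT.of_speedSq_le {f : N → ℝ} {t t' : ℝ} {x : N} {C A : ℝ} (h : G.SlopeLT f (t', x) C)
    (hA : 0 ≤ A) (hs : ∀ v : TangentSpace (𝓡∂ 3) x,
      G.speedSq (t', x) v ≤ (1 + A) * G.speedSq (t, x) v) :
    G.SlopeLT f (t, x) (C * (1 + A)) := by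
  have hC := h.1
  refine ⟨by positivity, fun v hv => (h.2 v hv).trans_le ?_⟩
  have := G.speedSq_pos (t, x) hv
  have h2 := hs v
  calc C ^ 2 * G.speedSq (t', x) v ≤ C ^ 2 * ((1 + A) * G.speedSq (t, x) v) := by gcongr
    _ ≤ C ^ 2 * ((1 + A) ^ 2 * G.speedSq (t, x) v) := by
      gcongr
      nlinarith
    _ = _ := by ring

/-- A weak notion of causality for a curve `s ↦ (τ s, x s)` on a parameter set `S`: for each smooth
`f` with slope less than `C` at a point of the curve, `C τ - f ∘ x` is monotone near that point.
It is stable under concatenation and pointwise limits, and in charts it means that `x` has `h`-speed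
at most one with respect to the time `τ`. -/
structure CausalOn (τ : ℝ → ℝ) (x : ℝ → N) (S : Set ℝ) : Prop where
  continuousOn_time : ContinuousOn τ S
  continuousOn_space : ContinuousOn x S
  monotone : ∀ s ∈ S, ∀ f : N → ℝ, ContMDiff (𝓡∂ 3) 𝓘(ℝ, ℝ) ∞ f → ∀ C, G.SlopeLT f (τ s, x s) C →
    ∃ u ∈ 𝓝[S] s, MonotoneOn (fun r => C * τ r - f (x r)) u

variable {G}

theorem CausalOn.mono {τ : ℝ → ℝ} {x : ℝ → N} {S S' : Set ℝ} (h : G.CausalOn τ x S) (hS : S' ⊆ S) :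
    G.CausalOn τ x S' := by
  refine ⟨h.continuousOn_time.mono hS, h.continuousOn_space.mono hS, fun s hs f hf C hC => ?_⟩
  obtain ⟨u, hu, hm⟩ := h.monotone s (hS hs) f hf C hC
  exact ⟨u, nhdsWithin_mono s hS hu, hm⟩

theorem CausalOn.congr {τ τ' : ℝ → ℝ} {x x' : ℝ → N} {S : Set ℝ} (h : G.CausalOn τ x S)
    (hτ : EqOn τ' τ S) (hx : EqOn x' x S) : G.CausalOn τ' x' S := by
  refine ⟨h.continuousOn_time.congr hτ, h.continuousOn_space.congr hx, fun s hs f hf C hC => ?_⟩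
  rw [hτ hs, hx hs] at hC
  obtain ⟨u, hu, hm⟩ := h.monotone s hs f hf C hC
  refine ⟨u ∩ S, inter_mem hu self_mem_nhdsWithin, fun r hr r' hr' hrr' => ?_⟩
  simp only [hτ hr.2, hx hr.2, hτ hr'.2, hx hr'.2]
  exact hm hr.1 hr'.1 hrr'

theorem CausalOn.const {τ : ℝ → ℝ} {S : Set ℝ} (hτ : ContinuousOn τ S) (hm : MonotoneOn τ S)
    (z : N) : G.CausalOn τ (fun _ => z) S := by
  refine ⟨hτ, continuousOn_const, fun s _ f _ C hC => ⟨S, self_mem_nhdsWithin, ?_⟩⟩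
  intro r hr r' hr' hrr'
  have := hm hr hr' hrr'
  have hC := hC.1
  simp only
  gcongr

/-- Concatenation of causal curves. -/
theorem CausalOn.union_Icc {τ : ℝ → ℝ} {x : ℝ → N} {a b c : ℝ} (hab : a ≤ b) (hbc : b ≤ c)
    (h₁ : G.CausalOn τ x (Icc a b)) (h₂ : G.CausalOn τ x (Icc b c)) :
    G.CausalOn τ x (Icc a c) := by
  rw [← Icc_union_Icc_eq_Icc hab hbc]
  refine ⟨h₁.continuousOn_time.union_of_isClosed h₂.continuousOn_time isClosed_Icc isClosed_Icc,
    h₁.continuousOn_space.union_of_isClosed h₂.continuousOn_space isClosed_Icc isClosed_Icc,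
    fun s hs f hf C hC => ?_⟩
  rcases lt_trichotomy s b with hsb | rfl | hsb
  · have hs1 : s ∈ Icc a b := by
      rcases hs with hs | hs
      · exact hs
      · exact absurd hs.1 (not_le.2 hsb)
    obtain ⟨u, hu, hm⟩ := h₁.monotone s hs1 f hf C hC
    refine ⟨u ∩ Iio b, inter_mem ?_ (mem_nhdsWithin_of_mem_nhds (Iio_mem_nhds hsb)),
      hm.mono inter_subset_left⟩
    rw [nhdsWithin_union]
    refine ⟨hu, ?_⟩
    rw [notMem_closure_iff_nhdsWithin_eq_bot.1 (by
      rw [closure_Icc]; exact fun h => absurd h.1 (not_le.2 hsb))]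
    trivial
  · obtain ⟨u, hu, hm⟩ := h₁.monotone s ⟨hab, le_rfl⟩ f hf C hC
    obtain ⟨w, hw, hm'⟩ := h₂.monotone s ⟨le_rfl, hbc⟩ f hf C hC
    have hsu : s ∈ u := mem_of_mem_nhdsWithin (right_mem_Icc.2 hab) hu
    have hsw : s ∈ w := mem_of_mem_nhdsWithin (left_mem_Icc.2 hbc) hw
    refine ⟨(u ∩ Icc a s) ∪ (w ∩ Icc s c), ?_, ?_⟩
    · rw [nhdsWithin_union]
      exact ⟨mem_of_superset (inter_mem hu self_mem_nhdsWithin) subset_union_left,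
        mem_of_superset (inter_mem hw self_mem_nhdsWithin) subset_union_right⟩
    · have g1 : IsGreatest (u ∩ Icc a s) s := by
        constructor
        · exact ⟨hsu, hab, le_rfl⟩
        · exact fun r hr => hr.2.2
      have g2 : IsLeast (w ∩ Icc s c) s := by
        constructor
        · exact ⟨hsw, le_rfl, hbc⟩
        · exact fun r hr => hr.2.1
      exact (hm.mono inter_subset_left).union_right (hm'.mono inter_subset_left) g1 g2
  · have hs1 : s ∈ Icc b c := by
      rcases hs with hs | hs
      · exact absurd hs.2 (not_le.2 hsb)
      · exact hs
    obtain ⟨u, hu, hm⟩ := h₂.monotone s hs1 f hf C hC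
    refine ⟨u ∩ Ioi b, inter_mem ?_ (mem_nhdsWithin_of_mem_nhds (Ioi_mem_nhds hsb)),
      hm.mono inter_subset_left⟩
    rw [nhdsWithin_union]
    refine ⟨?_, hu⟩
    rw [notMem_closure_iff_nhdsWithin_eq_bot.1 (by
      rw [closure_Icc]; exact fun h => absurd h.2 (not_le.2 hsb))]
    trivial

/-- Change of parameter by a monotone map. -/
theorem CausalOn.comp {τ : ℝ → ℝ} {x : ℝ → N} {S S' : Set ℝ} (h : G.CausalOn τ x S) {θ : ℝ → ℝ}
    (hc : ContinuousOn θ S') (hm : MonotoneOn θ S') (hS : MapsTo θ S' S) :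
    G.CausalOn (τ ∘ θ) (x ∘ θ) S' := by
  refine ⟨h.continuousOn_time.comp hc hS, h.continuousOn_space.comp hc hS, fun s hs f hf C hC => ?_⟩
  obtain ⟨u, hu, hmu⟩ := h.monotone _ (hS hs) f hf C hC
  refine ⟨θ ⁻¹' u ∩ S', inter_mem ((hc s hs).tendsto_nhdsWithin hS hu) self_mem_nhdsWithin,
    fun r hr r' hr' hrr' => hmu hr.1 hr'.1 (hm hr.2 hr'.2 hrr')⟩

/-- Near each of its points, a causal curve keeps the slope bound. -/
theorem CausalOn.eventually_slopeLT {τ : ℝ → ℝ} {x : ℝ → N} {S : Set ℝ} {s : ℝ}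
    (hτ : ContinuousWithinAt τ S s) (hx : ContinuousWithinAt x S s) {f : N → ℝ}
    (hf : ContMDiff (𝓡∂ 3) 𝓘(ℝ, ℝ) ∞ f) {C : ℝ} (hC : G.SlopeLT f (τ s, x s) C) :
    ∀ᶠ r in 𝓝[S] s, G.SlopeLT f (τ r, x r) C :=
  (hτ.prodMk hx).eventually (G.eventually_slopeLT hf hC)

/-- A uniform slope bound along the curve gives monotonicity on the whole interval. -/
theorem CausalOn.monotoneOn_Icc {τ : ℝ → ℝ} {x : ℝ → N} {a b : ℝ} (h : G.CausalOn τ x (Icc a b))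
    {f : N → ℝ} (hf : ContMDiff (𝓡∂ 3) 𝓘(ℝ, ℝ) ∞ f) {C : ℝ}
    (hC : ∀ s ∈ Icc a b, G.SlopeLT f (τ s, x s) C) :
    MonotoneOn (fun r => C * τ r - f (x r)) (Icc a b) :=
  monotoneOn_Icc_of_locally fun s hs => h.monotone s hs f hf C (hC s hs)

theorem SlopeLT.neg {f : N → ℝ} {k : ℝ × N} {C : ℝ} (h : G.SlopeLT f k C) :
    G.SlopeLT (fun x => -f x) k C := by
  refine ⟨h.1, fun v hv => ?_⟩
  have e : differential (fun x => -f x) k.2 = -differential f k.2 := mfderiv_neg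
  rw [e]
  simpa using h.2 v hv

theorem CausalOn.abs_sub_le {τ : ℝ → ℝ} {x : ℝ → N} {a b : ℝ} (h : G.CausalOn τ x (Icc a b))
    {f : N → ℝ} (hf : ContMDiff (𝓡∂ 3) 𝓘(ℝ, ℝ) ∞ f) {C : ℝ}
    (hC : ∀ s ∈ Icc a b, G.SlopeLT f (τ s, x s) C) {r s : ℝ} (hr : r ∈ Icc a b)
    (hs : s ∈ Icc a b) (hrs : r ≤ s) : |f (x s) - f (x r)| ≤ C * (τ s - τ r) := by
  have h1 := h.monotoneOn_Icc hf hC hr hs hrs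
  have h2 := h.monotoneOn_Icc (f := fun x => -f x) hf.neg (fun s hs => (hC s hs).neg) hr hs hrs
  simp only at h1 h2
  rw [abs_le]
  constructor <;> linarith

/-- It suffices to check causality in the open interval. -/
theorem CausalOn.of_Ioo {τ : ℝ → ℝ} {x : ℝ → N} {a b : ℝ} (hτ : ContinuousOn τ (Icc a b))
    (hx : ContinuousOn x (Icc a b)) (h : G.CausalOn τ x (Ioo a b)) : G.CausalOn τ x (Icc a b) := by
  refine ⟨hτ, hx, fun s hs f hf C hC => ?_⟩
  have hev := CausalOn.eventually_slopeLT (hτ s hs) (hx s hs) hf hC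
  obtain ⟨r, hr, hball⟩ := Metric.mem_nhdsWithin_iff.1 hev
  refine ⟨Metric.ball s r ∩ Icc a b, inter_mem (mem_nhdsWithin_of_mem_nhds
    (Metric.ball_mem_nhds _ hr)) self_mem_nhdsWithin, ?_⟩
  rintro r₁ ⟨h1b, h1⟩ r₂ ⟨h2b, h2⟩ hr12
  rcases hr12.eq_or_lt with rfl | hlt
  · exact le_rfl
  have hcF : ContinuousOn (fun r => C * τ r - f (x r)) (Icc r₁ r₂) :=
    ((continuousOn_const.mul hτ).sub (hf.continuous.comp_continuousOn hx)).mono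
      (Icc_subset_Icc h1.1 h2.2)
  have hm : MonotoneOn (fun r => C * τ r - f (x r)) (Ioo r₁ r₂) := by
    intro q hq q' hq' hqq'
    refine (h.mono (S' := Icc q q') ?_).monotoneOn_Icc hf ?_ ⟨le_rfl, hqq'⟩ ⟨hqq', le_rfl⟩ hqq'
    · exact fun z hz => ⟨h1.1.trans_lt (hq.1.trans_le hz.1), (hz.2.trans_lt hq'.2).trans_le h2.2⟩
    · intro z hz
      refine hball ⟨?_, h1.1.trans (hq.1.le.trans hz.1), hz.2.trans (hq'.2.le.trans h2.2)⟩
      rw [Real.ball_eq_Ioo] at h1b h2b ⊢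
      exact ⟨h1b.1.trans (hq.1.trans_le hz.1), (hz.2.trans_lt hq'.2).trans h2b.2⟩
  set F : ℝ → ℝ := fun r => C * τ r - f (x r)
  have hmid : (r₁ + r₂) / 2 ∈ Ioo r₁ r₂ := by constructor <;> linarith
  refine le_trans (b := F ((r₁ + r₂) / 2)) ?_ ?_
  · refine ContinuousWithinAt.closure_le (s := Ioo r₁ ((r₁ + r₂) / 2)) ?_
      ((hcF r₁ ⟨le_rfl, hlt.le⟩).mono fun z hz => ⟨hz.1.le, (hz.2.trans hmid.2).le⟩)
      continuousWithinAt_const fun z hz => hm ⟨hz.1, hz.2.trans hmid.2⟩ hmid hz.2.le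
    rw [closure_Ioo hmid.1.ne]
    exact ⟨le_rfl, hmid.1.le⟩
  · refine ContinuousWithinAt.closure_le (s := Ioo ((r₁ + r₂) / 2) r₂) ?_
      continuousWithinAt_const
      ((hcF r₂ ⟨hlt.le, le_rfl⟩).mono fun z hz => ⟨(hmid.1.trans hz.1).le, hz.2.le⟩)
      fun z hz => hm hmid ⟨hmid.1.trans hz.1, hz.2⟩ hz.1.le
    rw [closure_Ioo hmid.2.ne]
    exact ⟨hmid.2.le, le_rfl⟩

end SplitMetric

/-! ### Weakly causal curves in charts -/

namespace SplitMetric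

variable {N : Type*} [TopologicalSpace N] [ChartedSpace (EuclideanHalfSpace 3) N]
  [IsManifold (𝓡∂ 3) ∞ N] {G : SplitMetric N}

/-- A Lipschitz curve in a chart which is causal almost everywhere is causal in the weak sense. -/
theorem CausalOn.of_chart (p : N) {τ : ℝ → ℝ} {z : ℝ → EuclideanSpace ℝ (Fin 3)} {a b : ℝ}
    (hτ : ∃ K, LipschitzOnWith K τ (Icc a b)) (hz : ∃ K, LipschitzOnWith K z (Icc a b))
    (hmem : ∀ s ∈ Icc a b, z s ∈ (extChartAt (𝓡∂ 3) p).target)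
    (hae : ∀ᵐ s, s ∈ Ioo a b → ∃ τ' z', HasDerivAt τ τ' s ∧ HasDerivAt z z' s ∧
      0 ≤ τ' ∧ G.chartForm p (τ s, z s) z' z' ≤ τ' ^ 2) :
    G.CausalOn τ (fun s => (extChartAt (𝓡∂ 3) p).symm (z s)) (Icc a b) := by
  obtain ⟨Kτ, hKτ⟩ := hτ
  obtain ⟨Kz, hKz⟩ := hz
  have hxc : ContinuousOn (fun s => (extChartAt (𝓡∂ 3) p).symm (z s)) (Icc a b) :=
    (continuousOn_extChartAt_symm p).comp hKz.continuousOn hmem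
  refine ⟨hKτ.continuousOn, hxc, fun s hs f hf C hC => ?_⟩
  have hev := CausalOn.eventually_slopeLT (hKτ.continuousOn s hs) (hxc s hs) hf hC
  set F := f ∘ (extChartAt (𝓡∂ 3) p).symm with hF
  have hFs : ContDiffWithinAt ℝ 1 F (range (𝓡∂ 3)) (z s) := by
    have h1 : ContMDiffOn 𝓘(ℝ, EuclideanSpace ℝ (Fin 3)) 𝓘(ℝ, ℝ) ∞
        (f ∘ (extChartAt (𝓡∂ 3) p).symm) (extChartAt (𝓡∂ 3) p).target :=
      hf.comp_contMDiffOn (contMDiffOn_extChartAt_symm p)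
    exact ((contMDiffOn_iff_contDiffOn.1 h1 (z s) (hmem s hs)).mono_of_mem_nhdsWithin
      (extChartAt_target_mem_nhdsWithin_of_mem (hmem s hs))).of_le (by simp)
  obtain ⟨K, w, hw, hFw⟩ := hFs.exists_lipschitzOnWith (𝓡∂ 3).convex_range
  have hzw : ∀ᶠ r in 𝓝[Icc a b] s, z r ∈ w := by
    have : Tendsto z (𝓝[Icc a b] s) (𝓝[range (𝓡∂ 3)] (z s)) :=
      (hKz.continuousOn s hs).tendsto_nhdsWithin
        fun r hr => extChartAt_target_subset_range p (hmem r hr)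
    exact this hw
  obtain ⟨δ, hδ, hball⟩ := Metric.mem_nhdsWithin_iff.1 (hev.and hzw)
  have hsub : Icc (max (s - δ / 2) a) (min (s + δ / 2) b) ⊆ Metric.ball s δ ∩ Icc a b := by
    intro r hr
    simp only [mem_Icc, sup_le_iff, le_inf_iff] at hr
    refine ⟨?_, hr.1.2, hr.2.2⟩
    rw [Real.ball_eq_Ioo]
    constructor <;> linarith [hr.1.1, hr.2.1]
  refine ⟨Icc (max (s - δ / 2) a) (min (s + δ / 2) b), ?_, ?_⟩
  · rw [← Icc_inter_Icc]
    exact inter_mem (mem_nhdsWithin_of_mem_nhds (Icc_mem_nhds (by linarith) (by linarith)))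
      self_mem_nhdsWithin
  have hsub' := hsub.trans inter_subset_right
  -- The function tested is Lipschitz, so its monotonicity can be checked on its derivative.
  have hlip : LipschitzOnWith (‖C‖₊ * Kτ + K * Kz) (fun r => C * τ r - F (z r))
      (Icc (max (s - δ / 2) a) (min (s + δ / 2) b)) := by
    refine LipschitzOnWith.sub ?_ ?_
    · exact (lipschitzWith_smul C).comp_lipschitzOnWith (hKτ.mono hsub')
    · exact hFw.comp (hKz.mono hsub') fun r hr => (hball (hsub hr)).2
  refine monotoneOn_of_ae_deriv_nonneg hlip ?_
  filter_upwards [hae] with r hr hrI _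
  have hrI' := Ioo_subset_Icc_self hrI
  have hrab : r ∈ Icc a b := hsub' hrI'
  have hrab' : r ∈ Ioo a b := ⟨(le_max_right _ _).trans_lt hrI.1, hrI.2.trans_le (min_le_right _ _)⟩
  obtain ⟨τ', z', h1, h2, h3, h4⟩ := hr hrab'
  have hdF : HasDerivAt (F ∘ z) (chartDeriv f p (z r) z') r :=
    (hasFDerivWithinAt_chart hf p (hmem r hrab)).comp_hasDerivAt r h2
      (by filter_upwards [Icc_mem_nhds hrab'.1 hrab'.2] with q hq using hmem q hq)
  have hd : HasDerivAt (fun r => C * τ r - F (z r)) (C * τ' - chartDeriv f p (z r) z') r :=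
    (h1.const_mul C).sub hdF
  refine le_of_le_of_eq ?_ hd.deriv.symm
  have hsl := (slopeLT_iff_chart G hf p (τ r) C (hmem r hrab)).1 (hball (hsub hrI')).1
  have hCτ : 0 ≤ C * τ' := mul_nonneg hsl.1.le h3
  rcases eq_or_ne z' 0 with rfl | hz'
  · simpa using hCτ
  · have h5 : (chartDeriv f p (z r) z') ^ 2 < (C * τ') ^ 2 := by
      refine (hsl.2 z' hz').trans_le ?_
      rw [mul_pow]
      exact mul_le_mul_of_nonneg_left h4 (sq_nonneg C)
    have := (abs_lt_of_sq_lt_sq h5 hCτ)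
    linarith [(abs_lt.1 this).2]

/-- The velocity of a space-time curve in terms of the chart at `p`. -/
theorem exists_hasDerivWithinAt_of_mdifferentiableWithinAt {c : ℝ → ℝ × N} {S : Set ℝ} {s : ℝ}
    (hc : MDifferentiableWithinAt 𝓘(ℝ, ℝ) spacetimeModel c S s)
    (p : N) (hp : (c s).2 ∈ (extChartAt (𝓡∂ 3) p).source) :
    ∃ v, HasDerivWithinAt (fun r => (c r).1) (curveVelocity spacetimeModel c S s).1 S s ∧
      HasDerivWithinAt (fun r => extChartAt (𝓡∂ 3) p (c r).2) v S s ∧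
      G.g (c s) (curveVelocity spacetimeModel c S s) (curveVelocity spacetimeModel c S s)
        = G.α (c s) * (G.chartForm p ((c s).1, extChartAt (𝓡∂ 3) p (c s).2) v v
          - (curveVelocity spacetimeModel c S s).1 ^ 2) := by
  have h0 := hc.hasMFDerivWithinAt
  have h1 := (hasMFDerivAt_fst (I := 𝓘(ℝ, ℝ)) (I' := 𝓡∂ 3) (c s)).comp_hasMFDerivWithinAt s h0
  have h2 := (hasMFDerivAt_snd (I := 𝓘(ℝ, ℝ)) (I' := 𝓡∂ 3) (c s)).comp_hasMFDerivWithinAt s h0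
  have hp' : (c s).2 ∈ (chartAt (EuclideanHalfSpace 3) p).source := by
    rwa [extChartAt_source] at hp
  have h3 := (mdifferentiableAt_extChartAt (I := 𝓡∂ 3) hp').hasMFDerivAt.comp_hasMFDerivWithinAt
    s h2
  set w := curveVelocity spacetimeModel c S s with hw
  set D : TangentSpace (𝓡∂ 3) (c s).2 →L[ℝ] EuclideanSpace ℝ (Fin 3) :=
    mfderiv (𝓡∂ 3) 𝓘(ℝ, EuclideanSpace ℝ (Fin 3)) (extChartAt (𝓡∂ 3) p) (c s).2 with hD
  set A : ℝ →L[ℝ] ℝ × EuclideanSpace ℝ (Fin 3) := mfderivWithin 𝓘(ℝ, ℝ) spacetimeModel c S s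
  refine ⟨D w.2, ?_, ?_, ?_⟩
  · have e : HasFDerivWithinAt (fun r => (c r).1)
        ((ContinuousLinearMap.fst ℝ ℝ (EuclideanSpace ℝ (Fin 3))).comp A) S s :=
      h1.hasFDerivWithinAt
    exact e.hasDerivWithinAt
  · have e : HasFDerivWithinAt (fun r => extChartAt (𝓡∂ 3) p (c r).2)
        (D.comp ((ContinuousLinearMap.snd ℝ ℝ (EuclideanSpace ℝ (Fin 3))).comp A)) S s :=
      h3.hasFDerivWithinAt
    exact e.hasDerivWithinAt
  · have h4 : chartFrame p (extChartAt (𝓡∂ 3) p (c s).2) (D w.2) = w.2 :=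
      DFunLike.congr_fun (mfderivWithin_extChartAt_symm_comp_mfderiv_extChartAt' (I := 𝓡∂ 3) hp) w.2
    have h5 : G.chartForm p ((c s).1, extChartAt (𝓡∂ 3) p (c s).2) (D w.2) (D w.2)
        = (G.α (c s))⁻¹ * G.κ (c s) w.2 w.2 := by
      rw [chartForm_apply, h4, (extChartAt (𝓡∂ 3) p).left_inv hp]
    rw [h5, g]
    have := (G.α_pos (c s)).ne'
    field_simp
    ring

end SplitMetric

/-! ### Smooth causal curves -/

namespace SplitMetric

variable {N : Type*} [TopologicalSpace N] [ChartedSpace (EuclideanHalfSpace 3) N]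
  [IsManifold (𝓡∂ 3) ∞ N] {G : SplitMetric N}

/-- A smooth space-time curve in the chart at `p`, near a parameter value. -/
theorem exists_Icc_subset_chart {c : ℝ → ℝ × N} {o : Set ℝ} (ho : IsOpen o)
    (hc : ContMDiffOn 𝓘(ℝ, ℝ) spacetimeModel ∞ c o) {s : ℝ} (hs : s ∈ o) {p : N}
    (hp : (c s).2 ∈ (extChartAt (𝓡∂ 3) p).source) :
    ∃ a b, a < s ∧ s < b ∧ ∀ r ∈ Icc a b, r ∈ o ∧ (c r).2 ∈ (extChartAt (𝓡∂ 3) p).source ∧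
      ContDiffAt ℝ ∞ (fun r => (c r).1) r ∧
      ContDiffAt ℝ ∞ (fun r => extChartAt (𝓡∂ 3) p (c r).2) r ∧
      deriv (fun r => (c r).1) r = (curveVelocity spacetimeModel c o r).1 ∧
      G.g (c r) (curveVelocity spacetimeModel c o r) (curveVelocity spacetimeModel c o r)
        = G.α (c r) * (G.chartForm p ((c r).1, extChartAt (𝓡∂ 3) p (c r).2)
          (deriv (fun r => extChartAt (𝓡∂ 3) p (c r).2) r)
          (deriv (fun r => extChartAt (𝓡∂ 3) p (c r).2) r)
            - (curveVelocity spacetimeModel c o r).1 ^ 2) := by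
  have hev : ∀ᶠ r in 𝓝 s, r ∈ o ∧ (c r).2 ∈ (extChartAt (𝓡∂ 3) p).source := by
    refine Filter.Eventually.and (p := (· ∈ o)) (ho.mem_nhds hs) ?_
    have h1 : ContinuousAt c s := (hc.continuousOn s hs).continuousAt (ho.mem_nhds hs)
    exact (continuousAt_snd.comp h1).eventually ((isOpen_extChartAt_source p).mem_nhds hp)
  obtain ⟨δ, hδ, hball⟩ := Metric.mem_nhds_iff.1 hev
  refine ⟨s - δ / 2, s + δ / 2, by linarith, by linarith, fun r hr => ?_⟩
  obtain ⟨hro, hrp⟩ : r ∈ o ∧ (c r).2 ∈ (extChartAt (𝓡∂ 3) p).source := by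
    refine hball ?_
    rw [Real.ball_eq_Ioo]
    constructor <;> linarith [hr.1, hr.2]
  have hcr : ContMDiffAt 𝓘(ℝ, ℝ) spacetimeModel ∞ c r := (hc r hro).contMDiffAt (ho.mem_nhds hro)
  have h1 : ContMDiffAt 𝓘(ℝ, ℝ) 𝓘(ℝ, ℝ) ∞ (fun r => (c r).1) r := contMDiffAt_fst.comp r hcr
  have h2 : ContMDiffAt 𝓘(ℝ, ℝ) (𝓡∂ 3) ∞ (fun r => (c r).2) r := contMDiffAt_snd.comp r hcr
  have h3 : ContMDiffAt 𝓘(ℝ, ℝ) 𝓘(ℝ, EuclideanSpace ℝ (Fin 3)) ∞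
      (fun r => extChartAt (𝓡∂ 3) p (c r).2) r := by
    refine ContMDiffAt.comp r ?_ h2
    exact contMDiffAt_extChartAt' (by rwa [extChartAt_source] at hrp)
  obtain ⟨v, e1, e2, e3⟩ := exists_hasDerivWithinAt_of_mdifferentiableWithinAt (G := G)
    ((hcr.mdifferentiableAt (by simp)).mdifferentiableWithinAt (s := o)) p hrp
  refine ⟨hro, hrp, h1.contDiffAt, h3.contDiffAt, (e1.hasDerivAt (ho.mem_nhds hro)).deriv, ?_⟩
  rw [(e2.hasDerivAt (ho.mem_nhds hro)).deriv]
  exact e3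

theorem exists_lipschitzOnWith_of_contDiffAt {F : Type*} [NormedAddCommGroup F] [NormedSpace ℝ F]
    {f : ℝ → F} {a b : ℝ} (h : ∀ r ∈ Icc a b, ContDiffAt ℝ ∞ f r) :
    ∃ K, LipschitzOnWith K f (Icc a b) := by
  have : ContDiffOn ℝ ∞ f (Icc a b) := fun r hr => (h r hr).contDiffWithinAt
  exact this.exists_lipschitzOnWith (by simp) (convex_Icc a b) isCompact_Icc

/-- Time strictly increases along future-pointing curves. -/
theorem strictMonoOn_time {c : ℝ → ℝ × N} (hcont : ContinuousOn c (Icc 0 1))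
    (hc : ContMDiffOn 𝓘(ℝ, ℝ) spacetimeModel ∞ c (Ioo 0 1))
    (hpos : ∀ s ∈ Ioo (0 : ℝ) 1, 0 < (curveVelocity spacetimeModel c (Ioo 0 1) s).1) :
    StrictMonoOn (fun r => (c r).1) (Icc 0 1) := by
  refine strictMonoOn_of_deriv_pos (convex_Icc 0 1) (continuous_fst.comp_continuousOn hcont) ?_
  intro s hs
  rw [interior_Icc] at hs
  have h1 := (hc s hs).mdifferentiableWithinAt (by simp)
  have h0 := h1.hasMFDerivWithinAt
  have h1 := (hasMFDerivAt_fst (I := 𝓘(ℝ, ℝ)) (I' := 𝓡∂ 3) (c s)).comp_hasMFDerivWithinAt s h0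
  have e : HasFDerivWithinAt (fun r => (c r).1)
        ((ContinuousLinearMap.fst ℝ ℝ (EuclideanSpace ℝ (Fin 3))).comp
          (mfderivWithin 𝓘(ℝ, ℝ) spacetimeModel c (Ioo 0 1) s : ℝ →L[ℝ] _)) (Ioo 0 1) s :=
      h1.hasFDerivWithinAt
  rw [(e.hasDerivWithinAt.hasDerivAt (Ioo_mem_nhds hs.1 hs.2)).deriv]
  exact hpos s hs

/-- Smooth causal curves are causal in the weak sense. -/
theorem CausalOn.of_contMDiffOn {c : ℝ → ℝ × N} (hcont : ContinuousOn c (Icc 0 1))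
    (hc : ContMDiffOn 𝓘(ℝ, ℝ) spacetimeModel ∞ c (Ioo 0 1))
    (hpos : ∀ s ∈ Ioo (0 : ℝ) 1, 0 < (curveVelocity spacetimeModel c (Ioo 0 1) s).1)
    (hg : ∀ s ∈ Ioo (0 : ℝ) 1, G.g (c s) (curveVelocity spacetimeModel c (Ioo 0 1) s)
      (curveVelocity spacetimeModel c (Ioo 0 1) s) ≤ 0) :
    G.CausalOn (fun r => (c r).1) (fun r => (c r).2) (Icc 0 1) := by
  have hτ : ContinuousOn (fun r => (c r).1) (Icc 0 1) := continuous_fst.comp_continuousOn hcont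
  have hx : ContinuousOn (fun r => (c r).2) (Icc 0 1) := continuous_snd.comp_continuousOn hcont
  refine CausalOn.of_Ioo hτ hx ⟨hτ.mono Ioo_subset_Icc_self, hx.mono Ioo_subset_Icc_self,
    fun s hs f hf C hC => ?_⟩
  obtain ⟨a, b, has, hsb, hab⟩ := exists_Icc_subset_chart (G := G) isOpen_Ioo hc hs
    (mem_extChartAt_source (I := 𝓡∂ 3) (c s).2)
  have key : G.CausalOn (fun r => (c r).1) (fun r => (extChartAt (𝓡∂ 3) (c s).2).symm
      (extChartAt (𝓡∂ 3) (c s).2 (c r).2)) (Icc a b) := by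
    refine CausalOn.of_chart (c s).2 (exists_lipschitzOnWith_of_contDiffAt fun r hr =>
      (hab r hr).2.2.1) (exists_lipschitzOnWith_of_contDiffAt fun r hr => (hab r hr).2.2.2.1)
      (fun r hr => (extChartAt (𝓡∂ 3) (c s).2).map_source (hab r hr).2.1) ?_
    refine Eventually.of_forall fun r hr => ?_
    obtain ⟨h1, h2, h3, h4, h5, h6⟩ := hab r (Ioo_subset_Icc_self hr)
    refine ⟨_, _, (h3.differentiableAt (by simp)).hasDerivAt,
      (h4.differentiableAt (by simp)).hasDerivAt, h5 ▸ (hpos r h1).le, ?_⟩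
    have h7 := hg r h1
    rw [h6] at h7
    have := nonpos_of_mul_nonpos_right h7 (G.α_pos _)
    simp only [h5]
    linarith
  obtain ⟨u, hu, hm⟩ := (key.congr (τ' := fun r => (c r).1) (x' := fun r => (c r).2)
    (fun r _ => rfl)
    fun r hr => ((extChartAt (𝓡∂ 3) (c s).2).left_inv (hab r hr).2.1).symm).monotone
    s ⟨has.le, hsb.le⟩ f hf C hC
  refine ⟨u, mem_nhdsWithin_of_mem_nhds ?_, hm⟩
  rwa [nhdsWithin_eq_nhds.2 (Icc_mem_nhds has hsb)] at hu

/-- Part of a timelike curve can be traversed with a delayed start and the same arrival. -/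
theorem exists_causalOn_delay_of_timelike {c : ℝ → ℝ × N}
    (hc : ContMDiffOn 𝓘(ℝ, ℝ) spacetimeModel ∞ c (Ioo 0 1))
    (hpos : ∀ s ∈ Ioo (0 : ℝ) 1, 0 < (curveVelocity spacetimeModel c (Ioo 0 1) s).1)
    (hg : ∀ s ∈ Ioo (0 : ℝ) 1, G.g (c s) (curveVelocity spacetimeModel c (Ioo 0 1) s)
      (curveVelocity spacetimeModel c (Ioo 0 1) s) < 0) :
    ∃ a b ε, 0 < a ∧ a < b ∧ b < 1 ∧ 0 < ε ∧
      StrictMonoOn (fun r => (c r).1 + ε * (b - r)) (Icc a b) ∧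
      G.CausalOn (fun r => (c r).1 + ε * (b - r)) (fun r => (c r).2) (Icc a b) := by
  have hs : (1 / 2 : ℝ) ∈ Ioo (0 : ℝ) 1 := by constructor <;> norm_num
  set p := (c (1 / 2)).2 with hp
  obtain ⟨a, b, has, hsb, hab⟩ := exists_Icc_subset_chart (G := G) isOpen_Ioo hc hs
    (mem_extChartAt_source (I := 𝓡∂ 3) p)
  have hlt : a < b := has.trans hsb
  set τ := fun r => (c r).1 with hτ
  set y := fun r => extChartAt (𝓡∂ 3) p (c r).2 with hy
  -- By compactness, the strict inequalities on `[a, b]` persist for small delays `ε (b - r)`.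
  have key : ∀ᶠ ε : ℝ in 𝓝 0, ∀ r ∈ Icc a b, G.chartForm p (τ r + ε * (b - r), y r) (deriv y r)
      (deriv y r) < (deriv τ r - ε) ^ 2 ∧ ε < deriv τ r := by
    refine isCompact_Icc.eventually_forall_of_forall_eventually fun r hr => ?_
    obtain ⟨h1, h2, h3, h4, h5, h6⟩ := hab r hr
    have d1 : ContinuousAt (deriv τ) r := (h3.derivWithin (m := 0) (by simp)).continuousAt
    have d2 : ContinuousAt (deriv y) r := (h4.derivWithin (m := 0) (by simp)).continuousAt
    have d1' : ContinuousAt (fun q : ℝ × ℝ => deriv τ q.2) (0, r) :=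
      ContinuousAt.comp (f := Prod.snd) (x := ((0 : ℝ), r)) d1 continuousAt_snd
    have d2' : ContinuousAt (fun q : ℝ × ℝ => deriv y q.2) (0, r) :=
      ContinuousAt.comp (f := Prod.snd) (x := ((0 : ℝ), r)) d2 continuousAt_snd
    have hcr : ContinuousAt c r := (hc.continuousOn r h1).continuousAt (isOpen_Ioo.mem_nhds h1)
    have d3 : ContinuousAt (fun q : ℝ × ℝ => (τ q.2 + q.1 * (b - q.2), (c q.2).2)) (0, r) := by
      have h7 : ContinuousAt (fun q : ℝ × ℝ => c q.2) (0, r) :=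
        ContinuousAt.comp (f := Prod.snd) (x := ((0 : ℝ), r)) hcr continuousAt_snd
      refine ContinuousAt.prodMk ?_ (continuousAt_snd.comp h7)
      exact (continuousAt_fst.comp h7).add (by fun_prop)
    have d4 : ContinuousAt (fun q : ℝ × ℝ => G.chartForm p (τ q.2 + q.1 * (b - q.2), y q.2))
        (0, r) := by
      have h8 : ContinuousAt (fun k : ℝ × N => G.chartForm p (k.1, extChartAt (𝓡∂ 3) p k.2))
          (τ r + 0 * (b - r), (c r).2) :=
        (G.continuousOn_chartForm_comp p).continuousAt
          (prod_mem_nhds univ_mem ((isOpen_extChartAt_source p).mem_nhds h2))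
      exact ContinuousAt.comp (f := fun q : ℝ × ℝ => (τ q.2 + q.1 * (b - q.2), (c q.2).2))
        (x := ((0 : ℝ), r)) h8 d3
    refine Eventually.and ?_ ?_
    · refine ((d4.clm_apply d2').clm_apply d2').eventually_lt
        ((d1'.sub continuousAt_fst).pow 2) ?_
      have h9 := hg r h1
      rw [h6] at h9
      have := neg_of_mul_neg_right h9 (G.α_pos _).le
      simp only [zero_mul, add_zero, sub_zero]
      rw [← h5] at this
      linarith
    · refine continuousAt_fst.eventually_lt d1' ?_
      simp only
      rw [h5]
      exact hpos r h1
  obtain ⟨ε, hε, h0⟩ := ((key.filter_mono (nhdsWithin_le_nhds (s := Ioi 0))).and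
    self_mem_nhdsWithin).exists
  have hd : ∀ r ∈ Icc a b, HasDerivAt (fun r => (c r).1 + ε * (b - r)) (deriv τ r - ε) r := by
    intro r hr
    have h1 := ((hab r hr).2.2.1.differentiableAt (by simp)).hasDerivAt
    have h2 : HasDerivAt (fun r => ε * (b - r)) (ε * (0 - 1)) r :=
      ((hasDerivAt_const r b).sub (hasDerivAt_id r)).const_mul ε
    exact (h1.add h2).congr_deriv (by ring)
  refine ⟨a, b, ε, (hab a ⟨le_rfl, hlt.le⟩).1.1, hlt, (hab b ⟨hlt.le, le_rfl⟩).1.2, h0, ?_, ?_⟩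
  · refine strictMonoOn_of_deriv_pos (convex_Icc a b)
      (fun r hr => (hd r hr).continuousAt.continuousWithinAt) fun r hr => ?_
    have hr' := interior_subset hr
    rw [(hd r hr').deriv]
    linarith [(hε r hr').2]
  · refine (CausalOn.of_chart p (τ := fun r => (c r).1 + ε * (b - r)) (z := y)
      (exists_lipschitzOnWith_of_contDiffAt fun r hr => ?_)
      (exists_lipschitzOnWith_of_contDiffAt fun r hr => (hab r hr).2.2.2.1)
      (fun r hr => (extChartAt (𝓡∂ 3) p).map_source (hab r hr).2.1)
      (Eventually.of_forall fun r hr => ?_)).congr (fun r _ => rfl)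
      fun r hr => ((extChartAt (𝓡∂ 3) p).left_inv (hab r hr).2.1).symm
    · exact (hab r hr).2.2.1.add (by fun_prop)
    · have hr' := Ioo_subset_Icc_self hr
      exact ⟨_, _, hd r hr', ((hab r hr').2.2.2.1.differentiableAt (by simp)).hasDerivAt,
        by linarith [(hε r hr').2], (hε r hr').1.le⟩

end SplitMetric

/-! ### Reachability and delays -/

/-- A continuous strictly increasing function on `[a, b]` has a continuous strictly increasing
inverse on `[τ a, τ b]`. -/
theorem exists_inverse_Icc {τ : ℝ → ℝ} {a b : ℝ} (hab : a ≤ b) (hc : ContinuousOn τ (Icc a b))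
    (hm : StrictMonoOn τ (Icc a b)) : ∃ θ : ℝ → ℝ, ContinuousOn θ (Icc (τ a) (τ b)) ∧
      StrictMonoOn θ (Icc (τ a) (τ b)) ∧ MapsTo θ (Icc (τ a) (τ b)) (Icc a b) ∧
      (∀ r ∈ Icc (τ a) (τ b), τ (θ r) = r) ∧ ∀ s ∈ Icc a b, θ (τ s) = s := by
  have hsurj : SurjOn τ (Icc a b) (Icc (τ a) (τ b)) := intermediate_value_Icc hab hc
  have hmaps : MapsTo τ (Icc a b) (Icc (τ a) (τ b)) := fun s hs =>
    ⟨hm.monotoneOn ⟨le_rfl, hab⟩ hs hs.1, hm.monotoneOn hs ⟨hab, le_rfl⟩ hs.2⟩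
  have h1 : ∀ r ∈ Icc (τ a) (τ b), Function.invFunOn τ (Icc a b) r ∈ Icc a b := fun r hr =>
    Function.invFunOn_mem (hsurj hr)
  have h2 : ∀ r ∈ Icc (τ a) (τ b), τ (Function.invFunOn τ (Icc a b) r) = r := fun r hr =>
    Function.invFunOn_eq (hsurj hr)
  refine ⟨Function.invFunOn τ (Icc a b), ?_, ?_, h1, h2, fun s hs => ?_⟩
  · refine continuousOn_iff_isClosed.2 fun t ht => ⟨τ '' (t ∩ Icc a b), ?_, ?_⟩
    · exact ((isCompact_Icc.inter_left ht).image_of_continuousOn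
        (hc.mono inter_subset_right)).isClosed
    · ext r
      constructor
      · rintro ⟨hr, hrI⟩
        exact ⟨⟨_, ⟨hr, h1 r hrI⟩, h2 r hrI⟩, hrI⟩
      · rintro ⟨⟨s, ⟨hst, hs⟩, rfl⟩, hrI⟩
        refine ⟨?_, hrI⟩
        rwa [mem_preimage, hm.injOn (h1 _ hrI) hs (h2 _ hrI)]
  · intro r hr r' hr' hrr'
    refine (hm.lt_iff_lt (h1 r hr) (h1 r' hr')).1 ?_
    rwa [h2 r hr, h2 r' hr']
  · exact hm.injOn (h1 _ (hmaps hs)) hs (h2 _ (hmaps hs))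

namespace SplitMetric

variable {N : Type*} [TopologicalSpace N] [ChartedSpace (EuclideanHalfSpace 3) N]
  [IsManifold (𝓡∂ 3) ∞ N] {G : SplitMetric N}

variable (G) in
/-- The space-time point `q` can be reached from `p` along a weakly causal curve, parametrized by
time. -/
def Reach (p q : ℝ × N) : Prop :=
  p.1 ≤ q.1 ∧ ∃ x, G.CausalOn id x (Icc p.1 q.1) ∧ x p.1 = p.2 ∧ x q.1 = q.2

theorem Reach.of_le {t t' : ℝ} (h : t ≤ t') (z : N) : G.Reach (t, z) (t', z) :=
  ⟨h, fun _ => z, CausalOn.const continuousOn_id monotoneOn_id z, rfl, rfl⟩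

theorem Reach.trans {p q r : ℝ × N} (h₁ : G.Reach p q) (h₂ : G.Reach q r) : G.Reach p r := by
  obtain ⟨hpq, x₁, hx₁, hp₁, hq₁⟩ := h₁
  obtain ⟨hqr, x₂, hx₂, hq₂, hr₂⟩ := h₂
  have e1 : EqOn (fun s => if s ≤ q.1 then x₁ s else x₂ s) x₁ (Icc p.1 q.1) :=
    fun s hs => if_pos hs.2
  have e2 : EqOn (fun s => if s ≤ q.1 then x₁ s else x₂ s) x₂ (Icc q.1 r.1) := by
    intro s hs
    rcases hs.1.eq_or_lt with rfl | hlt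
    · simp [hq₁, hq₂]
    · exact if_neg (not_le.2 hlt)
  exact ⟨hpq.trans hqr, fun s => if s ≤ q.1 then x₁ s else x₂ s,
    CausalOn.union_Icc hpq hqr (hx₁.congr (fun _ _ => rfl) e1) (hx₂.congr (fun _ _ => rfl) e2),
    (e1 ⟨le_rfl, hpq⟩).trans hp₁, (e2 ⟨hqr, le_rfl⟩).trans hr₂⟩

/-- A weakly causal curve along which time strictly increases can be parametrized by time. -/
theorem CausalOn.reach_of_strictMonoOn {τ : ℝ → ℝ} {x : ℝ → N} {a b : ℝ} (hab : a ≤ b)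
    (h : G.CausalOn τ x (Icc a b)) (hm : StrictMonoOn τ (Icc a b)) :
    G.Reach (τ a, x a) (τ b, x b) := by
  obtain ⟨θ, hc, hθ, hmaps, h1, h2⟩ := exists_inverse_Icc hab h.continuousOn_time hm
  refine ⟨hm.monotoneOn ⟨le_rfl, hab⟩ ⟨hab, le_rfl⟩ hab, x ∘ θ, ?_, ?_, ?_⟩
  · exact (h.comp hc hθ.monotoneOn hmaps).congr (fun r hr => (h1 r hr).symm) fun _ _ => rfl
  · simp [h2 a ⟨le_rfl, hab⟩]
  · simp [h2 b ⟨hab, le_rfl⟩]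

theorem CausalOn.reach {x : ℝ → N} {a b s t : ℝ} (h : G.CausalOn id x (Icc a b))
    (hs : a ≤ s) (hst : s ≤ t) (ht : t ≤ b) : G.Reach (s, x s) (t, x t) :=
  ⟨hst, x, h.mono (Icc_subset_Icc hs ht), rfl, rfl⟩

/-- If the arrival of a causal curve may be delayed, then its departure may be delayed as well:
the delay is made to grow exponentially along the curve, which compensates for the change of the
metric with time. -/
theorem Reach.exists_delay [CompactSpace N] {p q : ℝ × N} (h : G.Reach p q) :
    ∃ δ₀ > 0, ∀ δ, 0 < δ → δ ≤ δ₀ → ∃ ε > 0, G.Reach (p.1 + ε, p.2) (q.1 + δ, q.2) := by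
  obtain ⟨hpq, x, hx, hp, hq⟩ := h
  obtain ⟨K, hK, η, hη, hKη⟩ := G.exists_speedSq_le_of_isCompact
    ((isCompact_Icc (a := p.1) (b := q.1)).prod (isCompact_univ (X := N)))
  -- A delay `d` changes the squared `h`-speed at most by the factor `1 + K d`, so a delay with
  -- `d' = 2 K d` suffices. It ends with the value `δ`, at time `q.1`.
  refine ⟨η, hη, fun δ hδ hδη => ⟨δ * Real.exp (2 * K * (p.1 - q.1)), by positivity, ?_⟩⟩
  set d : ℝ → ℝ := fun s => δ * Real.exp (2 * K * (s - q.1)) with hd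
  have hdpos : ∀ s, 0 < d s := fun s => by positivity
  have hdc : Continuous d := by fun_prop
  have hdle : ∀ s ≤ q.1, d s ≤ δ := fun s hs => by
    have : Real.exp (2 * K * (s - q.1)) ≤ 1 := Real.exp_le_one_iff.2
      (mul_nonpos_of_nonneg_of_nonpos (by positivity) (by linarith))
    exact mul_le_of_le_one_right hδ.le this
  have hgrow : ∀ r r', d r * (2 * K) * (r' - r) ≤ d r' - d r := fun r r' => by
    have h1 := Real.add_one_le_exp (2 * K * (r' - r))
    have h2 : d r' = d r * Real.exp (2 * K * (r' - r)) := by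
      simp only [hd, mul_assoc, ← Real.exp_add]
      ring_nf
    have := hdpos r
    rw [h2]
    nlinarith
  have hT : StrictMonoOn (fun s => s + d s) (Icc p.1 q.1) := by
    intro r _ r' _ hrr'
    have := hgrow r r'
    have h3 : 0 ≤ d r * (2 * K) * (r' - r) :=
      mul_nonneg (mul_nonneg (hdpos r).le (by positivity)) (by linarith)
    simp only
    linarith
  have hcaus : G.CausalOn (fun s => s + d s) x (Icc p.1 q.1) := by
    refine ⟨by fun_prop, hx.continuousOn_space, fun s hs f hf C hC => ?_⟩
    have habs : |s + d s - s| = d s := by simp [abs_of_pos (hdpos s)]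
    have h1 : G.SlopeLT f (s, x s) (C * (1 + K * d s)) :=
      SlopeLT.of_speedSq_le (t := s) (t' := s + d s) hC (mul_nonneg hK (hdpos s).le) fun v => by
        have := hKη s (x s) ⟨hs, mem_univ _⟩ (s + d s)
          (by rw [habs]; exact (hdle s hs.2).trans hδη) v
        rwa [habs] at this
    obtain ⟨u, hu, hmu⟩ := hx.monotone s hs f hf _ h1
    have hev : ∀ᶠ r in 𝓝[Icc p.1 q.1] s, d s / 2 < d r :=
      nhdsWithin_le_nhds (hdc.continuousAt.eventually (lt_mem_nhds (half_lt_self (hdpos s))))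
    refine ⟨u ∩ {r | d s / 2 < d r}, inter_mem hu hev, ?_⟩
    rintro r ⟨hr, hrd⟩ r' ⟨hr', -⟩ hrr'
    have h2 := hmu hr hr' hrr'
    have h3 := hgrow r r'
    simp only [id, mem_ofPred_eq] at h2 hrd ⊢
    have h4 : K * d s * (r' - r) ≤ d r' - d r := by
      refine le_trans ?_ h3
      refine mul_le_mul_of_nonneg_right ?_ (by linarith)
      nlinarith
    have h5 := mul_le_mul_of_nonneg_left h4 hC.1.le
    nlinarith
  have := hcaus.reach_of_strictMonoOn hpq hT
  simpa [hd, hp, hq] using this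

theorem reach_of_causalLE {p q : ℝ × N} (h : G.CausalLE p q) : G.Reach p q := by
  rcases h with rfl | ⟨c, hc, rfl, rfl, hs, hP⟩
  · exact Reach.of_le le_rfl _
  · exact (CausalOn.of_contMDiffOn hc hs (fun s hs => (hP s hs).2.2)
      fun s hs => (hP s hs).2.1).reach_of_strictMonoOn zero_le_one
      (strictMonoOn_time hc hs fun s hs => (hP s hs).2.2)

/-- A chronological relation leaves room for a delay at an intermediate point. -/
theorem ChronLT.exists_reach {p q : ℝ × N} (h : G.ChronLT p q) :
    ∃ m : ℝ × N, ∃ δ > 0, G.Reach p m ∧ G.Reach (m.1 + δ, m.2) q := by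
  obtain ⟨-, c, hc, rfl, rfl, hs, hP⟩ := h
  have hm := strictMonoOn_time hc hs fun s hs => (hP s hs).2
  have hcaus := CausalOn.of_contMDiffOn hc hs (fun s hs => (hP s hs).2)
      fun s hs => (hP s hs).1.le
  obtain ⟨a, b, ε, ha, hab, hb, hε, hmono, hdel⟩ := exists_causalOn_delay_of_timelike hs
    (fun s hs => (hP s hs).2) fun s hs => (hP s hs).1
  refine ⟨c a, ε * (b - a),
    mul_pos hε (by linarith), ?_, ?_⟩
  · have hsub : Icc 0 a ⊆ Icc (0 : ℝ) 1 := Icc_subset_Icc le_rfl (hab.trans hb).le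
    exact (hcaus.mono hsub).reach_of_strictMonoOn ha.le (hm.mono hsub)
  · have hsub : Icc b 1 ⊆ Icc (0 : ℝ) 1 := Icc_subset_Icc (ha.trans hab).le le_rfl
    have h1 := (hcaus.mono hsub).reach_of_strictMonoOn hb.le (hm.mono hsub)
    have h2 := hdel.reach_of_strictMonoOn hab.le hmono
    simp only [sub_self, mul_zero, add_zero] at h2
    exact h2.trans h1

/-- Slack at an intermediate point can be traded for a later departure. -/
theorem Reach.exists_later_departure [CompactSpace N] {p m q : ℝ × N} (h : G.Reach p m) {δ : ℝ}
    (hδ : 0 < δ) (hm : G.Reach (m.1 + δ, m.2) q) : ∃ ε > 0, G.Reach (p.1 + ε, p.2) q := by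
  obtain ⟨δ₀, hδ₀, H⟩ := h.exists_delay
  obtain ⟨ε, hε, h1⟩ := H (min δ δ₀) (lt_min hδ hδ₀) (min_le_right _ _)
  exact ⟨ε, hε, (h1.trans (Reach.of_le (add_le_add_right (min_le_left _ _) _) _)).trans hm⟩

end SplitMetric

/-! ### The latest departure -/

namespace SplitMetric

variable {N : Type*} [TopologicalSpace N] [ChartedSpace (EuclideanHalfSpace 3) N]
  [IsManifold (𝓡∂ 3) ∞ N] {G : SplitMetric N} [T2Space N] [CompactSpace N]

theorem exists_contMDiff_one_of_mem_nhds {x : N} {W : Set N} (hW : W ∈ 𝓝 x) :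
    ∃ f : N → ℝ, ContMDiff (𝓡∂ 3) 𝓘(ℝ, ℝ) ∞ f ∧ f x = 1 ∧ ∀ y ∉ W, f y = 0 := by
  obtain ⟨f, h1, h2, -⟩ := exists_contMDiffMap_one_nhds_of_subset_interior (n := ⊤) (𝓡∂ 3)
    (isClosed_singleton (x := x)) (singleton_subset_iff.2 (mem_interior_iff_mem_nhds.2 hW))
  exact ⟨f, f.contMDiff, h1.self_of_nhdsSet x rfl, h2⟩

/-- Among the causal curves from a closed set of positions to a given space-time point there is one
which departs at the latest possible time: smooth functions are uniformly Lipschitz along causal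
curves, so a pointwise limit along an ultrafilter of a maximizing sequence is again causal. -/
theorem exists_latest_departure {B : Set N} (hB : IsClosed B) {q : ℝ × N}
    (hne : ∃ a, ∃ w ∈ B, G.Reach (a, w) q) :
    ∃ t x, t ≤ q.1 ∧ G.CausalOn id x (Icc t q.1) ∧ x t ∈ B ∧ x q.1 = q.2 ∧
      ∀ a, ∀ w ∈ B, G.Reach (a, w) q → a ≤ t := by
  set A : Set ℝ := {a | ∃ w ∈ B, G.Reach (a, w) q} with hA
  have hAb : BddAbove A := ⟨q.1, by rintro a ⟨w, -, h, -⟩; exact h⟩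
  obtain ⟨a, ha, hlim, haA⟩ := exists_seq_tendsto_sSup hne hAb
  set t := sSup A with ht
  have hat : ∀ n, a n ≤ t := fun n => le_csSup hAb (haA n)
  choose w hwB hreach using haA
  choose haq x hx hxa hxq using hreach
  simp only at haq hx hxa hxq
  have htq : t ≤ q.1 := le_of_tendsto' hlim haq
  set l : Ultrafilter ℕ := hyperfilter ℕ
  have hlat : (l : Filter ℕ) ≤ atTop := Nat.hyperfilter_le_atTop
  -- By compactness of `N`, the curves `x n` converge pointwise along the ultrafilter `l`.
  set y : ℝ → N := fun s => (l.map fun n => x n s).lim with hy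
  have hylim : ∀ s, Tendsto (fun n => x n s) l (𝓝 (y s)) := fun s =>
    (l.map fun n => x n s).le_nhds_lim
  -- A smooth function is Lipschitz along the curves `x n`, uniformly in `n`.
  have hbd : ∀ f : N → ℝ, ContMDiff (𝓡∂ 3) 𝓘(ℝ, ℝ) ∞ f → ∃ C > 0, ∀ n, ∀ r r', a n ≤ r → r ≤ r' →
      r' ≤ q.1 → |f (x n r') - f (x n r)| ≤ C * (r' - r) := by
    intro f hf
    obtain ⟨C, hC⟩ := G.exists_slopeLT_of_isCompact hf
      ((isCompact_Icc (a := a 0) (b := q.1)).prod (isCompact_univ (X := N)))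
    refine ⟨C, (hC (a 0, q.2) ⟨⟨le_rfl, haq 0⟩, mem_univ _⟩).1, fun n r r' h1 h2 h3 => ?_⟩
    exact (hx n).abs_sub_le hf (fun s hs => hC _ ⟨⟨(ha (Nat.zero_le n)).trans hs.1, hs.2⟩,
      mem_univ _⟩) ⟨h1, h2.trans h3⟩ ⟨h1.trans h2, h3⟩ h2
  have hflim : ∀ f : N → ℝ, ContMDiff (𝓡∂ 3) 𝓘(ℝ, ℝ) ∞ f → ∀ s,
      Tendsto (fun n => f (x n s)) l (𝓝 (f (y s))) := fun f hf s =>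
    (hf.continuous.tendsto (y s)).comp (hylim s)
  have hyc : ContinuousOn y (Icc t q.1) := by
    intro s hs W hW
    obtain ⟨f, hf, hf1, hf0⟩ := exists_contMDiff_one_of_mem_nhds hW
    obtain ⟨C, hC, hfC⟩ := hbd f hf
    have hle : ∀ r ∈ Icc t q.1, ∀ r' ∈ Icc t q.1, r ≤ r' → |f (y r') - f (y r)| ≤ C * (r' - r) := by
      intro r hr r' hr' hrr'
      exact le_of_tendsto' ((hflim f hf r').sub (hflim f hf r)).abs fun n =>
        hfC n r r' ((hat n).trans hr.1) hrr' hr'.2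
    have hev : ∀ᶠ r in 𝓝[Icc t q.1] s, C * |r - s| < 1 := by
      have : ContinuousAt (fun r => C * |r - s|) s := by fun_prop
      exact nhdsWithin_le_nhds (this.eventually (gt_mem_nhds (by simp)))
    change ∀ᶠ r in 𝓝[Icc t q.1] s, y r ∈ W
    filter_upwards [hev, self_mem_nhdsWithin] with r hr hrI
    by_contra hrW
    have h0 := hf0 (y r) hrW
    rcases le_total r s with h | h
    · have := hle r hrI s hs h
      rw [abs_sub_comm, abs_of_nonneg (by linarith)] at hr
      rw [hf1, h0] at this
      norm_num at this
      linarith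
    · have := hle s hs r hrI h
      rw [abs_of_nonneg (by linarith)] at hr
      rw [hf1, h0] at this
      norm_num at this
      linarith
  refine ⟨t, y, htq, ⟨continuousOn_id, hyc, fun s hs f hf C hC => ?_⟩, ?_, ?_,
    fun b w hw h => le_csSup hAb ⟨w, hw, h⟩⟩
  · have hop := G.eventually_slopeLT hf hC
    rw [nhds_prod_eq] at hop
    obtain ⟨P, hP, Q, hQ, hPQ⟩ := eventually_prod_iff.1 hop
    obtain ⟨δ, hδ, hball⟩ := Metric.mem_nhds_iff.1 hP
    obtain ⟨χ, hχ, hχ1, hχ0⟩ := exists_contMDiff_one_of_mem_nhds (show {z | Q z} ∈ 𝓝 (y s) from hQ)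
    obtain ⟨D, hD, hχD⟩ := hbd χ hχ
    have hχs : ∀ᶠ n in (l : Filter ℕ), 1 / 2 < χ (x n s) :=
      (hflim χ hχ s).eventually (lt_mem_nhds (by rw [hχ1]; norm_num))
    -- The cut-off function `χ` changes little in a short time, so the curves `x n` stay in the
    -- neighbourhood `Q` of `y s` during a time which does not depend on `n`.
    set δ' := min δ (1 / (4 * D)) with hδ'
    have hδ'0 : 0 < δ' := by positivity
    have hmem : ∀ n, 1 / 2 < χ (x n s) → ∀ r ∈ Icc t q.1, |r - s| < δ' →
        G.SlopeLT f (r, x n r) C := by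
      intro n hn r hr hrs
      refine hPQ (hball ?_) ?_
      · rw [Metric.mem_ball, Real.dist_eq]; exact hrs.trans_le (min_le_left _ _)
      · by_contra hQ
        have h0 := hχ0 (x n r) hQ
        have h1 : D * |r - s| < 1 / 4 := by
          have := hrs.trans_le (min_le_right _ _)
          rw [lt_div_iff₀ (by positivity)] at this
          linarith
        have h2 : |χ (x n s) - χ (x n r)| ≤ D * |r - s| := by
          rcases le_total r s with h | h
          · have := hχD n r s ((hat n).trans hr.1) h hs.2
            rwa [abs_sub_comm r s, abs_of_nonneg (sub_nonneg.2 h)]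
          · have := hχD n s r ((hat n).trans hs.1) h hr.2
            rwa [abs_of_nonneg (sub_nonneg.2 h), abs_sub_comm]
        have := le_abs_self (χ (x n s) - χ (x n r))
        linarith
    refine ⟨Metric.ball s δ' ∩ Icc t q.1, inter_mem (mem_nhdsWithin_of_mem_nhds
      (Metric.ball_mem_nhds _ hδ'0)) self_mem_nhdsWithin, ?_⟩
    rintro r ⟨hrb, hr⟩ r' ⟨hrb', hr'⟩ hrr'
    have hev : ∀ᶠ n in (l : Filter ℕ), C * r - f (x n r) ≤ C * r' - f (x n r') := by
      filter_upwards [hχs] with n hn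
      refine ((hx n).mono (S' := Icc r r') (Icc_subset_Icc ((hat n).trans hr.1)
        hr'.2)).monotoneOn_Icc hf (fun z hz => ?_) ⟨le_rfl, hrr'⟩ ⟨hrr', le_rfl⟩ hrr'
      refine hmem n hn z ⟨hr.1.trans hz.1, hz.2.trans hr'.2⟩ ?_
      rw [Metric.mem_ball, Real.dist_eq, abs_lt] at hrb hrb'
      rw [abs_lt]
      constructor <;> linarith [hz.1, hz.2, hrb.1, hrb'.2]
    exact le_of_tendsto_of_tendsto (tendsto_const_nhds.sub (hflim f hf r))
      (tendsto_const_nhds.sub (hflim f hf r')) hev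
  · set z := (l.map w).lim
    have hz : Tendsto w l (𝓝 z) := (l.map w).le_nhds_lim
    have hzB : z ∈ B := hB.mem_of_tendsto hz (Eventually.of_forall hwB)
    suffices h : y t = z by rwa [h]
    -- A function separating `y t` from `z` is Lipschitz along `x n`, while `a n` tends to `t`.
    by_contra hne
    obtain ⟨f, hf, hf1, hf0⟩ := exists_contMDiff_one_of_mem_nhds (W := {z}ᶜ) (x := y t)
      (isOpen_compl_singleton.mem_nhds hne)
    obtain ⟨C, hC, hfC⟩ := hbd f hf
    have h1 : Tendsto (fun n => C * (t - a n)) l (𝓝 0) := by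
      have : Tendsto (fun n => C * (t - a n)) atTop (𝓝 (C * (t - t))) :=
        (tendsto_const_nhds.sub hlim).const_mul C
      rw [sub_self, mul_zero] at this
      exact this.mono_left hlat
    have h2 : Tendsto (fun n => |f (x n t) - f (w n)|) l (𝓝 |f (y t) - f z|) :=
      ((hflim f hf t).sub ((hf.continuous.tendsto z).comp hz)).abs
    have h3 := le_of_tendsto_of_tendsto' h2 h1 fun n => by
      have := hfC n (a n) t le_rfl (hat n) htq
      rwa [hxa] at this
    rw [hf1, hf0 z (by simp)] at h3
    norm_num at h3
  · exact tendsto_nhds_unique (hylim q.1) (by simp only [hxq]; exact tendsto_const_nhds)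

end SplitMetric

/-! ### Coordinates of weakly causal curves -/

namespace SplitMetric

variable {N : Type*} [TopologicalSpace N] [ChartedSpace (EuclideanHalfSpace 3) N]
  [IsManifold (𝓡∂ 3) ∞ N] {G : SplitMetric N} [T2Space N] [CompactSpace N]

/-- Every linear function of the coordinates agrees near a given point of the chart domain with a
smooth function on the whole manifold. -/
theorem exists_contMDiff_eventuallyEq_chart {p x : N} (hx : x ∈ (extChartAt (𝓡∂ 3) p).source)
    (ℓ : EuclideanSpace ℝ (Fin 3) →L[ℝ] ℝ) :
    ∃ f : N → ℝ, ContMDiff (𝓡∂ 3) 𝓘(ℝ, ℝ) ∞ f ∧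
      ∀ᶠ y in 𝓝 x, f y = ℓ (extChartAt (𝓡∂ 3) p y) := by
  have ho := isOpen_extChartAt_source (I := 𝓡∂ 3) p
  obtain ⟨χ, h0, h1, -⟩ := exists_contMDiffMap_zero_one_nhds_of_isClosed (n := ⊤) (𝓡∂ 3)
    ho.isClosed_compl (isClosed_singleton (x := x))
    (disjoint_singleton_right.2 fun h => h hx)
  refine ⟨fun y => χ y * ℓ (extChartAt (𝓡∂ 3) p y), fun y => ?_, ?_⟩
  · by_cases hy : y ∈ (extChartAt (𝓡∂ 3) p).source
    · have e1 : ContMDiffAt (𝓡∂ 3) 𝓘(ℝ, EuclideanSpace ℝ (Fin 3)) ∞ (extChartAt (𝓡∂ 3) p) y :=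
        contMDiffAt_extChartAt' (by rwa [extChartAt_source] at hy)
      have e2 : ContMDiffAt (𝓡∂ 3) 𝓘(ℝ, ℝ) ∞ (fun y => ℓ (extChartAt (𝓡∂ 3) p y)) y :=
        ℓ.contMDiff.contMDiffAt.comp y e1
      exact (χ.contMDiff y).mul e2
    · have e3 : ∀ᶠ z in 𝓝 y, χ z = 0 := (Filter.Eventually.filter_mono (nhds_le_nhdsSet hy) h0)
      refine (contMDiffAt_const (c := (0 : ℝ))).congr_of_eventuallyEq ?_
      filter_upwards [e3] with z hz
      rw [hz, zero_mul]
  · rw [nhdsSet_singleton] at h1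
    filter_upwards [h1] with y hy
    rw [hy, one_mul]

/-- In charts, the weak causality condition tested on linear functions of the coordinates. -/
theorem CausalOn.exists_monotoneOn_chart {x : ℝ → N} {S : Set ℝ} (h : G.CausalOn id x S) {p : N}
    {s : ℝ} (hs : s ∈ S) (hp : x s ∈ (extChartAt (𝓡∂ 3) p).source)
    (ℓ : EuclideanSpace ℝ (Fin 3) →L[ℝ] ℝ) {C : ℝ} (hC : 0 < C)
    (hℓ : ∀ u, u ≠ 0 → (ℓ u) ^ 2 < C ^ 2 * G.chartForm p (s, extChartAt (𝓡∂ 3) p (x s)) u u) :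
    ∃ u ∈ 𝓝[S] s, MonotoneOn (fun r => C * r - ℓ (extChartAt (𝓡∂ 3) p (x r))) u := by
  obtain ⟨f, hf, hev⟩ := exists_contMDiff_eventuallyEq_chart hp ℓ
  have hz := (extChartAt (𝓡∂ 3) p).map_source hp
  have hd : chartDeriv f p (extChartAt (𝓡∂ 3) p (x s)) = ℓ := by
    have h1 := hasFDerivWithinAt_chart hf p hz
    have h2 : HasFDerivWithinAt (f ∘ (extChartAt (𝓡∂ 3) p).symm) ℓ
        (extChartAt (𝓡∂ 3) p).target (extChartAt (𝓡∂ 3) p (x s)) := by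
      have h3 : ∀ᶠ z in 𝓝[(extChartAt (𝓡∂ 3) p).target] (extChartAt (𝓡∂ 3) p (x s)),
          (f ∘ (extChartAt (𝓡∂ 3) p).symm) z = ℓ z := by
        have h4 : Tendsto (extChartAt (𝓡∂ 3) p).symm
            (𝓝[(extChartAt (𝓡∂ 3) p).target] (extChartAt (𝓡∂ 3) p (x s))) (𝓝 (x s)) := by
          have := continuousOn_extChartAt_symm (I := 𝓡∂ 3) p _ hz
          rwa [ContinuousWithinAt, (extChartAt (𝓡∂ 3) p).left_inv hp] at this
        filter_upwards [h4.eventually hev, self_mem_nhdsWithin] with z hz hzt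
        rw [Function.comp_apply, hz, (extChartAt (𝓡∂ 3) p).right_inv hzt]
      exact ℓ.hasFDerivWithinAt.congr_of_eventuallyEq h3 (h3.self_of_nhdsWithin hz)
    exact (uniqueDiffOn_extChartAt_target p _ hz).eq h1 h2
  have hsl : G.SlopeLT f (id s, x s) C := by
    have := (slopeLT_iff_chart G hf p s C hz).2 ⟨hC, by rwa [hd]⟩
    rwa [(extChartAt (𝓡∂ 3) p).left_inv hp] at this
  obtain ⟨u, hu, hm⟩ := h.monotone s hs f hf C hsl
  have hev' : ∀ᶠ r in 𝓝[S] s, f (x r) = ℓ (extChartAt (𝓡∂ 3) p (x r)) :=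
    (h.continuousOn_space s hs).eventually hev
  refine ⟨u ∩ {r | f (x r) = ℓ (extChartAt (𝓡∂ 3) p (x r))}, inter_mem hu hev', ?_⟩
  rintro r ⟨hr, hre⟩ r' ⟨hr', hre'⟩ hrr'
  have := hm hr hr' hrr'
  change C * r - f (x r) ≤ C * r' - f (x r') at this
  change f (x r) = _ at hre
  change f (x r') = _ at hre'
  rwa [hre, hre'] at this

/-- The coordinates of a causal curve are Lipschitz functions of time. -/
theorem CausalOn.exists_lipschitzOnWith_chart {x : ℝ → N} {a b : ℝ}
    (h : G.CausalOn id x (Icc a b)) {p : N}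
    (hp : ∀ s ∈ Icc a b, x s ∈ (extChartAt (𝓡∂ 3) p).source) :
    ∃ K, LipschitzOnWith K (fun s => extChartAt (𝓡∂ 3) p (x s)) (Icc a b) := by
  set y := fun s => extChartAt (𝓡∂ 3) p (x s) with hy
  have hcoord : ∀ i : Fin 3, ∃ K, LipschitzOnWith K (fun s => y s i) (Icc a b) := by
    intro i
    have hloc : LocallyLipschitzOn (Icc a b) (fun s => y s i) := by
      intro s hs
      set ℓ : EuclideanSpace ℝ (Fin 3) →L[ℝ] ℝ := EuclideanSpace.proj i with hℓ
      obtain ⟨c, hc, hlow⟩ := exists_pos_mul_sq_le_of_posDef (B := G.chartForm p (s, y s))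
        fun u hu => G.chartForm_pos p ⟨mem_univ _, (extChartAt (𝓡∂ 3) p).map_source (hp s hs)⟩ hu
      set C := (‖ℓ‖ + 1) / Real.sqrt c with hCdef
      have hC : 0 < C := by positivity
      have hb : ∀ u, u ≠ 0 → (ℓ u) ^ 2 < C ^ 2 * G.chartForm p (s, y s) u u := by
        intro u hu
        have hn := norm_pos_iff.2 hu
        have h1 : |ℓ u| ≤ ‖ℓ‖ * ‖u‖ := ℓ.le_opNorm u
        calc (ℓ u) ^ 2 = |ℓ u| ^ 2 := (sq_abs _).symm
          _ < ((‖ℓ‖ + 1) * ‖u‖) ^ 2 := by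
            refine pow_lt_pow_left₀ ?_ (abs_nonneg _) two_ne_zero
            nlinarith
          _ = C ^ 2 * (c * ‖u‖ ^ 2) := by
            rw [hCdef, div_pow, Real.sq_sqrt hc.le]
            field_simp
          _ ≤ _ := by gcongr; exact hlow u
      obtain ⟨u₁, hu₁, hm₁⟩ := h.exists_monotoneOn_chart hs (hp s hs) ℓ hC hb
      obtain ⟨u₂, hu₂, hm₂⟩ := h.exists_monotoneOn_chart hs (hp s hs) (-ℓ) hC
        (fun u hu => by rw [neg_apply, neg_sq]; exact hb u hu)
      refine ⟨⟨C, hC.le⟩, u₁ ∩ u₂, inter_mem hu₁ hu₂, LipschitzOnWith.of_le_add_mul _ ?_⟩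
      intro r hr r' hr'
      change ℓ (y r) ≤ ℓ (y r') + C * dist r r'
      rcases le_total r r' with hrr | hrr
      · have := hm₂ hr.2 hr'.2 hrr
        simp only [neg_apply] at this
        rw [dist_comm, Real.dist_eq, abs_of_nonneg (sub_nonneg.2 hrr)]
        linarith
      · have := hm₁ hr'.1 hr.1 hrr
        simp only at this
        rw [Real.dist_eq, abs_of_nonneg (sub_nonneg.2 hrr)]
        linarith
    exact hloc.exists_lipschitzOnWith_of_compact isCompact_Icc
  choose K hK using hcoord
  have h1 : LipschitzOnWith (Finset.univ.sup K) (fun s i => y s i) (Icc a b) := by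
    refine LipschitzOnWith.of_dist_le_mul fun r hr r' hr' => (dist_pi_le_iff (by positivity)).2
      fun i => ((hK i).dist_le_mul r hr r' hr').trans ?_
    gcongr
    exact_mod_cast Finset.le_sup (f := K) (Finset.mem_univ i)
  exact ⟨_, (PiLp.lipschitzWith_toLp 2 fun _ : Fin 3 => ℝ).comp_lipschitzOnWith h1⟩

/-- The coordinates of a causal curve have `h`-speed at most one at almost every time. -/
theorem CausalOn.ae_chartForm_le_one {x : ℝ → N} {a b : ℝ}
    (h : G.CausalOn id x (Icc a b)) {p : N}
    (hp : ∀ s ∈ Icc a b, x s ∈ (extChartAt (𝓡∂ 3) p).source) :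
    ∀ᵐ s, s ∈ Ioo a b → ∃ v, HasDerivAt (fun s => extChartAt (𝓡∂ 3) p (x s)) v s ∧
      G.chartForm p (s, extChartAt (𝓡∂ 3) p (x s)) v v ≤ 1 := by
  obtain ⟨K, hK⟩ := h.exists_lipschitzOnWith_chart hp
  filter_upwards [hK.ae_differentiableWithinAt_of_mem] with s hs hsI
  have hsI' := Ioo_subset_Icc_self hsI
  have hd := (hs hsI').differentiableAt (Icc_mem_nhds hsI.1 hsI.2)
  set y := fun s => extChartAt (𝓡∂ 3) p (x s) with hy
  set v := deriv y s with hv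
  refine ⟨v, hd.hasDerivAt, ?_⟩
  set B := G.chartForm p (s, y s) with hB
  have hpos : ∀ u, u ≠ 0 → 0 < B u u := fun u hu =>
    G.chartForm_pos p ⟨mem_univ _, (extChartAt (𝓡∂ 3) p).map_source (hp s hsI')⟩ hu
  rcases eq_or_ne v 0 with h0 | h0
  · change B v v ≤ 1
    rw [h0]; simp
  have hvv := hpos v h0
  have hcs : ∀ u, (B v u) ^ 2 ≤ B v v * B u u := by
    intro u
    have hq : ∀ c : ℝ, 0 ≤ B u u + 2 * c * B v u + c ^ 2 * B v v := by
      intro c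
      have h1 : 0 ≤ B (u + c • v) (u + c • v) := by
        rcases eq_or_ne (u + c • v) 0 with h | h
        · rw [h]; simp
        · exact (hpos _ h).le
      have h2 : B u v = B v u := G.chartForm_symm p _ _ _
      simp only [map_add, map_smul, add_apply, smul_apply, smul_eq_mul, h2] at h1
      linarith
    have h3 := hq (-(B v u) / B v v)
    have h4 : B u u + 2 * (-(B v u) / B v v) * B v u + (-(B v u) / B v v) ^ 2 * B v v
        = (B v v * B u u - (B v u) ^ 2) / B v v := by
      field_simp
      ring
    rw [h4] at h3
    have := (div_nonneg_iff.1 h3).resolve_right (fun h => absurd h.2 (not_le.2 hvv))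
    linarith [this.1]
  -- Testing with the linear function `B v`, whose slope is the `h`-norm of `v`.
  have hkey : ∀ C, 0 < C → B v v < C ^ 2 → B v v ≤ C := by
    intro C hC hCv
    obtain ⟨u, hu, hm⟩ := h.exists_monotoneOn_chart hsI' (hp s hsI') (B v) hC fun w hw =>
      (hcs w).trans_lt (mul_lt_mul_of_pos_right hCv (hpos w hw))
    rw [nhdsWithin_eq_nhds.2 (Icc_mem_nhds hsI.1 hsI.2)] at hu
    have hder : HasDerivAt (fun r => C * r - B v (y r)) (C * 1 - B v v) s :=
      ((hasDerivAt_id s).const_mul C).sub ((B v).hasFDerivAt.comp_hasDerivAt s hd.hasDerivAt)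
    have hm' := hm.derivWithin_nonneg (x := s)
    rw [derivWithin_of_mem_nhds hu] at hm'
    have := hder.deriv ▸ hm'
    linarith
  by_contra hcon
  have h1 : 1 < B v v := not_le.1 hcon
  have h2 := hkey ((B v v + 1) / 2) (by linarith) (by nlinarith [sq_nonneg (B v v - 1)])
  linarith

end SplitMetric

/-! ### Unimprovable curves -/

/-- Time strictly increases along a shortcut, with rate at least `1 / 2`. -/
theorem IsShortcut.strictMonoOn {E : Type*} [NormedAddCommGroup E] [NormedSpace ℝ E]
    {L : ℝ × E × E → ℝ} {O : Set E} {y : ℝ → E} {a b ζ : ℝ} {τ : ℝ → ℝ} {z : ℝ → E}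
    (h : IsShortcut L O y a b ζ τ z) : StrictMonoOn τ (Icc a b) := by
  obtain ⟨K, hK⟩ := h.lipschitz_time
  have hlip : LipschitzOnWith (K + ‖(1 / 2 : ℝ)‖₊) (fun r => τ r - 1 / 2 * r) (Icc a b) :=
    hK.sub (lipschitzWith_smul (1 / 2 : ℝ)).lipschitzOnWith
  have hm := monotoneOn_of_ae_deriv_nonneg hlip (by
    filter_upwards [h.ae_causal] with s hs hsI _
    obtain ⟨τ', z', h1, -, h3, -⟩ := hs hsI
    have : HasDerivAt (fun r => τ r - 1 / 2 * r) (τ' - 1 / 2 * 1) s :=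
      h1.sub ((hasDerivAt_id s).const_mul _)
    rw [this.deriv]
    linarith)
  intro r hr r' hr' hrr'
  have := hm hr hr' hrr'.le
  simp only at this
  linarith

namespace SplitMetric

variable {N : Type*} [TopologicalSpace N] [ChartedSpace (EuclideanHalfSpace 3) N]
  [IsManifold (𝓡∂ 3) ∞ N]

/-- A causal curve with values in the interior (except perhaps for its initial point) from whose
points the final point cannot be reached with a delayed start. -/
structure IsUnimprovable (G : SplitMetric N) (x : ℝ → N) (a b : ℝ) : Prop where
  lt : a < b
  causal : G.CausalOn id x (Icc a b)
  interior : ∀ s ∈ Ioc a b, x s ∈ (𝓡∂ 3).interior N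
  not_reach : ∀ s ∈ Icc a b, ∀ δ > 0, ¬ G.Reach (s + δ, x s) (b, x b)

variable {G : SplitMetric N} [T2Space N] [CompactSpace N]

/-- In charts, unimprovable curves are smooth up to the initial time, have unit `h`-speed, and
satisfy the equations of motion. -/
theorem IsUnimprovable.contDiffOn_chart {x : ℝ → N} {t₀ t₁ : ℝ} (h : G.IsUnimprovable x t₀ t₁)
    {p : N} {a b : ℝ} (ha : t₀ ≤ a) (hab : a < b) (hb : b ≤ t₁)
    (hp : ∀ s ∈ Icc a b, x s ∈ (extChartAt (𝓡∂ 3) p).source) :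
    ContDiffOn ℝ ∞ (fun s => extChartAt (𝓡∂ 3) p (x s)) (Icc a b) ∧
      IsOptimalMotion (G.chartForm p) (univ ×ˢ (extChartAt (𝓡∂ 3) p).target)
        (fun s => extChartAt (𝓡∂ 3) p (x s))
        (derivWithin (fun s => extChartAt (𝓡∂ 3) p (x s)) (Icc a b)) (Icc a b) := by
  have hcaus := h.causal.mono (Icc_subset_Icc ha hb)
  have hlip := hcaus.exists_lipschitzOnWith_chart hp
  have hpos : ∀ k ∈ (univ : Set ℝ) ×ˢ (extChartAt (𝓡∂ 3) p).target, ∀ v, v ≠ 0 →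
    0 < G.chartForm p k v v := fun k hk v hv => G.chartForm_pos p hk hv
  refine contDiffOn_and_isOptimalMotion_Icc (uniqueDiffOn_extChartAt_target p) hpos
    (G.contDiffOn_chartForm p) hab hlip
    (fun s hs => (extChartAt (𝓡∂ 3) p).map_source (hp s hs)) fun a' ha' => ?_
  have hsub : Icc a' b ⊆ Icc a b := Icc_subset_Icc ha'.1.le le_rfl
  obtain ⟨K, hK⟩ := hlip
  refine exists_isOptimalMotion_of_no_shortcut (ζ := 1)
    (fun k _ u v => G.chartForm_symm p k u v) hpos
    (G.contDiffOn_chartForm p) ha'.2 one_pos ⟨K, hK.mono hsub⟩ (fun s hs => ?_)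
    ((hcaus.mono hsub).ae_chartForm_le_one fun s hs => hp s (hsub hs)) ?_
  · have hi : (𝓡∂ 3).IsInteriorPoint (x s) :=
      h.interior s ⟨ha.trans_lt (ha'.1.trans_le hs.1), hs.2.trans hb⟩
    have hsrc := hp s (hsub hs)
    rw [extChartAt_source] at hsrc
    exact ((𝓡∂ 3).isInteriorPoint_iff_of_mem_atlas (n := ∞) (by simp)
      (chart_mem_atlas _ p) hsrc).1 hi
  -- A shortcut between points of the curve would allow a delayed start of its later part.
  · rintro ⟨τ, z, hτz⟩
    have hz : ∀ s ∈ Icc a' b, z s ∈ (extChartAt (𝓡∂ 3) p).target := fun s hs =>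
      interior_subset (hτz.mem s hs)
    have hc : G.CausalOn τ (fun s => (extChartAt (𝓡∂ 3) p).symm (z s)) (Icc a' b) := by
      refine CausalOn.of_chart p hτz.lipschitz_time hτz.lipschitz_space hz ?_
      filter_upwards [hτz.ae_causal] with s hs hsI
      obtain ⟨τ', z', h1, h2, h3, h4⟩ := hs hsI
      exact ⟨τ', z', h1, h2, by linarith, h4⟩
    have hr := hc.reach_of_strictMonoOn ha'.2.le hτz.strictMonoOn
    simp only [hτz.time_end, hτz.space_start, hτz.space_end] at hr
    rw [(extChartAt (𝓡∂ 3) p).left_inv (hp a' (hsub (left_mem_Icc.2 ha'.2.le))),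
      (extChartAt (𝓡∂ 3) p).left_inv (hp b (right_mem_Icc.2 hab.le))] at hr
    have hr2 := h.causal.reach (ha.trans hab.le) hb le_rfl
    refine h.not_reach a' ⟨ha.trans ha'.1.le, ha'.2.le.trans hb⟩ (τ a' - a')
      (sub_pos.2 hτz.lt_start) ?_
    rw [add_sub_cancel]
    exact hr.trans hr2

/-- The causal curve with the latest departure from the boundary is unimprovable. -/
theorem exists_isUnimprovable {q : ℝ × N} (hq : q.2 ∈ (𝓡∂ 3).interior N) {p : ℝ × N}
    (hp : p.2 ∈ (𝓡∂ 3).boundary N) (hpq : G.Reach p q) :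
    ∃ x t, p.1 ≤ t ∧ x t ∈ (𝓡∂ 3).boundary N ∧ x q.1 = q.2 ∧ G.IsUnimprovable x t q.1 := by
  obtain ⟨t, x, htq, hx, htB, hxq, hmax⟩ := exists_latest_departure (G := G)
    ((𝓡∂ 3).isClosed_boundary (M := N) (n := ∞) (by simp)) ⟨p.1, p.2, hp, hpq⟩
  have hdisj : ∀ z : N, z ∈ (𝓡∂ 3).boundary N → z ∉ (𝓡∂ 3).interior N := fun z hz hz' =>
    (𝓡∂ 3).disjoint_interior_boundary (M := N) |>.le_bot ⟨hz', hz⟩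
  have hlt : t < q.1 := by
    refine htq.lt_of_ne ?_
    rintro rfl
    exact hdisj _ htB (hxq ▸ hq)
  refine ⟨x, t, hmax _ _ hp hpq, htB, hxq, hlt, hx, fun s hs => ?_, fun s hs δ hδ => ?_⟩
  -- A later point of the curve on the boundary would be a better point of departure.
  · by_contra hs'
    have hb : x s ∈ (𝓡∂ 3).boundary N := by
      rw [← (𝓡∂ 3).compl_interior]; exact hs'
    have hr : G.Reach (s, x s) q := by
      have := hx.reach hs.1.le hs.2 le_rfl
      rwa [hxq] at this
    exact absurd (hmax s _ hb hr) (not_le.2 hs.1)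
  · rw [hxq]
    intro hr
    obtain ⟨ε, hε, h1⟩ := (hx.reach le_rfl hs.1 hs.2).exists_later_departure hδ hr
    have h2 := hmax _ _ htB h1
    simp only at h2
    linarith

end SplitMetric

/-! ### The rate of change of energy -/

set_option maxSynthPendingDepth 5 in
theorem contDiffOn_halfTimeDeriv_comp {E : Type*} [NormedAddCommGroup E] [InnerProductSpace ℝ E]
    {h : ℝ × E → E →L[ℝ] E →L[ℝ] ℝ} {D : Set (ℝ × E)} (hD : UniqueDiffOn ℝ D)
    (hh : ContDiffOn ℝ ∞ h D) {y V : ℝ → E} {S : Set ℝ} (hy : ContDiffOn ℝ ∞ y S)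
    (hV : ContDiffOn ℝ ∞ V S) (hmem : ∀ s ∈ S, (s, y s) ∈ D) :
    ContDiffOn ℝ ∞ (fun s => halfTimeDeriv h D s (y s) (V s)) S := by
  have h1 : ContDiffOn ℝ ∞ (fun s => fderivWithin ℝ h D (s, y s)) S :=
    (hh.fderivWithin hD (m := ∞) (by simp)).comp (contDiffOn_id.prodMk hy) hmem
  exact contDiffOn_const.mul (((h1.clm_apply contDiffOn_const).clm_apply hV).clm_apply hV)

set_option maxSynthPendingDepth 5 in
theorem hasDerivAt_time {E : Type*} [NormedAddCommGroup E] [InnerProductSpace ℝ E]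
    {h : ℝ × E → E →L[ℝ] E →L[ℝ] ℝ} {T : Set E} (hh : ContDiffOn ℝ ∞ h (univ ×ˢ T))
    (s : ℝ) {x : E} (hx : x ∈ T) (v : E) :
    HasDerivAt (fun t => h (t, x) v v) (2 * halfTimeDeriv h (univ ×ˢ T) s x v) s := by
  have h1 := (hh.differentiableOn (by simp) (s, x) ⟨mem_univ _, hx⟩).hasFDerivWithinAt
  have h2 : HasDerivAt (fun t : ℝ => (t, x)) ((1 : ℝ), (0 : E)) s :=
    (hasDerivAt_id s).prodMk (hasDerivAt_const s x)
  have h3 : HasDerivAt (fun t => h (t, x)) (fderivWithin ℝ h (univ ×ˢ T) (s, x) (1, 0)) s :=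
    h1.comp_hasDerivAt s h2 (Eventually.of_forall fun t => mk_mem_prod (mem_univ t) hx)
  have h4 := (h3.clm_apply (hasDerivAt_const s v)).clm_apply (hasDerivAt_const s v)
  refine h4.congr_deriv ?_
  simp [halfTimeDeriv]

namespace SplitMetric

variable {N : Type*} [TopologicalSpace N] [ChartedSpace (EuclideanHalfSpace 3) N]
  [IsManifold (𝓡∂ 3) ∞ N]

variable (G : SplitMetric N)

theorem exists_hasDerivWithinAt_chart {x : ℝ → N} {S : Set ℝ} {s : ℝ}
    (hx : MDifferentiableWithinAt 𝓘(ℝ, ℝ) (𝓡∂ 3) x S s) {p : N}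
    (hp : x s ∈ (extChartAt (𝓡∂ 3) p).source) :
    ∃ v, HasDerivWithinAt (fun r => extChartAt (𝓡∂ 3) p (x r)) v S s ∧
      ∀ t, G.speedSq (t, x s) (curveVelocity (𝓡∂ 3) x S s)
        = G.chartForm p (t, extChartAt (𝓡∂ 3) p (x s)) v v := by
  have hp' : x s ∈ (chartAt (EuclideanHalfSpace 3) p).source := by
    rwa [extChartAt_source] at hp
  have h3 := (mdifferentiableAt_extChartAt (I := 𝓡∂ 3) hp').hasMFDerivAt.comp_hasMFDerivWithinAt
    s hx.hasMFDerivWithinAt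
  set w := curveVelocity (𝓡∂ 3) x S s with hw
  set D : TangentSpace (𝓡∂ 3) (x s) →L[ℝ] EuclideanSpace ℝ (Fin 3) :=
    mfderiv (𝓡∂ 3) 𝓘(ℝ, EuclideanSpace ℝ (Fin 3)) (extChartAt (𝓡∂ 3) p) (x s) with hD
  set A : ℝ →L[ℝ] EuclideanSpace ℝ (Fin 3) := mfderivWithin 𝓘(ℝ, ℝ) (𝓡∂ 3) x S s
  refine ⟨D w, ?_, fun t => ?_⟩
  · have e : HasFDerivWithinAt (fun r => extChartAt (𝓡∂ 3) p (x r)) (D.comp A) S s :=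
      h3.hasFDerivWithinAt
    exact e.hasDerivWithinAt
  · have h4 : chartFrame p (extChartAt (𝓡∂ 3) p (x s)) (D w) = w :=
      DFunLike.congr_fun (mfderivWithin_extChartAt_symm_comp_mfderiv_extChartAt' (I := 𝓡∂ 3) hp) w
    rw [chartForm_self, h4, (extChartAt (𝓡∂ 3) p).left_inv hp]

/-- Half the rate of change, due to the time dependence of `h = κ / α` alone, of the squared
`h`-length of the velocity of `x`. -/
def energyRate (x : ℝ → N) (S : Set ℝ) (s : ℝ) : ℝ :=
  1 / 2 * deriv (fun t => G.speedSq (t, x s) (curveVelocity (𝓡∂ 3) x S s)) s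

variable {G} [T2Space N] [CompactSpace N]

theorem IsUnimprovable.exists_chart_Icc {x : ℝ → N} {t₀ t₁ s : ℝ} (h : G.IsUnimprovable x t₀ t₁)
    (hs : s ∈ Icc t₀ t₁) : ∃ a b, t₀ ≤ a ∧ a < b ∧ b ≤ t₁ ∧ s ∈ Icc a b ∧
      Icc a b ∈ 𝓝[Icc t₀ t₁] s ∧ ∀ r ∈ Icc a b, x r ∈ (extChartAt (𝓡∂ 3) (x s)).source := by
  have hlt := h.lt
  obtain ⟨δ, hδ, hball⟩ := Metric.mem_nhdsWithin_iff.1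
    ((h.causal.continuousOn_space s hs) (extChartAt_source_mem_nhds (I := 𝓡∂ 3) (x s)))
  refine ⟨max (s - δ / 2) t₀, min (s + δ / 2) t₁, le_max_right _ _, ?_, min_le_right _ _,
    ?_, ?_, ?_⟩
  · simp only [max_lt_iff, lt_min_iff]
    refine ⟨⟨?_, ?_⟩, ?_, ?_⟩ <;> linarith [hs.1, hs.2]
  · refine ⟨max_le ?_ hs.1, le_min ?_ hs.2⟩ <;> linarith
  · rw [← Icc_inter_Icc]
    exact inter_mem (mem_nhdsWithin_of_mem_nhds (Icc_mem_nhds (by linarith) (by linarith)))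
      self_mem_nhdsWithin
  · intro r hr
    simp only [mem_Icc, sup_le_iff, le_inf_iff] at hr
    refine hball ⟨?_, hr.1.2, hr.2.2⟩
    rw [Real.ball_eq_Ioo]
    constructor <;> linarith [hr.1.1, hr.2.1]

theorem IsUnimprovable.contMDiffOn {x : ℝ → N} {t₀ t₁ : ℝ} (h : G.IsUnimprovable x t₀ t₁) :
    ContMDiffOn 𝓘(ℝ, ℝ) (𝓡∂ 3) ∞ x (Icc t₀ t₁) := by
  intro s hs
  obtain ⟨a, b, ha, hab, hb, hsab, hnhds, hsrc⟩ := h.exists_chart_Icc hs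
  have h1 := (h.contDiffOn_chart ha hab hb hsrc).1.contMDiffOn
  have h2 : ContMDiffOn 𝓘(ℝ, ℝ) (𝓡∂ 3) ∞ (fun r => (extChartAt (𝓡∂ 3) (x s)).symm
      (extChartAt (𝓡∂ 3) (x s) (x r))) (Icc a b) :=
    (contMDiffOn_extChartAt_symm (x s)).comp h1 fun r hr =>
      (extChartAt (𝓡∂ 3) (x s)).map_source (hsrc r hr)
  have h3 : ContMDiffOn 𝓘(ℝ, ℝ) (𝓡∂ 3) ∞ x (Icc a b) := h2.congr fun r hr =>
    ((extChartAt (𝓡∂ 3) (x s)).left_inv (hsrc r hr)).symm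
  exact (h3 s hsab).mono_of_mem_nhdsWithin hnhds

/-- The energy rate is defined without reference to a chart, so the function `½ h_t(V, V)` of the
equations of motion is the same in all charts. -/
theorem IsUnimprovable.energyRate_eq {x : ℝ → N} {t₀ t₁ : ℝ} (h : G.IsUnimprovable x t₀ t₁)
    {p : N} {a b : ℝ} (ha : t₀ ≤ a) (hab : a < b) (hb : b ≤ t₁)
    (hp : ∀ s ∈ Icc a b, x s ∈ (extChartAt (𝓡∂ 3) p).source) {s : ℝ} (hs : s ∈ Icc a b) :
    G.energyRate x (Icc t₀ t₁) s
      = halfTimeDeriv (G.chartForm p) (univ ×ˢ (extChartAt (𝓡∂ 3) p).target) s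
        (extChartAt (𝓡∂ 3) p (x s))
        (derivWithin (fun s => extChartAt (𝓡∂ 3) p (x s)) (Icc a b) s) := by
  have hsub : Icc a b ⊆ Icc t₀ t₁ := Icc_subset_Icc ha hb
  obtain ⟨v, hv, hsp⟩ := G.exists_hasDerivWithinAt_chart
    ((h.contMDiffOn s (hsub hs)).mdifferentiableWithinAt (by simp)) (hp s hs)
  rw [(hv.mono hsub).derivWithin (uniqueDiffOn_Icc hab s hs), energyRate]
  simp only [hsp]
  rw [(hasDerivAt_time (G.contDiffOn_chartForm p) s
    ((extChartAt (𝓡∂ 3) p).map_source (hp s hs)) v).deriv]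
  ring

theorem IsUnimprovable.contDiffOn_energyRate {x : ℝ → N} {t₀ t₁ : ℝ}
    (h : G.IsUnimprovable x t₀ t₁) : ContDiffOn ℝ ∞ (G.energyRate x (Icc t₀ t₁)) (Icc t₀ t₁) := by
  intro s hs
  obtain ⟨a, b, ha, hab, hb, hsab, hnhds, hsrc⟩ := h.exists_chart_Icc hs
  have h1 := (h.contDiffOn_chart ha hab hb hsrc).1
  have h2 := contDiffOn_halfTimeDeriv_comp
    (uniqueDiffOn_univ.prod (uniqueDiffOn_extChartAt_target (I := 𝓡∂ 3) (x s)))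
    (G.contDiffOn_chartForm (x s)) h1 (h1.derivWithin (m := ∞) (uniqueDiffOn_Icc hab) (by simp))
    fun r hr => ⟨mem_univ _, (extChartAt (𝓡∂ 3) (x s)).map_source (hsrc r hr)⟩
  have h3 := h2.congr fun r hr => h.energyRate_eq ha hab hb hsrc hr
  exact (h3 s hsab).mono_of_mem_nhdsWithin hnhds

end SplitMetric

/-! ### Change of time and the metric in charts -/

/-- A smooth positive function `k` on a compact interval of times is, up to a constant factor, the
speed of a smooth time change defined on `[0, 1]`. -/
theorem exists_timeChange {k : ℝ → ℝ} {t₀ t₁ : ℝ} (ht : t₀ < t₁)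
    (hk : ContDiffOn ℝ ∞ k (Icc t₀ t₁)) (hpos : ∀ s ∈ Icc t₀ t₁, 0 < k s) :
    ∃ c > 0, ∃ θ : ℝ → ℝ, ContDiffOn ℝ ∞ θ (Icc 0 1) ∧ StrictMonoOn θ (Icc 0 1) ∧
      MapsTo θ (Icc 0 1) (Icc t₀ t₁) ∧ θ 0 = t₀ ∧ θ 1 = t₁ ∧
      ∀ r ∈ Icc (0 : ℝ) 1, HasDerivWithinAt θ (c * k (θ r)) (Icc 0 1) r := by
  have hw : ContinuousOn (fun s => (k s)⁻¹) (Icc t₀ t₁) :=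
    hk.continuousOn.inv₀ fun s hs => (hpos s hs).ne'
  set Λ₀ : ℝ → ℝ := fun s => ∫ r in t₀..s, (k r)⁻¹ with hΛ₀
  have hd₀ : ∀ s ∈ Icc t₀ t₁, HasDerivWithinAt Λ₀ (k s)⁻¹ (Icc t₀ t₁) s := fun s hs =>
    hasDerivWithinAt_primitive hw hs
  have hm₀ : StrictMonoOn Λ₀ (Icc t₀ t₁) := by
    refine strictMonoOn_of_deriv_pos (convex_Icc _ _)
      (fun s hs => (hd₀ s hs).continuousWithinAt) fun s hs => ?_
    rw [interior_Icc] at hs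
    rw [((hd₀ s (Ioo_subset_Icc_self hs)).hasDerivAt (Icc_mem_nhds hs.1 hs.2)).deriv]
    exact inv_pos.2 (hpos s (Ioo_subset_Icc_self hs))
  have h0 : Λ₀ t₀ = 0 := by simp [hΛ₀]
  set c := Λ₀ t₁ with hc
  have hcpos : 0 < c := by
    have := hm₀ (left_mem_Icc.2 ht.le) (right_mem_Icc.2 ht.le) ht
    rwa [h0] at this
  set Λ : ℝ → ℝ := fun s => c⁻¹ * Λ₀ s with hΛ
  have hd : ∀ s ∈ Icc t₀ t₁, HasDerivWithinAt Λ (c⁻¹ * (k s)⁻¹) (Icc t₀ t₁) s := fun s hs =>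
    (hd₀ s hs).const_mul _
  have hm : StrictMonoOn Λ (Icc t₀ t₁) := fun s hs s' hs' h =>
    mul_lt_mul_of_pos_left (hm₀ hs hs' h) (inv_pos.2 hcpos)
  have hΛ0 : Λ t₀ = 0 := by simp [hΛ, h0]
  have hΛ1 : Λ t₁ = 1 := by
    simp only [hΛ, ← hc]
    exact inv_mul_cancel₀ hcpos.ne'
  obtain ⟨θ, hθc, hθm, hθI, hθ1, hθ2⟩ := exists_inverse_Icc ht.le
    (fun s hs => (hd s hs).continuousWithinAt) hm
  rw [hΛ0, hΛ1] at hθc hθm hθI hθ1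
  have hθd : ∀ r ∈ Icc (0 : ℝ) 1, HasDerivWithinAt θ (c * k (θ r)) (Icc 0 1) r := by
    intro r hr
    have hk0 := hpos _ (hθI hr)
    have hne : c⁻¹ * (k (θ r))⁻¹ ≠ 0 := by positivity
    have h1 : HasFDerivWithinAt Λ
        ((ContinuousLinearEquiv.unitsEquivAut ℝ (Units.mk0 _ hne) : ℝ ≃L[ℝ] ℝ) : ℝ →L[ℝ] ℝ)
        (Icc t₀ t₁) (θ r) := hd _ (hθI hr)
    have h2 := (HasFDerivWithinAt.of_local_left_inverse ((hθc r hr).tendsto_nhdsWithin hθI) h1 hr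
      (eventually_mem_nhdsWithin.mono hθ1)).hasDerivWithinAt
    refine h2.congr_deriv ?_
    simp [mul_comm]
  refine ⟨c, hcpos, θ, ?_, hθm, hθI, ?_, ?_, hθd⟩
  · refine contDiffOn_of_hasDerivWithinAt (uniqueDiffOn_Icc one_pos) (D := univ ×ˢ Icc t₀ t₁)
      (Φ := fun q => c * k q.2) ?_ (fun r hr => ⟨mem_univ _, hθI hr⟩) hθd
    exact contDiffOn_const.mul (hk.comp contDiffOn_snd fun q hq => hq.2)
  · rw [← hΛ0]; exact hθ2 _ (left_mem_Icc.2 ht.le)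
  · rw [← hΛ1]; exact hθ2 _ (right_mem_Icc.2 ht.le)

namespace SplitMetric

variable {N : Type*} [TopologicalSpace N] [ChartedSpace (EuclideanHalfSpace 3) N]
  [IsManifold (𝓡∂ 3) ∞ N] (G : SplitMetric N)

/-- The Lorentzian metric in the chart at `p`: `α (h - dt²)`, with `h` the form `chartForm`. -/
def metricForm (p : N) (z : ℝ × EuclideanSpace ℝ (Fin 3)) :
    ℝ × EuclideanSpace ℝ (Fin 3) →L[ℝ] ℝ × EuclideanSpace ℝ (Fin 3) →L[ℝ] ℝ :=
  G.α (z.1, (extChartAt (𝓡∂ 3) p).symm z.2) •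
    ((G.chartForm p z).bilinearComp (ContinuousLinearMap.snd ℝ ℝ (EuclideanSpace ℝ (Fin 3)))
        (ContinuousLinearMap.snd ℝ ℝ (EuclideanSpace ℝ (Fin 3)))
      - (ContinuousLinearMap.mul ℝ ℝ).bilinearComp
        (ContinuousLinearMap.fst ℝ ℝ (EuclideanSpace ℝ (Fin 3)))
        (ContinuousLinearMap.fst ℝ ℝ (EuclideanSpace ℝ (Fin 3))))

theorem metricForm_apply (p : N) (z u v : ℝ × EuclideanSpace ℝ (Fin 3)) :
    G.metricForm p z u v = G.α (z.1, (extChartAt (𝓡∂ 3) p).symm z.2) *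
      (G.chartForm p z u.2 v.2 - u.1 * v.1) := by
  simp [metricForm]

theorem range_spacetimeModel : range spacetimeModel = univ ×ˢ range (𝓡∂ 3) :=
  (ModelWithCorners.range_prod (I := 𝓘(ℝ, ℝ)) (J := 𝓡∂ 3)).trans (by simp)

theorem chartMetric_eq_metricForm (t : ℝ) (p : N) {z : ℝ × EuclideanSpace ℝ (Fin 3)}
    (hz : z.2 ∈ (extChartAt (𝓡∂ 3) p).target) (u v : ℝ × EuclideanSpace ℝ (Fin 3)) :
    chartMetric spacetimeModel G.g (t, p) z u v = G.metricForm p z u v := by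
  have hzr : z ∈ range spacetimeModel := by
    rw [range_spacetimeModel]
    exact ⟨mem_univ _, extChartAt_target_subset_range p hz⟩
  have hA : mfderivWithin 𝓘(ℝ, ℝ × EuclideanSpace ℝ (Fin 3)) spacetimeModel
      (extChartAt spacetimeModel (t, p)).symm (range spacetimeModel) z
      = (ContinuousLinearMap.fst ℝ ℝ (EuclideanSpace ℝ (Fin 3))).prod
        ((chartFrame p z.2).comp (ContinuousLinearMap.snd ℝ ℝ (EuclideanSpace ℝ (Fin 3)))) := by
    refine HasMFDerivWithinAt.mfderivWithin ?_ (spacetimeModel.uniqueMDiffOn _ hzr)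
    have h1 : HasMFDerivWithinAt 𝓘(ℝ, ℝ × EuclideanSpace ℝ (Fin 3)) 𝓘(ℝ, ℝ) Prod.fst
        (range spacetimeModel) z (ContinuousLinearMap.fst ℝ ℝ (EuclideanSpace ℝ (Fin 3))) :=
      hasFDerivWithinAt_fst.hasMFDerivWithinAt
    have h2 : HasMFDerivWithinAt 𝓘(ℝ, ℝ × EuclideanSpace ℝ (Fin 3))
        𝓘(ℝ, EuclideanSpace ℝ (Fin 3)) Prod.snd
        (range spacetimeModel) z (ContinuousLinearMap.snd ℝ ℝ (EuclideanSpace ℝ (Fin 3))) :=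
      hasFDerivWithinAt_snd.hasMFDerivWithinAt
    have h3 : HasMFDerivWithinAt 𝓘(ℝ, EuclideanSpace ℝ (Fin 3)) (𝓡∂ 3)
        (extChartAt (𝓡∂ 3) p).symm (range (𝓡∂ 3)) z.2 (chartFrame p z.2) :=
      (mdifferentiableWithinAt_extChartAt_symm hz).hasMFDerivWithinAt
    have h4 := h3.comp z h2 (by rw [range_spacetimeModel]; exact fun q hq => hq.2)
    exact h1.prodMk h4
  rw [chartMetric, hA, metricForm_apply]
  have := (G.α_pos (z.1, (extChartAt (𝓡∂ 3) p).symm z.2)).ne'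
  change -G.α (z.1, (extChartAt (𝓡∂ 3) p).symm z.2) * (u.1 * v.1)
    + G.κ (z.1, (extChartAt (𝓡∂ 3) p).symm z.2) (chartFrame p z.2 u.2) (chartFrame p z.2 v.2) = _
  obtain ⟨z₁, z₂⟩ := z
  rw [chartForm_apply]
  field_simp
  ring

end SplitMetric

/-! ### The geodesic equation in charts -/

set_option maxSynthPendingDepth 5 in
set_option synthInstance.maxHeartbeats 200000 in
theorem hasDerivWithinAt_bilinear {F : Type*} [NormedAddCommGroup F]
    [NormedSpace ℝ F] {M : F → F →L[ℝ] F →L[ℝ] ℝ} {M' : F →L[ℝ] F →L[ℝ] F →L[ℝ] ℝ} {D : Set F}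
    {Z W : ℝ → F} {Z' W' : F} {S S' : Set ℝ} {r : ℝ} (hM : HasFDerivWithinAt M M' D (Z r))
    (hZ : HasDerivWithinAt Z Z' S r) (hW : HasDerivWithinAt W W' S r) (hS' : S' ∈ 𝓝[S] r)
    (hmem : MapsTo Z S' D) (w : F) :
    HasDerivWithinAt (fun q => M (Z q) (W q) w) (M' Z' (W r) w + M (Z r) W' w) S r := by
  have hnh : S ∩ S' ∈ 𝓝[S] r := inter_mem self_mem_nhdsWithin hS'
  have e1 : HasDerivWithinAt (fun q => M (Z q)) (M' Z') (S ∩ S') r :=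
    hM.comp_hasDerivWithinAt r (hZ.mono inter_subset_left) fun q hq => hmem hq.2
  have e2 := ((e1.mono_of_mem_nhdsWithin hnh).clm_apply hW).clm_apply
    (hasDerivWithinAt_const r S w)
  refine e2.congr_deriv ?_
  simp

set_option maxSynthPendingDepth 5 in
set_option synthInstance.maxHeartbeats 200000 in
theorem hasFDerivWithinAt_apply_apply {F G : Type*} [NormedAddCommGroup F] [NormedSpace ℝ F]
    [NormedAddCommGroup G] [NormedSpace ℝ G]
    {M : F → G →L[ℝ] G →L[ℝ] ℝ} {M' : F →L[ℝ] G →L[ℝ] G →L[ℝ] ℝ} {D : Set F}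
    {z : F} (hM : HasFDerivWithinAt M M' D z) (u v : G) :
    HasFDerivWithinAt (fun z => M z u v) ((M'.flip u).flip v) D z := by
  have e := (hM.clm_apply (hasFDerivWithinAt_const u z D)).clm_apply (hasFDerivWithinAt_const v z D)
  refine e.congr_fderiv ?_
  ext k
  simp

namespace SplitMetric

variable {N : Type*} [TopologicalSpace N] [ChartedSpace (EuclideanHalfSpace 3) N]
  [IsManifold (𝓡∂ 3) ∞ N] (G : SplitMetric N)

theorem contDiffOn_α_chart (p : N) :
    ContDiffOn ℝ ∞ (fun z : ℝ × EuclideanSpace ℝ (Fin 3) =>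
      G.α (z.1, (extChartAt (𝓡∂ 3) p).symm z.2)) (univ ×ˢ (extChartAt (𝓡∂ 3) p).target) := by
  have hbase : ContMDiffOn 𝓘(ℝ, ℝ × EuclideanSpace ℝ (Fin 3)) spacetimeModel ∞
      (fun k : ℝ × EuclideanSpace ℝ (Fin 3) => (k.1, (extChartAt (𝓡∂ 3) p).symm k.2))
      (univ ×ˢ (extChartAt (𝓡∂ 3) p).target) :=
    contDiff_fst.contMDiff.contMDiffOn.prodMk ((contMDiffOn_extChartAt_symm p).comp
      contDiff_snd.contMDiff.contMDiffOn fun k hk => hk.2)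
  exact contMDiffOn_iff_contDiffOn.1 (G.α_smooth.comp_contMDiffOn hbase)

set_option maxSynthPendingDepth 5 in
theorem contDiffOn_metricForm (p : N) :
    ContDiffOn ℝ ∞ (G.metricForm p) (univ ×ˢ (extChartAt (𝓡∂ 3) p).target) := by
  rw [contDiffOn_clm_apply]
  intro u
  rw [contDiffOn_clm_apply]
  intro v
  have := (G.contDiffOn_α_chart p).mul ((((G.contDiffOn_chartForm p).clm_apply
    (contDiffOn_const (c := u.2))).clm_apply (contDiffOn_const (c := v.2))).sub
    (contDiffOn_const (c := u.1 * v.1)))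
  exact this.congr fun z _ => G.metricForm_apply p z u v

/-- The differential of the metric on a null vector: conformal invariance reduces it to that of
the form `h`. -/
theorem fderivWithin_metricForm_null (p : N) {z u : ℝ × EuclideanSpace ℝ (Fin 3)}
    (hz : z.2 ∈ (extChartAt (𝓡∂ 3) p).target) (hu : G.chartForm p z u.2 u.2 = u.1 * u.1)
    (w : ℝ × EuclideanSpace ℝ (Fin 3)) :
    fderivWithin ℝ (G.metricForm p) (univ ×ˢ (extChartAt (𝓡∂ 3) p).target) z w u u
      = G.α (z.1, (extChartAt (𝓡∂ 3) p).symm z.2) *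
        fderivWithin ℝ (G.chartForm p) (univ ×ˢ (extChartAt (𝓡∂ 3) p).target) z w u.2 u.2 := by
  set D : Set (ℝ × EuclideanSpace ℝ (Fin 3)) := univ ×ˢ (extChartAt (𝓡∂ 3) p).target with hD
  have hzD : z ∈ D := ⟨mem_univ _, hz⟩
  have hDu : UniqueDiffOn ℝ D :=
    uniqueDiffOn_univ.prod (uniqueDiffOn_extChartAt_target (I := 𝓡∂ 3) p)
  have h1 := ((G.contDiffOn_metricForm p).differentiableOn (by simp) z hzD).hasFDerivWithinAt
  have h2 := ((G.contDiffOn_α_chart p).differentiableOn (by simp) z hzD).hasFDerivWithinAt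
  have h3 := ((G.contDiffOn_chartForm p).differentiableOn (by simp) z hzD).hasFDerivWithinAt
  have h4 := hasFDerivWithinAt_apply_apply h1 u u
  have h5 := h2.mul ((hasFDerivWithinAt_apply_apply h3 u.2 u.2).sub_const (u.1 * u.1))
  have h6 := h4.congr (f₁ := fun z : ℝ × EuclideanSpace ℝ (Fin 3) =>
    G.α (z.1, (extChartAt (𝓡∂ 3) p).symm z.2) * (G.chartForm p z u.2 u.2 - u.1 * u.1))
    (fun y _ => (G.metricForm_apply p y u u).symm) (G.metricForm_apply p z u u).symm
  have h7 := DFunLike.congr_fun ((hDu z hzD).eq h6 h5) w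
  simpa only [ContinuousLinearMap.flip_apply, add_apply, smul_apply, smul_eq_mul, hu, sub_self,
    zero_mul, add_zero] using h7

/-- A curve is geodesic in a chart if the derivative of its momentum `g(Z', ·)` is half the
differential of the energy. -/
theorem chartMetric_add_christoffelFirst_eq_zero (t : ℝ) (p : N)
    {Z W : ℝ → ℝ × EuclideanSpace ℝ (Fin 3)} {S S' : Set ℝ} {r : ℝ} (hr : r ∈ S) (hS' : S' ∈ 𝓝[S] r)
    (hS : UniqueDiffOn ℝ S)
    (hmem : ∀ q ∈ S', (Z q).2 ∈ (extChartAt (𝓡∂ 3) p).target)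
    (hZ : ∀ᶠ q in 𝓝[S] r, HasDerivWithinAt Z (W q) S q) (hW : DifferentiableWithinAt ℝ W S r)
    (w : ℝ × EuclideanSpace ℝ (Fin 3))
    (hmom : HasDerivWithinAt (fun q => G.metricForm p (Z q) (W q) w)
      (1 / 2 * fderivWithin ℝ (G.metricForm p) (univ ×ˢ (extChartAt (𝓡∂ 3) p).target) (Z r) w
        (W r) (W r)) S r) :
    chartMetric spacetimeModel G.g (t, p) (Z r) (derivWithin (derivWithin Z S) S r) w
      + christoffelFirst spacetimeModel G.g (t, p) (Z r) (derivWithin Z S r) (derivWithin Z S r) w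
      = 0 := by
  set D : Set (ℝ × EuclideanSpace ℝ (Fin 3)) := univ ×ˢ (extChartAt (𝓡∂ 3) p).target with hD
  have hrS' : r ∈ S' := mem_of_mem_nhdsWithin hr hS'
  have hzD : Z r ∈ D := ⟨mem_univ _, hmem r hrS'⟩
  have hZW : ∀ᶠ q in 𝓝[S] r, derivWithin Z S q = W q := by
    filter_upwards [hZ, self_mem_nhdsWithin] with q hq hqS using hq.derivWithin (hS q hqS)
  have hZr : HasDerivWithinAt Z (W r) S r := hZ.self_of_nhdsWithin hr
  have hM := ((G.contDiffOn_metricForm p).differentiableOn (by simp) (Z r) hzD).hasFDerivWithinAt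
  have hW' : HasDerivWithinAt W (derivWithin (derivWithin Z S) S r) S r := by
    rw [Filter.EventuallyEq.derivWithin_eq hZW (hZW.self_of_nhdsWithin hr)]
    exact hW.hasDerivWithinAt
  set M' := fderivWithin ℝ (G.metricForm p) D (Z r) with hM'
  rw [hZr.derivWithin (hS r hr)]
  set W' := derivWithin (derivWithin Z S) S r
  have hprod := hasDerivWithinAt_bilinear hM hZr hW' hS'
    (fun q hq => ⟨mem_univ _, hmem q hq⟩) w
  have huniq := (hS r hr).eq_deriv _ hprod hmom
  -- The chart expression of the metric and its derivatives agree with `metricForm`.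
  have hDr : D ∈ 𝓝[range spacetimeModel] (Z r) := by
    rw [range_spacetimeModel, nhdsWithin_prod_eq]
    exact prod_mem_prod univ_mem (extChartAt_target_mem_nhdsWithin_of_mem (hmem r hrS'))
  have hrange : Z r ∈ range spacetimeModel := by
    rw [range_spacetimeModel]
    exact ⟨mem_univ _, extChartAt_target_subset_range p (hmem r hrS')⟩
  have hder : ∀ u v k : ℝ × EuclideanSpace ℝ (Fin 3),
      fderivWithin ℝ (fun z => chartMetric spacetimeModel G.g (t, p) z u v)
        (range spacetimeModel) (Z r) k = M' k u v := by
    intro u v k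
    have e1 := (hasFDerivWithinAt_apply_apply hM u v).mono_of_mem_nhdsWithin hDr
    have e2 := e1.congr_of_eventuallyEq
      (f₁ := fun z => chartMetric spacetimeModel G.g (t, p) z u v)
      (by filter_upwards [hDr] with z hz using G.chartMetric_eq_metricForm t p hz.2 u v)
      (G.chartMetric_eq_metricForm t p (hmem r hrS') u v)
    rw [e2.fderivWithin (spacetimeModel.uniqueDiffOn _ hrange)]
    rfl
  rw [christoffelFirst, hder, hder, G.chartMetric_eq_metricForm t p (hmem r hrS')]
  linarith

end SplitMetric

/-! ### The null geodesic -/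

theorem exists_exponential_weight {q : ℝ → ℝ} {t₀ t₁ : ℝ} (ht : t₀ < t₁)
    (hq : ContDiffOn ℝ ∞ q (Icc t₀ t₁)) : ∃ ρ : ℝ → ℝ, ContDiffOn ℝ ∞ ρ (Icc t₀ t₁) ∧
      (∀ s, 0 < ρ s) ∧ ∀ s ∈ Icc t₀ t₁, HasDerivWithinAt ρ (-(q s) * ρ s) (Icc t₀ t₁) s := by
  have hd : ∀ s ∈ Icc t₀ t₁, HasDerivWithinAt (fun s => Real.exp (-∫ r in t₀..s, q r))
      (-(q s) * Real.exp (-∫ r in t₀..s, q r)) (Icc t₀ t₁) s := fun s hs =>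
    ((hasDerivWithinAt_primitive hq.continuousOn hs).fun_neg.exp).congr_deriv (mul_comm _ _)
  refine ⟨_, ?_, fun s => Real.exp_pos _, hd⟩
  refine contDiffOn_of_hasDerivWithinAt (uniqueDiffOn_Icc ht) (D := Icc t₀ t₁ ×ˢ univ)
    (Φ := fun k => -(q k.1) * k.2) ?_ (fun s hs => ⟨hs, mem_univ _⟩) hd
  exact ((hq.comp contDiffOn_fst fun k hk => hk.1).neg).mul contDiffOn_snd

set_option maxSynthPendingDepth 5 in
set_option synthInstance.maxHeartbeats 200000 in
/-- Along an optimal motion, the momentum of the conformally rescaled metric, scaled by the weight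
`ρ`, changes by half the differential of the form. -/
theorem IsOptimalMotion.hasDerivWithinAt_momentum {E : Type*} [NormedAddCommGroup E]
    [InnerProductSpace ℝ E] {h : ℝ × E → E →L[ℝ] E →L[ℝ] ℝ} {D : Set (ℝ × E)} {y V : ℝ → E}
    {S : Set ℝ} (hm : IsOptimalMotion h D y V S) {s : ℝ} (hs : s ∈ S) {ρ : ℝ → ℝ}
    (hρ : HasDerivWithinAt ρ (-(halfTimeDeriv h D s (y s) (V s)) * ρ s) S s) (w : ℝ × E) :
    HasDerivWithinAt (fun r => ρ r * (h (r, y r) (V r) w.2 - w.1))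
      (ρ s * (1 / 2 * fderivWithin ℝ h D (s, y s) w (V s) (V s))) S s := by
  have h1 := (hm.momentum s hs).clm_apply (hasDerivWithinAt_const s S w.2)
  refine (hρ.mul (h1.sub_const w.1)).congr_deriv ?_
  have e : fderivWithin ℝ h D (s, y s) w (V s) (V s)
      = 2 * (w.1 * halfTimeDeriv h D s (y s) (V s) + halfPosDeriv h D s (y s) (V s) w.2) := by
    have : w = w.1 • ((1 : ℝ), (0 : E)) + ((0 : ℝ), w.2) := by ext <;> simp
    conv_lhs => rw [this]
    rw [map_add, map_smul, halfPosDeriv_apply, halfTimeDeriv]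
    simp only [add_apply, smul_apply, smul_eq_mul]
    ring
  rw [e]
  simp only [add_apply, smul_apply, smul_eq_mul, map_zero, add_zero]
  ring

namespace SplitMetric

variable {N : Type*} [TopologicalSpace N] [ChartedSpace (EuclideanHalfSpace 3) N]
  [IsManifold (𝓡∂ 3) ∞ N] {G : SplitMetric N} [T2Space N] [CompactSpace N]

/-- An unimprovable curve becomes an affinely parametrized null geodesic after a change of
parameter. The affine parameter is found by integrating the time component of the geodesic
equation, which makes `α dt/dλ` a constant multiple of `ρ`. -/
theorem IsUnimprovable.exists_isFutureNullGeodesic {x : ℝ → N} {t₀ t₁ : ℝ}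
    (h : G.IsUnimprovable x t₀ t₁) : ∃ θ : ℝ → ℝ, StrictMonoOn θ (Icc 0 1) ∧
      MapsTo θ (Icc 0 1) (Icc t₀ t₁) ∧ θ 0 = t₀ ∧ θ 1 = t₁ ∧
      G.IsFutureNullGeodesic fun r => (θ r, x (θ r)) := by
  obtain ⟨ρ, hρs, hρ0, hρd⟩ := exists_exponential_weight h.lt h.contDiffOn_energyRate
  have hxs := h.contMDiffOn
  have hαs : ContDiffOn ℝ ∞ (fun s => G.α (s, x s)) (Icc t₀ t₁) :=
    contMDiffOn_iff_contDiffOn.1 (G.α_smooth.comp_contMDiffOn (contMDiffOn_id.prodMk hxs))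
  set k : ℝ → ℝ := fun s => ρ s / G.α (s, x s) with hk
  have hks : ContDiffOn ℝ ∞ k (Icc t₀ t₁) := hρs.div hαs fun s _ => (G.α_pos _).ne'
  have hk0 : ∀ s, 0 < k s := fun s => div_pos (hρ0 s) (G.α_pos _)
  obtain ⟨c, hc, θ, hθs, hθm, hθI, hθ0, hθ1, hθd⟩ := exists_timeChange h.lt hks fun s _ => hk0 s
  refine ⟨θ, hθm, hθI, hθ0, hθ1, ?_⟩
  set μ : ℝ → ℝ × N := fun r => (θ r, x (θ r)) with hμ
  have hU : UniqueDiffOn ℝ (Icc (0 : ℝ) 1) := uniqueDiffOn_Icc one_pos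
  have hμs : ContMDiffOn 𝓘(ℝ, ℝ) spacetimeModel ∞ μ (Icc 0 1) :=
    hθs.contMDiffOn.prodMk (hxs.comp hθs.contMDiffOn hθI)
  -- The coordinate expression of the velocity, near a given parameter.
  have hloc : ∀ r ∈ Icc (0 : ℝ) 1, ∃ a b, t₀ ≤ a ∧ a < b ∧ b ≤ t₁ ∧ θ r ∈ Icc a b ∧
      Icc a b ∈ 𝓝[Icc t₀ t₁] θ r ∧
      (∀ s ∈ Icc a b, x s ∈ (extChartAt (𝓡∂ 3) (x (θ r))).source) ∧
      ∀ᶠ q in 𝓝[Icc 0 1] r, θ q ∈ Icc a b ∧ HasDerivWithinAt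
        (fun q => (θ q, extChartAt (𝓡∂ 3) (x (θ r)) (x (θ q))))
        (c * k (θ q), (c * k (θ q)) •
          derivWithin (fun s => extChartAt (𝓡∂ 3) (x (θ r)) (x s)) (Icc a b) (θ q))
        (Icc 0 1) q := by
    intro r hr
    obtain ⟨a, b, ha, hab, hb, hsab, hnhds, hsrc⟩ := h.exists_chart_Icc (hθI hr)
    refine ⟨a, b, ha, hab, hb, hsab, hnhds, hsrc, ?_⟩
    obtain ⟨-, hopt⟩ := h.contDiffOn_chart ha hab hb hsrc
    have hev : ∀ᶠ s in 𝓝[Icc t₀ t₁] θ r, Icc a b ∈ 𝓝[Icc t₀ t₁] s :=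
      eventually_eventually_nhdsWithin.2 hnhds
    have hθt : Tendsto θ (𝓝[Icc 0 1] r) (𝓝[Icc t₀ t₁] θ r) :=
      (hθs.continuousOn r hr).tendsto_nhdsWithin hθI
    filter_upwards [hθt.eventually hev, self_mem_nhdsWithin] with q hq hqI
    have hqab : θ q ∈ Icc a b := mem_of_mem_nhdsWithin (hθI hqI) hq
    have h1 := (hopt.hasDeriv _ hqab).mono_of_mem_nhdsWithin hq
    exact ⟨hqab, (hθd q hqI).prodMk (h1.scomp q (hθd q hqI) hθI)⟩
  refine ⟨⟨hμs, fun r hr w => ?_⟩, fun r hr => ?_⟩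
  · obtain ⟨a, b, ha, hab, hb, hsab, hnhds, hsrc, hev⟩ := hloc r hr
    set p := x (θ r) with hp
    obtain ⟨hys, hopt⟩ := h.contDiffOn_chart ha hab hb hsrc
    set y := fun s => extChartAt (𝓡∂ 3) p (x s) with hy
    set V := derivWithin y (Icc a b) with hV
    have hVs : ContDiffOn ℝ ∞ V (Icc a b) := hys.derivWithin (uniqueDiffOn_Icc hab) (by simp)
    set W : ℝ → ℝ × EuclideanSpace ℝ (Fin 3) := fun q => (c * k (θ q), (c * k (θ q)) • V (θ q))
      with hW
    have hθr := hθd r hr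
    have hWd : DifferentiableWithinAt ℝ W (Icc 0 1) r := by
      have e1 : DifferentiableWithinAt ℝ (fun q => c * k (θ q)) (Icc 0 1) r :=
        ((hks.differentiableOn (by simp) _ (hθI hr)).comp r hθr.differentiableWithinAt
          hθI).const_mul c
      have e2 : DifferentiableWithinAt ℝ (fun q => V (θ q)) (Icc 0 1) r :=
        ((hVs.differentiableOn (by simp) _ hsab).mono_of_mem_nhdsWithin hnhds).comp r
          hθr.differentiableWithinAt hθI
      exact e1.prodMk (e1.smul e2)
    refine G.chartMetric_add_christoffelFirst_eq_zero (θ r) p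
      (Z := fun q => (θ q, y (θ q))) (W := W) (S' := {q | θ q ∈ Icc a b}) hr
      (hev.mono fun q hq => hq.1) hU
      (fun q hq => (extChartAt (𝓡∂ 3) p).map_source (hsrc _ hq)) (hev.mono fun q hq => hq.2)
      hWd w ?_
    have hzt : y (θ r) ∈ (extChartAt (𝓡∂ 3) p).target :=
      (extChartAt (𝓡∂ 3) p).map_source (hsrc _ hsab)
    have hform : ∀ q, θ q ∈ Icc a b → G.metricForm p (θ q, y (θ q)) (W q) w
        = c * (ρ (θ q) * (G.chartForm p (θ q, y (θ q)) (V (θ q)) w.2 - w.1)) := by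
      intro q hq
      have e1 : (extChartAt (𝓡∂ 3) p).symm (y (θ q)) = x (θ q) :=
        (extChartAt (𝓡∂ 3) p).left_inv (hsrc _ hq)
      rw [G.metricForm_apply]
      simp only [hW, map_smul, smul_apply, smul_eq_mul, e1, hk]
      have := (G.α_pos (θ q, x (θ q))).ne'
      field_simp
    have hρd' := (hρd _ (hθI hr)).mono (Icc_subset_Icc ha hb)
    rw [h.energyRate_eq ha hab hb hsrc hsab] at hρd'
    have hmom := (((hopt.hasDerivWithinAt_momentum hsab hρd' w).mono_of_mem_nhdsWithin
      hnhds).const_mul c).comp r hθr hθI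
    have hmom' := hmom.congr_of_eventuallyEq
      (f₁ := fun q => G.metricForm p (θ q, y (θ q)) (W q) w)
      (hev.mono fun q hq => hform q hq.1) (hform r hsab)
    refine hmom'.congr_deriv ?_
    have hnull : G.chartForm p (θ r, y (θ r)) (W r).2 (W r).2 = (W r).1 * (W r).1 := by
      have := hopt.unit _ hsab
      simp only [hW, map_smul, smul_apply, smul_eq_mul]
      rw [this, mul_one]
    rw [G.fderivWithin_metricForm_null p hzt hnull w]
    have e1 : (extChartAt (𝓡∂ 3) p).symm (y (θ r)) = x (θ r) :=
      (extChartAt (𝓡∂ 3) p).left_inv (hsrc _ hsab)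
    simp only [hW, map_smul, smul_apply, smul_eq_mul, e1, hk]
    have := (G.α_pos (θ r, x (θ r))).ne'
    field_simp
  · obtain ⟨a, b, ha, hab, hb, hsab, hnhds, hsrc, hev⟩ := hloc r hr
    obtain ⟨v, h1, h2, h3⟩ := exists_hasDerivWithinAt_of_mdifferentiableWithinAt (G := G)
      ((hμs r hr).mdifferentiableWithinAt (by simp)) (x (θ r)) (hsrc _ hsab)
    obtain ⟨-, hopt⟩ := h.contDiffOn_chart ha hab hb hsrc
    have h4 := (hev.self_of_nhdsWithin hr).2
    have h5 := (ContinuousLinearMap.fst ℝ ℝ (EuclideanSpace ℝ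
      (Fin 3))).hasFDerivAt.comp_hasDerivWithinAt r h4
    have h6 := (ContinuousLinearMap.snd ℝ ℝ (EuclideanSpace ℝ
      (Fin 3))).hasFDerivAt.comp_hasDerivWithinAt r h4
    have e1 : (curveVelocity spacetimeModel μ (Icc 0 1) r).1 = c * k (θ r) :=
      (hU r hr).eq_deriv _ h1 h5
    have e2 : v = (c * k (θ r)) •
        derivWithin (fun s => extChartAt (𝓡∂ 3) (x (θ r)) (x s)) (Icc a b) (θ r) :=
      (hU r hr).eq_deriv _ h2 h6
    have hpos : 0 < (curveVelocity spacetimeModel μ (Icc 0 1) r).1 :=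
      e1 ▸ mul_pos hc (hk0 _)
    refine ⟨?_, ?_, hpos⟩
    · intro h0
      rw [h0] at hpos
      exact lt_irrefl _ hpos
    · rw [h3, e1, e2]
      have := hopt.unit _ hsab
      simp only [map_smul, smul_apply, smul_eq_mul, hμ]
      rw [this]
      ring

end SplitMetric

theorem mainTheorem7 {N : Type*} [TopologicalSpace N] [T2Space N] [CompactSpace N]
    [ConnectedSpace N] [ChartedSpace (EuclideanHalfSpace 3) N] [IsManifold (𝓡∂ 3) ∞ N]
    (G : SplitMetric N) (T : ℝ) (q₀ : ℝ × N)
    (hq₀ : q₀ ∈ G.diamondUnion T ∩ Ioo (0 : ℝ) T ×ˢ (𝓡∂ 3).interior N) :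
    ∃ μ : ℝ → ℝ × N,
      G.IsFutureNullGeodesic μ ∧
      μ 0 ∈ Ioo (0 : ℝ) T ×ˢ (𝓡∂ 3).boundary N ∧
      μ 1 = q₀ ∧
      G.HasNoCutPoints μ := by
  obtain ⟨hmem, hq₀T, hq₀i⟩ := hq₀
  simp only [SplitMetric.diamondUnion, mem_iUnion] at hmem
  obtain ⟨p, ⟨hpT, hpb⟩, q, -, hpq, -⟩ := hmem
  obtain ⟨x, t, hpt, hxb, hxq, hx⟩ := SplitMetric.exists_isUnimprovable hq₀i hpb
    (SplitMetric.reach_of_causalLE hpq)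
  obtain ⟨θ, hθm, hθI, hθ0, hθ1, hgeo⟩ := hx.exists_isFutureNullGeodesic
  refine ⟨fun r => (θ r, x (θ r)), hgeo, ?_, ?_, ?_⟩
  · simp only [hθ0]
    exact ⟨⟨hpT.1.trans_le hpt, hx.lt.trans hq₀T.2⟩, hxb⟩
  · simp only [hθ1, hxq]
  · intro s hs r hr hchron
    -- A chronological relation would allow a later departure from `μ s`.
    obtain ⟨m, δ, hδ, hm, hmr⟩ := hchron.exists_reach
    obtain ⟨ε, hε, h1⟩ := hm.exists_later_departure hδ hmr
    exact hx.not_reach _ (hθI hs) ε hε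
      (h1.trans (hx.causal.reach (hθI hr).1 (hθI hr).2 le_rfl))

end
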